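/- Let $M$ be a smooth manifold of dimension $n\ge 2$. All connections and metrics are smooth, and metrics are pseudo-Riemannian of any signature. Square brackets around indices denote skew-symmetrization and parentheses symmetrization. **Definitions.** A *CP pair* $([\nabla],[h])$ is a projective structure $[\nabla]$ (a class of affine connections with the same unparameterized geodesics) with a conformal structure $[h]$. Torsion-free connections $\nabla,\bar\nabla$ are $[h]$-conformal projectively equivalent if the completely $h$-trace-free part of $\bar\nabla-\nabla$ vanishes, i.e. $\bar\nabla-\nabla=2\alpha_{(i}\delta_{j)}{}^k+h_{ij}\beta^k$. A *conformal projective structure* $(\{\nabla\},[h])$ is such an equivalence class together with $[h]$; it is *generated* by $([\nabla],[h])$ if the torsion-free members of $[\nabla]$ lie in $\{\nabla\}$. The *cubic torsion* is $\mathcal L_{ij}{}^k=h^{kp}\mathcal L_{ijp}$, where $\mathcal L_{ijk}$ is the completely trace-free part of $\nabla_{(i}h_{jk)}$, and the *conformal torsion* is $h^{kp}\mathcal K_{ijp}$, where $\mathcal K_{ijk}$ is the completely trace-free part of $\tfrac43\nabla_{[i}h_{j]k}$. These depend only on $(\{\nabla\},[h])$. A CP pair with zero conformal torsion is an *AH structure*;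 a conformal projective structure with zero conformal torsion is a *Codazzi projective structure*. The *aligned representative* of a CP pair is the torsion-free $\nabla\in[\nabla]$ with $h^{pq}\nabla_ih_{pq}=nh^{pq}\nabla_ph_{qi}$ for all $h\in[h]$. Its *Faraday primitive* for $h$ is $\gamma_i=\tfrac1{2n}h^{pq}\nabla_ih_{pq}$. Indices are raised and lowered with the density-valued metric $H_{ij}=|\det h|^{-1/n}h_{ij}$ and its inverse $H^{ij}$. For an AH structure with aligned representative $\nabla$, let $2\nabla_{[i}\nabla_{j]}X^k=R_{ijp}{}^kX^p$, $R_{ij}=R_{pij}{}^p$, $R=H^{ij}R_{ij}$, $F_{ij}=\tfrac1nR_{ijp}{}^p$. For a tensor $B_{ijkl}$ with $B_{(ij)kl}=0=B_{[ijk]l}$ put $\mathcal P_1(B)_{ijkl}=\tfrac34(B_{i(jkl)}-B_{j(ikl)})$ and $\mathcal P_2(B)_{ijkl}=\tfrac12(B_{ij[kl]}+B_{kl[ij]})$. Let $T=\mathcal P_2(R)$ and $U=\mathcal P_1(R-\mathsf r(F))$, where $\mathsf r(F)_{ijkl}=F_{ij}H_{kl}-F_{k[i}H_{j]l}+F_{l[i}H_{j]k}$,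 and let $T_{ij}=T_{pij}{}^p$, $U_{ij}=U_{pij}{}^p$. Put $E_{ij}=-\tfrac1nU_{ij}$ and $A_{ij}=\tfrac1{2-n}\bigl(T_{ij}+\tfrac{R}{2(1-n)}H_{ij}\bigr)$ (for $n=2$, $A_{ij}=-\tfrac R4H_{ij}$). The *self-conjugate* and *anti-self-conjugate Weyl tensors* $A_{ijkl}$ and $E_{ijkl}$, which are completely trace-free, are given by $$T_{ijkl}=A_{ijkl}-2H_{l[i}A_{j]k}+2H_{k[i}A_{j]l},\qquad U_{ijkl}=E_{ijkl}-2H_{l[i}E_{j]k}-2H_{k[i}E_{j]l}.$$ Let $W_{ijkl}=A_{ijkl}+E_{ijkl}$, $W_{ij}=A_{ij}+E_{ij}+\tfrac12F_{ij}$, and $$w_{ijk}=2\nabla_{[i}W_{j]k},$$ $$a_{ijk}=2\nabla_{[i}A_{j]k}+\nabla_{[i}F_{j]k}-\mathcal L_{k[i}{}^pA_{j]p}-\tfrac12\mathcal L_{k[i}{}^pF_{j]p}+\mathcal L_{k[i}{}^pE_{j]p},$$ $$e_{ijk}=2\nabla_{[i}E_{j]k}+\mathcal L_{k[i}{}^pA_{j]p}+\tfrac12\mathcal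 L_{k[i}{}^pF_{j]p}-\mathcal L_{k[i}{}^pE_{j]p}.$$ Let $W_i=w_{ip}{}^p$, $A_i=a_{ip}{}^p$, $E_i=e_{ip}{}^p$, and let $W_{ijk}=w_{ijk}-\tfrac2{n-1}W_{[i}H_{j]k}$, $A_{ijk}=a_{ijk}-\tfrac2{n-1}A_{[i}H_{j]k}$, $E_{ijk}=e_{ijk}-\tfrac2{n-1}E_{[i}H_{j]k}$. **Theorem.** Let $([\nabla],[h])$ and $([\tilde\nabla],[h])$ be AH structures on $M$ generating the same Codazzi projective structure, with aligned representatives $\nabla$ and $\tilde\nabla$, and decorate with a tilde the tensors of the second. Let $\alpha_i=\gamma_i-\tilde\gamma_i$ be the difference of the Faraday primitives for any $h\in[h]$. Then $\tilde\nabla-\nabla=2\alpha_{(i}\delta_{j)}{}^k-H_{ij}\alpha^k$, and: 1. $\tilde A_{ijkl}=A_{ijkl}$ and $\tilde E_{ijkl}=E_{ijkl}$. 2. If $n>2$, then $\tilde W_{ijk}=W_{ijk}-\alpha^pW_{ijkp}$, $\tilde A_{ijk}=A_{ijk}-\alpha^pA_{ijkp}$, $\tilde E_{ijk}=E_{ijk}-\alpha^pE_{ijkp}$,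 and $\tilde A_i=A_i$. 3. If $n=3$, then $A_{ijkl}=0$ and $\tilde A_{ijk}=A_{ijk}$. -/

import Mathlib

open scoped Manifold ContDiff

noncomputable section

namespace AHGeometry

/-- The model space `ℝⁿ`. -/
abbrev Model (n : ℕ) : Type := EuclideanSpace ℝ (Fin n)

/-- The coordinate partial derivative `∂ᵢ f` at `y`. -/
def pd {n : ℕ} (i : Fin n) (f : Model n → ℝ) (y : Model n) : ℝ :=
  fderiv ℝ f y (EuclideanSpace.single i 1)

/-! ### Algebraic operations on the components of tensors at a point

In the next definitions `g` is the matrix of a metric and `A` is a covariant 3-tensor. -/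

section Algebra

variable {n : ℕ}

/-- `h^{pq} A_{i p q}`. -/
def tr23 (g : Matrix (Fin n) (Fin n) ℝ) (A : Fin n → Fin n → Fin n → ℝ) (i : Fin n) : ℝ :=
  ∑ p, ∑ q, g⁻¹ p q * A i p q

/-- `h^{pq} A_{p i q}`. -/
def tr13 (g : Matrix (Fin n) (Fin n) ℝ) (A : Fin n → Fin n → Fin n → ℝ) (i : Fin n) : ℝ :=
  ∑ p, ∑ q, g⁻¹ p q * A p i q

/-- `h^{pq} A_{p q i}`. -/
def tr12 (g : Matrix (Fin n) (Fin n) ℝ) (A : Fin n → Fin n → Fin n → ℝ) (i : Fin n) : ℝ :=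
  ∑ p, ∑ q, g⁻¹ p q * A p q i

/-- Complete symmetrization `A_{(ijk)}`. -/
def sym3 (A : Fin n → Fin n → Fin n → ℝ) (i j k : Fin n) : ℝ :=
  (A i j k + A i k j + A j i k + A j k i + A k i j + A k j i) / 6

/-- The completely trace-free part of `A_{(ijk)}`. -/
def tfSym (g : Matrix (Fin n) (Fin n) ℝ) (A : Fin n → Fin n → Fin n → ℝ) (i j k : Fin n) : ℝ :=
  sym3 A i j k - 1 / ((n : ℝ) + 2) *
    (g i j * tr12 g (sym3 A) k + g j k * tr12 g (sym3 A) i + g k i * tr12 g (sym3 A) j)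

/-- The completely trace-free part of `(2/3) (A_{i(jk)} - A_{j(ik)})`. -/
def tfHook (g : Matrix (Fin n) (Fin n) ℝ) (A : Fin n → Fin n → Fin n → ℝ) (i j k : Fin n) : ℝ :=
  2 / 3 * ((A i j k + A i k j) / 2 - (A j i k + A j k i) / 2 + 1 / ((n : ℝ) - 1) *
    ((g k i * tr23 g A j - g k j * tr23 g A i)
      - (tr13 g A j * g i k - tr13 g A i * g j k) / 2
      - (tr12 g A j * g i k - tr12 g A i * g j k) / 2))

/-- The first projection of an algebraic curvature tensor `B`,
`(3/4) (B_{i(jkl)} - B_{j(ikl)})`. -/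
def proj1 (B : Fin n → Fin n → Fin n → Fin n → ℝ) (i j k l : Fin n) : ℝ :=
  3 / 4 * (sym3 (B i) j k l - sym3 (B j) i k l)

/-- The second projection of an algebraic curvature tensor `B`,
`(1/2) (B_{ij[kl]} + B_{kl[ij]})`. -/
def proj2 (B : Fin n → Fin n → Fin n → Fin n → ℝ) (i j k l : Fin n) : ℝ :=
  1 / 2 * ((B i j k l - B i j l k) / 2 + (B k l i j - B k l j i) / 2)

end Algebra

/-! ### Local coordinate expressions -/

/-- The coordinate expression of an affine connection (`Γ y i j k` is `Γ_{ij}^k`, that is,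
`∇_{∂_i} ∂_j = Γ_{ij}^k ∂_k`) and of a metric `g`. -/
structure LocalData (n : ℕ) where
  Γ : Model n → Fin n → Fin n → Fin n → ℝ
  g : Model n → Matrix (Fin n) (Fin n) ℝ

namespace LocalData

variable {n : ℕ} (D : LocalData n)

/-- The covariant derivative `∇_i X_{jk}` of a covariant 2-tensor. -/
def nabla (X : Model n → Fin n → Fin n → ℝ) (y : Model n) (i j k : Fin n) : ℝ :=
  pd i (fun z => X z j k) y - ∑ p, D.Γ y i j p * X y p k - ∑ p, D.Γ y i k p * X y j p

/-- `2 ∇_{[i} X_{j]k}`. -/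
def skewNabla (X : Model n → Fin n → Fin n → ℝ) (y : Model n) (i j k : Fin n) : ℝ :=
  D.nabla X y i j k - D.nabla X y j i k

/-- `∇_i h_{jk}`. -/
def nablaMetric (y : Model n) (i j k : Fin n) : ℝ := D.nabla D.g y i j k

/-- The one-form `γ_i` with `2 n γ_i = h^{pq} ∇_i h_{pq}`. -/
def faraday (y : Model n) (i : Fin n) : ℝ :=
  1 / (2 * (n : ℝ)) * tr23 (D.g y) (D.nablaMetric y) i

/-- The alignment condition `h^{pq} ∇_i h_{pq} = n h^{pq} ∇_p h_{qi}` at `y`. -/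
def AlignedAt (y : Model n) : Prop :=
  ∀ i, tr23 (D.g y) (D.nablaMetric y) i = n * tr12 (D.g y) (D.nablaMetric y) i

/-- The cubic torsion `𝓛_{ij}^k`. -/
def cubicTorsion (y : Model n) (i j k : Fin n) : ℝ :=
  ∑ p, (D.g y)⁻¹ k p * tfSym (D.g y) (D.nablaMetric y) i j p

/-- The conformal torsion `𝓚_{ij}^k`. -/
def conformalTorsion (y : Model n) (i j k : Fin n) : ℝ :=
  ∑ p, (D.g y)⁻¹ k p * tfHook (D.g y) (D.nablaMetric y) i j p

/-- The normalized metric `H_{ij} = |det h|^{-1/n} h_{ij}` (components with respect to the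
coordinate density). -/
def H (y : Model n) (i j : Fin n) : ℝ := |(D.g y).det| ^ (-(1 / (n : ℝ))) * D.g y i j

/-- The dual `H^{ij} = |det h|^{1/n} h^{ij}` of the normalized metric. -/
def Hinv (y : Model n) (i j : Fin n) : ℝ := |(D.g y).det| ^ (1 / (n : ℝ)) * (D.g y)⁻¹ i j

/-- The curvature `R_{ijk}^l`, with the convention `2 ∇_{[i} ∇_{j]} X^l = R_{ijk}^l X^k`. -/
def curv (y : Model n) (i j k l : Fin n) : ℝ :=
  pd i (fun z => D.Γ z j k l) y - pd j (fun z => D.Γ z i k l) y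
    + ∑ p, (D.Γ y i p l * D.Γ y j k p - D.Γ y j p l * D.Γ y i k p)

/-- `R_{ijkl} = R_{ijk}^p H_{pl}`. -/
def curvLow (y : Model n) (i j k l : Fin n) : ℝ := ∑ p, D.curv y i j k p * D.H y p l

/-- The Ricci curvature `R_{ij} = R_{pij}^p`. -/
def ricci (y : Model n) (i j : Fin n) : ℝ := ∑ p, D.curv y p i j p

/-- The weighted scalar curvature `R = H^{ij} R_{ij}`. -/
def scal (y : Model n) : ℝ := ∑ i, ∑ j, D.Hinv y i j * D.ricci y i j

/-- The Faraday form `F_{ij}`, with `n F_{ij} = R_{ijp}^p`. -/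
def faradayForm (y : Model n) (i j : Fin n) : ℝ := 1 / (n : ℝ) * ∑ p, D.curv y i j p p

/-- `F_{ij} H_{kl} - F_{k[i} H_{j]l} + F_{l[i} H_{j]k}`. -/
def faradayCurv (y : Model n) (i j k l : Fin n) : ℝ :=
  D.faradayForm y i j * D.H y k l
    - (D.faradayForm y k i * D.H y j l - D.faradayForm y k j * D.H y i l) / 2
    + (D.faradayForm y l i * D.H y j k - D.faradayForm y l j * D.H y i k) / 2

/-- `U_{ijkl}`, the first projection of `R_{ijkl} - (F_{ij} H_{kl} - F_{k[i} H_{j]l} +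
F_{l[i} H_{j]k})`. -/
def U4 (y : Model n) (i j k l : Fin n) : ℝ :=
  proj1 (fun a b c d => D.curvLow y a b c d - D.faradayCurv y a b c d) i j k l

/-- `T_{ijkl}`, the second projection of `R_{ijkl}`. -/
def T4 (y : Model n) (i j k l : Fin n) : ℝ := proj2 (D.curvLow y) i j k l

/-- The Ricci trace `U_{ij} = U_{pij}^p`. -/
def U2 (y : Model n) (i j : Fin n) : ℝ := ∑ p, ∑ q, D.Hinv y p q * D.U4 y p i j q

/-- The Ricci trace `T_{ij} = T_{pij}^p`. -/
def T2 (y : Model n) (i j : Fin n) : ℝ := ∑ p, ∑ q, D.Hinv y p q * D.T4 y p i j q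

/-- The self-conjugate Schouten tensor `A_{ij}`. For `n > 2` this is
`(1/(2-n)) (T_{ij} + (R/(2(1-n))) H_{ij})`, see `A2_eq`; it is written here as a multiple of the
trace-free part of `T_{ij}` plus a multiple of `H_{ij}`. For `n = 2` that trace-free part is zero,
and the remaining term is the one for which the tensor `A4` below is completely trace-free. -/
def A2 (y : Model n) (i j : Fin n) : ℝ :=
  1 / (2 - (n : ℝ)) * (D.T2 y i j - D.scal y / n * D.H y i j)
    - D.scal y / (2 * n * ((n : ℝ) - 1)) * D.H y i j

theorem A2_eq (hn : 2 < n) (y : Model n) (i j : Fin n) :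
    D.A2 y i j = 1 / (2 - (n : ℝ)) *
      (D.T2 y i j + D.scal y / (2 * (1 - (n : ℝ))) * D.H y i j) := by
  have h2 : (2 : ℝ) < n := by exact_mod_cast hn
  have e1 : (n : ℝ) ≠ 0 := by linarith
  have e2 : (2 - (n : ℝ)) ≠ 0 := by linarith
  have e3 : (1 - (n : ℝ)) ≠ 0 := by linarith
  have e4 : ((n : ℝ) - 1) ≠ 0 := by linarith
  unfold A2
  field_simp
  ring

/-- `E_{ij} = -(1/n) U_{ij}`. -/
def E2 (y : Model n) (i j : Fin n) : ℝ := -(1 / (n : ℝ)) * D.U2 y i j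

/-- The self-conjugate Weyl tensor `A_{ijkl}`, defined by
`T_{ijkl} = A_{ijkl} - 2 H_{l[i} A_{j]k} + 2 H_{k[i} A_{j]l}`. -/
def A4 (y : Model n) (i j k l : Fin n) : ℝ :=
  D.T4 y i j k l
    + (D.H y l i * D.A2 y j k - D.H y l j * D.A2 y i k)
    - (D.H y k i * D.A2 y j l - D.H y k j * D.A2 y i l)

/-- The anti-self-conjugate Weyl tensor `E_{ijkl}`, defined by
`U_{ijkl} = E_{ijkl} - 2 H_{l[i} E_{j]k} - 2 H_{k[i} E_{j]l}`. -/
def E4 (y : Model n) (i j k l : Fin n) : ℝ :=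
  D.U4 y i j k l
    + (D.H y l i * D.E2 y j k - D.H y l j * D.E2 y i k)
    + (D.H y k i * D.E2 y j l - D.H y k j * D.E2 y i l)

/-- `W_{ijkl} = A_{ijkl} + E_{ijkl}`. -/
def W4 (y : Model n) (i j k l : Fin n) : ℝ := D.A4 y i j k l + D.E4 y i j k l

/-- `W_{ij} = A_{ij} + E_{ij} + (1/2) F_{ij}`. -/
def W2 (y : Model n) (i j : Fin n) : ℝ :=
  D.A2 y i j + D.E2 y i j + 1 / 2 * D.faradayForm y i j

/-- `𝓛_{k[i}^p X_{j]p}`. -/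
def cubicSkew (X : Model n → Fin n → Fin n → ℝ) (y : Model n) (i j k : Fin n) : ℝ :=
  (∑ p, (D.cubicTorsion y k i p * X y j p - D.cubicTorsion y k j p * X y i p)) / 2

/-- `w_{ijk} = 2 ∇_{[i} W_{j]k}`. -/
def w3 (y : Model n) (i j k : Fin n) : ℝ := D.skewNabla D.W2 y i j k

/-- `a_{ijk} = 2 ∇_{[i} A_{j]k} + ∇_{[i} F_{j]k} - 𝓛_{k[i}^p A_{j]p} - (1/2) 𝓛_{k[i}^p F_{j]p}
+ 𝓛_{k[i}^p E_{j]p}`. -/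
def a3 (y : Model n) (i j k : Fin n) : ℝ :=
  D.skewNabla D.A2 y i j k + 1 / 2 * D.skewNabla D.faradayForm y i j k
    - D.cubicSkew D.A2 y i j k - 1 / 2 * D.cubicSkew D.faradayForm y i j k
    + D.cubicSkew D.E2 y i j k

/-- `e_{ijk} = 2 ∇_{[i} E_{j]k} + 𝓛_{k[i}^p A_{j]p} + (1/2) 𝓛_{k[i}^p F_{j]p}
- 𝓛_{k[i}^p E_{j]p}`. -/
def e3 (y : Model n) (i j k : Fin n) : ℝ :=
  D.skewNabla D.E2 y i j k
    + D.cubicSkew D.A2 y i j k + 1 / 2 * D.cubicSkew D.faradayForm y i j k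
    - D.cubicSkew D.E2 y i j k

/-- The trace `X_i = X_{ip}^p` (indices raised with `H`). -/
def trace3 (X : Model n → Fin n → Fin n → Fin n → ℝ) (y : Model n) (i : Fin n) : ℝ :=
  ∑ p, ∑ q, D.Hinv y p q * X y i p q

/-- `X_{ijk} - (2/(n-1)) X_{[i} H_{j]k}`, where `X_i = X_{ip}^p`. -/
def traceFree3 (X : Model n → Fin n → Fin n → Fin n → ℝ) (y : Model n) (i j k : Fin n) : ℝ :=
  X y i j k - 1 / ((n : ℝ) - 1) *
    (D.trace3 X y i * D.H y j k - D.trace3 X y j * D.H y i k)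

/-- The trace `A_i = a_{ip}^p`. -/
def A1 (y : Model n) (i : Fin n) : ℝ := D.trace3 D.a3 y i

/-- `W_{ijk}`, the trace-free part of `w_{ijk}`. -/
def W3 (y : Model n) (i j k : Fin n) : ℝ := D.traceFree3 D.w3 y i j k

/-- `A_{ijk}`, the trace-free part of `a_{ijk}`. -/
def A3 (y : Model n) (i j k : Fin n) : ℝ := D.traceFree3 D.a3 y i j k

/-- `E_{ijk}`, the trace-free part of `e_{ijk}`. -/
def E3 (y : Model n) (i j k : Fin n) : ℝ := D.traceFree3 D.e3 y i j k

/-- `α^k = H^{kp} α_p`. -/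
def raise (y : Model n) (α : Fin n → ℝ) (k : Fin n) : ℝ := ∑ p, D.Hinv y k p * α p

end LocalData

/-! ### Connections and metrics on a manifold -/

section Manifold

variable (n : ℕ) (M : Type*) [TopologicalSpace M] [ChartedSpace (Model n) M]
  [IsManifold (𝓡 n) ∞ M]

/-- A smooth affine connection on `M`. -/
structure AffineConnection where
  cov : CovariantDerivative (𝓡 n) (Model n) (TangentSpace (𝓡 n) : M → Type _)
  smooth : ∀ u : Set M, IsOpen u → ContMDiffCovariantDerivativeOn (Model n) ∞ cov.toFun u

/-- A smooth pseudo-Riemannian metric on `M`. -/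
structure PseudoMetric where
  inner (x : M) : TangentSpace (𝓡 n) x →L[ℝ] TangentSpace (𝓡 n) x →L[ℝ] ℝ
  symm (x : M) (v w : TangentSpace (𝓡 n) x) : inner x v w = inner x w v
  nondegenerate (x : M) (v : TangentSpace (𝓡 n) x) : (∀ w, inner x v w = 0) → v = 0
  smooth : ContMDiff (𝓡 n) ((𝓡 n).prod 𝓘(ℝ, Model n →L[ℝ] Model n →L[ℝ] ℝ)) ∞
    (fun x => Bundle.TotalSpace.mk' (Model n →L[ℝ] Model n →L[ℝ] ℝ)
      (E := fun x : M => TangentSpace (𝓡 n) x →L[ℝ] TangentSpace (𝓡 n) x →L[ℝ] ℝ) x (inner x))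

variable {n M}

/-- The constant vector field `∂_i` on the model space. -/
def constField (i : Fin n) (y : Model n) : TangentSpace (𝓡 n) y :=
  (EuclideanSpace.single i (1 : ℝ) : Model n)

/-- The coordinate vector field `∂_i` of the chart `e` (meaningful on the domain of `e`). -/
def coordField (e : OpenPartialHomeomorph M (Model n)) (i : Fin n) (x : M) :
    TangentSpace (𝓡 n) x :=
  VectorField.mpullback (𝓡 n) (𝓡 n) e (constField i) x

/-- The `k`-th component, in the chart `e`, of a tangent vector. -/
def coordComp (e : OpenPartialHomeomorph M (Model n)) (x : M) (v : TangentSpace (𝓡 n) x)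
    (k : Fin n) : ℝ :=
  let w : Model n := mfderiv (𝓡 n) (𝓡 n) e x v
  w k

namespace AffineConnection

/-- The Christoffel symbols `Γ_{ij}^k` in the chart `e`. -/
def christoffel (nab : AffineConnection n M) (e : OpenPartialHomeomorph M (Model n))
    (y : Model n) (i j k : Fin n) : ℝ :=
  coordComp e (e.symm y) (nab.cov (coordField e j) (e.symm y) (coordField e i (e.symm y))) k

/-- The coordinate expression of a connection and a metric in the chart `e`. -/
def inChart (nab : AffineConnection n M) (h : PseudoMetric n M)
    (e : OpenPartialHomeomorph M (Model n)) : LocalData n where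
  Γ := nab.christoffel e
  g y i j := h.inner (e.symm y) (coordField e i (e.symm y)) (coordField e j (e.symm y))

def IsTorsionFree (nab : AffineConnection n M) : Prop := nab.cov.torsion = 0

/-- `γ` restricted to the open interval `J` is a (smooth, affinely parameterized) geodesic. -/
def IsGeodesicOn (nab : AffineConnection n M) (γ : ℝ → M) (J : Set ℝ) : Prop :=
  IsOpen J ∧ J.OrdConnected ∧ J.Nonempty ∧ ContMDiffOn 𝓘(ℝ) (𝓡 n) ∞ γ J ∧
    ∀ e ∈ IsManifold.maximalAtlas (𝓡 n) ∞ M, ∀ t ∈ J, γ t ∈ e.source → ∀ k,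
      iteratedDeriv 2 (fun s => e (γ s) k) t + ∑ i, ∑ j, nab.christoffel e (e (γ t)) i j k *
        deriv (fun s => e (γ s) i) t * deriv (fun s => e (γ s) j) t = 0

/-- The images of the geodesics of a connection. -/
def unparamGeodesics (nab : AffineConnection n M) : Set (Set M) :=
  {s | ∃ γ J, nab.IsGeodesicOn γ J ∧ γ '' J = s}

/-- Projective equivalence: the same unparameterized geodesics. -/
def ProjEquiv (nab nab' : AffineConnection n M) : Prop :=
  nab.unparamGeodesics = nab'.unparamGeodesics

end AffineConnection

/-- Two metrics are conformal if they differ by a smooth positive factor. -/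
def PseudoMetric.ConfEquiv (h h' : PseudoMetric n M) : Prop :=
  ∃ f : M → ℝ, ContMDiff (𝓡 n) 𝓘(ℝ) ∞ f ∧ (∀ x, 0 < f x) ∧
    ∀ x v w, h'.inner x v w = f x * h.inner x v w

variable (n M) in
/-- A projective structure: a projective equivalence class of affine connections. -/
structure ProjectiveStructure where
  carrier : Set (AffineConnection n M)
  isClass : ∃ nab : AffineConnection n M, carrier = {nab' | nab.ProjEquiv nab'}

variable (n M) in
/-- A conformal structure: a conformal class of pseudo-Riemannian metrics. -/
structure ConformalStructure where
  carrier : Set (PseudoMetric n M)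
  isClass : ∃ h : PseudoMetric n M, carrier = {h' | h.ConfEquiv h'}

/-- Conformal projective equivalence with respect to a conformal structure `c`: the difference
tensor `∇' - ∇` has zero completely trace-free part, that is, it has the form
`2 α_{(i} δ_{j)}^k + h_{ij} β^k`. -/
def ConfProjEquiv (c : ConformalStructure n M) (nab nab' : AffineConnection n M) : Prop :=
  ∀ h ∈ c.carrier, ∀ x : M, ∃ (α : TangentSpace (𝓡 n) x →L[ℝ] ℝ) (β : TangentSpace (𝓡 n) x),
    ∀ u v : TangentSpace (𝓡 n) x,
      nab'.cov.difference nab.cov x v u = α u • v + α v • u + h.inner x u v • β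

/-- The conformal torsion of `∇` with respect to `h` vanishes. -/
def ConformalTorsionVanishes (nab : AffineConnection n M) (h : PseudoMetric n M) : Prop :=
  ∀ e ∈ IsManifold.maximalAtlas (𝓡 n) ∞ M, ∀ y ∈ e.target, ∀ i j k,
    (nab.inChart h e).conformalTorsion y i j k = 0

variable (n M) in
/-- A conformal projective structure: a conformal structure together with an equivalence class of
conformal projectively equivalent torsion-free connections. -/
structure ConformalProjectiveStructure where
  conf : ConformalStructure n M
  carrier : Set (AffineConnection n M)
  isClass : ∃ nab : AffineConnection n M, nab.IsTorsionFree ∧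
    carrier = {nab' | nab'.IsTorsionFree ∧ ConfProjEquiv conf nab nab'}

variable (n M) in
/-- A Codazzi projective structure: a conformal projective structure with zero conformal
torsion. -/
structure CodazziProjectiveStructure extends ConformalProjectiveStructure n M where
  codazzi : ∀ nab ∈ carrier, ∀ h ∈ conf.carrier, ConformalTorsionVanishes nab h

variable (n M) in
/-- A conformal projective pair: a projective structure and a conformal structure. -/
structure CPPair where
  proj : ProjectiveStructure n M
  conf : ConformalStructure n M

/-- A CP pair generates a conformal projective structure if they have the same conformal structure
and the (torsion-free) connections of its projective structure belong to the latter. -/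
def CPPair.Generates (S : CPPair n M) (P : ConformalProjectiveStructure n M) : Prop :=
  S.conf = P.conf ∧ ∀ nab ∈ S.proj.carrier, nab.IsTorsionFree → nab ∈ P.carrier

/-- `∇` is the aligned representative of the CP pair: it is torsion-free, it represents the
projective structure, and it is aligned with respect to the metrics of the conformal structure. -/
def CPPair.IsAlignedRepresentative (S : CPPair n M) (nab : AffineConnection n M) : Prop :=
  nab ∈ S.proj.carrier ∧ nab.IsTorsionFree ∧ ∀ h ∈ S.conf.carrier,
    ∀ e ∈ IsManifold.maximalAtlas (𝓡 n) ∞ M, ∀ y ∈ e.target, (nab.inChart h e).AlignedAt y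

variable (n M) in
/-- An AH structure: a CP pair with zero conformal torsion. -/
structure AHStructure extends CPPair n M where
  codazzi : ∀ nab ∈ proj.carrier, nab.IsTorsionFree → ∀ h ∈ conf.carrier,
    ConformalTorsionVanishes nab h

end Manifold

end AHGeometry

end

/-! All computations are made in one chart, with the normalized metric H, which is the same for all
metrics of the conformal class. For an aligned representative, vanishing conformal torsion means ∇_i
H_jk = θ_i H_jk + 𝓛_ijk with 𝓛 completely symmetric and trace-free (`IsAlignedOn.isAHOn`). Here θ
appears only because the components of H are differentiated as functions, without its weight.

Two connections of the same conformal projective structure differ by a_i δ_j^k + a_j δ_i^k + h_ij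
b^k. Alignment of both forces b to be minus the raised a, and a to be the difference α of the
Faraday primitives (`Γ_eq_of_aligned`). So the situation is that of a Weyl change in conformal
geometry, except that ∇H has the extra part 𝓛. The cubic torsion itself does not change
(`IsAHPairOn.cubicTorsion_eq`).

Put S = ∇α - α⊗α + ½|α|²H and C_ij = ½ 𝓛_ij^p α_p. The curvature changes by a two-form part built
from dα, a Kulkarni–Nomizu product of H with Q = sym(S) - C that is skew in the last two indices,
and one of H with C that is symmetric in them (`curvLow_change`, `IsAHPairOn.curvatureChange`). The
two projections separate these: T sees only Q, U only C. For n > 2 this gives A_ij → A_ij + Q_ij,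
and always E_ij → E_ij + C_ij. The Weyl tensors are what remains after the Kulkarni–Nomizu parts are
removed, so they are invariant.

For the Cotton tensors, W_ij changes by S_ij. The Ricci identity turns the skew derivative of S into
-α^p R_ijkp plus lower terms. After the curvature is decomposed, all cancels except -α^p W_ijkp and
a pure trace (`w3_change`). The change of e needs the skew derivative of 𝓛, which the Ricci identity
for H expresses through U and terms quadratic in 𝓛; the result is -α^p E_ijkp and the same pure
trace (`e3_change`). As w = a + e, the tensor a changes by exactly -α^p A_ijkp, with no trace term,
whence the invariance of A_i. In dimension three A_ijkl is a trace-free algebraic curvature tensor,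
hence zero. -/

noncomputable section

/-! ### Coordinate frames, Christoffel symbols and metric components in a chart. -/

namespace AHGeometry

variable {n : ℕ} {M : Type*} [TopologicalSpace M] [ChartedSpace (Model n) M]
  [IsManifold (𝓡 n) ∞ M]

omit [IsManifold (𝓡 n) ∞ M] in
theorem mdifferentiable_of_mem_maximalAtlas {e : OpenPartialHomeomorph M (Model n)}
    (he : e ∈ IsManifold.maximalAtlas (𝓡 n) ∞ M) : e.MDifferentiable (𝓡 n) (𝓡 n) :=
  ⟨(contMDiffOn_of_mem_maximalAtlas he).mdifferentiableOn (by simp),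
    (contMDiffOn_symm_of_mem_maximalAtlas he).mdifferentiableOn (by simp)⟩

omit [IsManifold (𝓡 n) ∞ M] in
theorem isInvertible_mfderiv_chart {e : OpenPartialHomeomorph M (Model n)}
    (he : e ∈ IsManifold.maximalAtlas (𝓡 n) ∞ M) {x : M} (hx : x ∈ e.source) :
    (mfderiv (𝓡 n) (𝓡 n) e x).IsInvertible :=
  ⟨(mdifferentiable_of_mem_maximalAtlas he).mfderiv hx, rfl⟩

theorem mdifferentiableAt_constField (i : Fin n) (y : Model n) :
    MDifferentiableAt (𝓡 n) (𝓡 n).tangent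
      (fun y => (⟨y, constField i y⟩ : TangentBundle (𝓡 n) (Model n))) y := by
  have : ContMDiffAt (𝓡 n) (𝓡 n).tangent ∞
      (fun y => (⟨y, constField i y⟩ : TangentBundle (𝓡 n) (Model n))) y :=
    contMDiffAt_vectorSpace_iff_contDiffAt.2 contDiffAt_const
  exact this.mdifferentiableAt (by simp)

theorem contMDiffAt_coordField {e : OpenPartialHomeomorph M (Model n)}
    (he : e ∈ IsManifold.maximalAtlas (𝓡 n) ∞ M) (i : Fin n) {x : M} (hx : x ∈ e.source) :
    ContMDiffAt (𝓡 n) (𝓡 n).tangent ∞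
      (fun x => (⟨x, coordField e i x⟩ : TangentBundle (𝓡 n) M)) x := by
  refine ContMDiffAt.mpullback_vectorField_preimage (n := ∞) (V := constField i)
    (contMDiffAt_vectorSpace_iff_contDiffAt.2 contDiffAt_const)
    ((contMDiffOn_of_mem_maximalAtlas he).contMDiffAt (e.open_source.mem_nhds hx))
    (isInvertible_mfderiv_chart he hx) (by simp)

omit [IsManifold (𝓡 n) ∞ M] in
theorem mfderiv_coordField {e : OpenPartialHomeomorph M (Model n)}
    (he : e ∈ IsManifold.maximalAtlas (𝓡 n) ∞ M) (i : Fin n) {x : M} (hx : x ∈ e.source) :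
    mfderiv (𝓡 n) (𝓡 n) e x (coordField e i x) = (EuclideanSpace.single i (1 : ℝ) : Model n) := by
  rw [coordField, VectorField.mpullback_apply]
  exact (isInvertible_mfderiv_chart he hx).self_apply_inverse _

omit [IsManifold (𝓡 n) ∞ M] in
theorem coordComp_coordField {e : OpenPartialHomeomorph M (Model n)}
    (he : e ∈ IsManifold.maximalAtlas (𝓡 n) ∞ M) (i k : Fin n) {x : M} (hx : x ∈ e.source) :
    coordComp e x (coordField e i x) k = if i = k then 1 else 0 := by
  unfold coordComp
  rw [mfderiv_coordField he i hx]
  simp [eq_comm]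

omit [IsManifold (𝓡 n) ∞ M] in
theorem coordComp_add (e : OpenPartialHomeomorph M (Model n)) (x : M)
    (v w : TangentSpace (𝓡 n) x) (k : Fin n) :
    coordComp e x (v + w) k = coordComp e x v k + coordComp e x w k := by
  unfold coordComp
  rw [map_add]; rfl

omit [IsManifold (𝓡 n) ∞ M] in
theorem coordComp_sub (e : OpenPartialHomeomorph M (Model n)) (x : M)
    (v w : TangentSpace (𝓡 n) x) (k : Fin n) :
    coordComp e x (v - w) k = coordComp e x v k - coordComp e x w k := by
  unfold coordComp
  rw [map_sub]; rfl

omit [IsManifold (𝓡 n) ∞ M] in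
theorem coordComp_smul (e : OpenPartialHomeomorph M (Model n)) (x : M) (c : ℝ)
    (v : TangentSpace (𝓡 n) x) (k : Fin n) :
    coordComp e x (c • v) k = c * coordComp e x v k := by
  unfold coordComp
  rw [map_smul]; rfl

omit [IsManifold (𝓡 n) ∞ M] in
theorem eq_sum_coordField {e : OpenPartialHomeomorph M (Model n)}
    (he : e ∈ IsManifold.maximalAtlas (𝓡 n) ∞ M) {x : M} (hx : x ∈ e.source)
    (v : TangentSpace (𝓡 n) x) : v = ∑ i, coordComp e x v i • coordField e i x := by
  apply (mdifferentiable_of_mem_maximalAtlas he).mfderiv_injective hx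
  rw [map_sum]
  simp only [map_smul, mfderiv_coordField he _ hx]
  have := (EuclideanSpace.basisFun (Fin n) ℝ).sum_repr (mfderiv (𝓡 n) (𝓡 n) e x v : Model n)
  simp only [EuclideanSpace.basisFun_apply] at this
  exact this.symm

/-- Brackets are natural under pullback, and constant fields on the model space commute. -/
theorem mlieBracket_coordField {e : OpenPartialHomeomorph M (Model n)}
    (he : e ∈ IsManifold.maximalAtlas (𝓡 n) ∞ M) (i j : Fin n) {x : M} (hx : x ∈ e.source) :
    VectorField.mlieBracket (𝓡 n) (coordField e i) (coordField e j) x = 0 := by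
  have : IsManifold (𝓡 n) (minSmoothness ℝ 2) M := by
    rw [minSmoothness_of_isRCLikeNormedField]
    exact IsManifold.of_le (n := ∞) (by exact WithTop.coe_le_coe.2 (le_top : (2 : ℕ∞) ≤ ⊤))
  have h := VectorField.mpullback_mlieBracket (n := ∞) (I := 𝓡 n) (I' := 𝓡 n) (f := e) (x₀ := x)
    (mdifferentiableAt_constField i (e x)) (mdifferentiableAt_constField j (e x))
    ((contMDiffOn_of_mem_maximalAtlas he).contMDiffAt (e.open_source.mem_nhds hx))
    (by rw [minSmoothness_of_isRCLikeNormedField]; exact WithTop.coe_le_coe.2 (le_top : (2 : ℕ∞) ≤ ⊤))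
  refine h.symm.trans ?_
  have h0 : VectorField.mlieBracket (𝓡 n) (constField i) (constField j) (e x) = 0 := by
    rw [← VectorField.mlieBracketWithin_univ, VectorField.mlieBracketWithin_eq_lieBracketWithin]
    have hc : ∀ i : Fin n, (constField i : Model n → Model n) =
      fun _ => EuclideanSpace.single i (1 : ℝ) := fun _ => rfl
    unfold VectorField.lieBracketWithin
    erw [hc i, hc j]
    simp
    rfl
  rw [VectorField.mpullback_apply, h0, map_zero]

theorem AffineConnection.christoffel_symm {nab : AffineConnection n M} (ht : nab.IsTorsionFree)
    {e : OpenPartialHomeomorph M (Model n)} (he : e ∈ IsManifold.maximalAtlas (𝓡 n) ∞ M)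
    {y : Model n} (hy : y ∈ e.target) (i j k : Fin n) :
    nab.christoffel e y i j k = nab.christoffel e y j i k := by
  have hx := e.map_target hy
  have h := (nab.cov.torsion_eq_zero_iff.1 ht)
    ((contMDiffAt_coordField he i hx).mdifferentiableAt (by simp))
    ((contMDiffAt_coordField he j hx).mdifferentiableAt (by simp))
  rw [mlieBracket_coordField he i j hx, sub_eq_zero] at h
  unfold christoffel
  rw [h]

theorem contDiffOn_coordComp {e : OpenPartialHomeomorph M (Model n)}
    (he : e ∈ IsManifold.maximalAtlas (𝓡 n) ∞ M) {Z : Π x : M, TangentSpace (𝓡 n) x}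
    (hZ : ContMDiffOn (𝓡 n) (𝓡 n).tangent ∞
      (fun x => (⟨x, Z x⟩ : TangentBundle (𝓡 n) M)) e.source) (k : Fin n) :
    ContDiffOn ℝ ∞ (fun y => coordComp e (e.symm y) (Z (e.symm y)) k) e.target := by
  intro y hy
  have hx := e.map_target hy
  have h1 := ContMDiffAt.mpullback_vectorField_preimage (n := ∞) (I := 𝓡 n) (I' := 𝓡 n)
    (f := e.symm) (x₀ := y) (V := Z) (m := ∞)
    (hZ.contMDiffAt (e.open_source.mem_nhds hx))
    ((contMDiffOn_symm_of_mem_maximalAtlas he).contMDiffAt (e.open_target.mem_nhds hy))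
    ⟨(mdifferentiable_of_mem_maximalAtlas he).symm.mfderiv hy, rfl⟩ (by simp)
  have h2 := contMDiffAt_vectorSpace_iff_contDiffAt.1 h1
  -- The components of `Z` are those of its pullback along `e.symm`, because the derivatives of `e`
  -- and `e.symm` are mutually inverse; the pullback is known to be smooth.
  let Y : Model n → Model n := VectorField.mpullback (𝓡 n) (𝓡 n) e.symm Z
  have h3 : ContDiffAt ℝ ∞ (fun y => Y y k) y :=
    (EuclideanSpace.proj k : Model n →L[ℝ] ℝ).contDiff.contDiffAt.comp y h2
  have h4 : ∀ z ∈ e.target, coordComp e (e.symm z) (Z (e.symm z)) k = Y z k := by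
    intro z hz
    have hc := (mdifferentiable_of_mem_maximalAtlas he).symm.symm_comp_deriv hz
    have hi : (mfderiv (𝓡 n) (𝓡 n) e.symm z).IsInvertible :=
      ⟨(mdifferentiable_of_mem_maximalAtlas he).symm.mfderiv hz, rfl⟩
    have hv := hi.self_apply_inverse (Z (e.symm z))
    have h5 := congrArg (fun A => A ((mfderiv (𝓡 n) (𝓡 n) e.symm z).inverse (Z (e.symm z)))) hc
    rw [ContinuousLinearMap.comp_apply, hv] at h5
    exact congrArg (fun w : Model n => w k) h5
  exact h3.contDiffWithinAt.congr h4 (h4 y hy)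

theorem AffineConnection.contDiffOn_christoffel (nab : AffineConnection n M)
    {e : OpenPartialHomeomorph M (Model n)} (he : e ∈ IsManifold.maximalAtlas (𝓡 n) ∞ M)
    (i j k : Fin n) : ContDiffOn ℝ ∞ (fun y => nab.christoffel e y i j k) e.target := by
  refine contDiffOn_coordComp he (Z := fun x => nab.cov (coordField e j) x (coordField e i x)) ?_ k
  have h1 := (nab.smooth e.source e.open_source).contMDiff (σ := coordField e j)
    (fun x hx => (contMDiffAt_coordField he j hx).contMDiffWithinAt)
  exact ContMDiffOn.clm_bundle_apply h1
    (fun x hx => (contMDiffAt_coordField he i hx).contMDiffWithinAt)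

theorem PseudoMetric.contDiffOn_components (h : PseudoMetric n M)
    {e : OpenPartialHomeomorph M (Model n)} (he : e ∈ IsManifold.maximalAtlas (𝓡 n) ∞ M)
    (i j : Fin n) : ContDiffOn ℝ ∞ (fun y => h.inner (e.symm y) (coordField e i (e.symm y))
      (coordField e j (e.symm y))) e.target := by
  have h1 : ContMDiffOn (𝓡 n) 𝓘(ℝ) ∞
      (fun x => h.inner x (coordField e i x) (coordField e j x)) e.source := by
    intro x hx
    have : ContMDiffWithinAt (𝓡 n) ((𝓡 n).prod 𝓘(ℝ)) ∞
        (fun m ↦ Bundle.TotalSpace.mk' ℝ (E := Bundle.Trivial M ℝ) m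
          (h.inner m (coordField e i m) (coordField e j m))) e.source x := by
      apply ContMDiffWithinAt.clm_bundle_apply₂ (F₁ := Model n) (F₂ := Model n)
      · exact h.smooth.contMDiffAt.contMDiffWithinAt
      · exact (contMDiffAt_coordField he i hx).contMDiffWithinAt
      · exact (contMDiffAt_coordField he j hx).contMDiffWithinAt
    simp only [Bundle.contMDiffWithinAt_totalSpace] at this
    exact this.2
  exact (h1.comp (contMDiffOn_symm_of_mem_maximalAtlas he)
    (fun y hy => e.map_target hy)).contDiffOn

/-- A null vector of the component matrix would give a tangent vector orthogonal to the whole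
coordinate frame, contrary to nondegeneracy. -/
theorem PseudoMetric.det_components_ne_zero (h : PseudoMetric n M)
    {e : OpenPartialHomeomorph M (Model n)} (he : e ∈ IsManifold.maximalAtlas (𝓡 n) ∞ M)
    {x : M} (hx : x ∈ e.source) :
    (Matrix.of fun i j => h.inner x (coordField e i x) (coordField e j x)).det ≠ 0 := by
  intro h0
  obtain ⟨v, hv, hv0⟩ := Matrix.exists_vecMul_eq_zero_iff.2 h0
  apply hv
  have hV : (∑ i, v i • coordField e i x) = 0 := by
    apply h.nondegenerate
    intro w
    rw [eq_sum_coordField he hx w, map_sum]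
    refine Finset.sum_eq_zero fun j _ => ?_
    rw [map_smul]
    have := congrFun hv0 j
    simp only [Matrix.vecMul, dotProduct, Matrix.of_apply, Pi.zero_apply] at this
    simp [map_sum, this]
  have h2 := congrArg (mfderiv (𝓡 n) (𝓡 n) e x) hV
  rw [map_sum, map_zero] at h2
  simp only [map_smul, mfderiv_coordField he _ hx] at h2
  funext k
  have h3 := congrArg (fun w : Model n => w k) h2
  have h4 : (∑ i, v i • (EuclideanSpace.single i (1 : ℝ) : Model n)) k = 0 := h3
  simpa [Pi.single_apply] using h4

theorem AffineConnection.difference_coordField (nab nab' : AffineConnection n M)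
    {e : OpenPartialHomeomorph M (Model n)} (he : e ∈ IsManifold.maximalAtlas (𝓡 n) ∞ M)
    {y : Model n} (hy : y ∈ e.target) (i j k : Fin n) :
    coordComp e (e.symm y) (nab'.cov.difference nab.cov (e.symm y) (coordField e j (e.symm y))
      (coordField e i (e.symm y))) k = nab'.christoffel e y i j k - nab.christoffel e y i j k := by
  have hx := e.map_target hy
  unfold CovariantDerivative.difference
  rw [IsCovariantDerivativeOn.difference_apply _ _ (Set.mem_univ _)
    ((contMDiffAt_coordField he j hx).mdifferentiableAt (by simp))]
  exact coordComp_sub _ _ _ _ _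

/-- In a chart, the difference of conformally projectively equivalent connections has the form
`a_i δ_j^k + a_j δ_i^k + h_{ij} b^k`. -/
theorem ConfProjEquiv.exists_christoffel_sub {c : ConformalStructure n M}
    {nab nab' : AffineConnection n M} (hc : ConfProjEquiv c nab nab') {h : PseudoMetric n M}
    (hh : h ∈ c.carrier) {e : OpenPartialHomeomorph M (Model n)}
    (he : e ∈ IsManifold.maximalAtlas (𝓡 n) ∞ M) {y : Model n} (hy : y ∈ e.target) :
    ∃ a b : Fin n → ℝ, ∀ i j k, nab'.christoffel e y i j k - nab.christoffel e y i j k =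
      a i * (if j = k then 1 else 0) + a j * (if i = k then 1 else 0)
        + (nab.inChart h e).g y i j * b k := by
  have hx := e.map_target hy
  obtain ⟨α, β, hab⟩ := hc h hh (e.symm y)
  refine ⟨fun i => α (coordField e i (e.symm y)), coordComp e (e.symm y) β, fun i j k => ?_⟩
  rw [← AffineConnection.difference_coordField nab nab' he hy, hab, coordComp_add, coordComp_add,
    coordComp_smul, coordComp_smul, coordComp_smul, coordComp_coordField he _ _ hx,
    coordComp_coordField he _ _ hx]
  rfl

/-- Both metrics are compared with the one generating the class. Only the pointwise factor is
needed, since it disappears from H. -/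
theorem ConformalStructure.exists_factor {c : ConformalStructure n M} {h h' : PseudoMetric n M}
    (hh : h ∈ c.carrier) (hh' : h' ∈ c.carrier) :
    ∃ f : M → ℝ, (∀ x, 0 < f x) ∧ ∀ x v w, h'.inner x v w = f x * h.inner x v w := by
  obtain ⟨h0, h0c⟩ := c.isClass
  rw [h0c] at hh hh'
  obtain ⟨f, -, fp, hf⟩ := hh
  obtain ⟨f', -, fp', hf'⟩ := hh'
  refine ⟨fun x => f' x / f x, fun x => div_pos (fp' x) (fp x), fun x v w => ?_⟩
  rw [hf', hf]
  have := (fp x).ne'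
  field_simp

end AHGeometry

namespace AHGeometry

/-! ### Pointwise algebra -/

section Pointwise

variable {n : ℕ}

/-- Substituting x + xᵀ for a symmetric tensor (below, x - xᵀ for a two-form) builds the symmetry
into the expression, so that `ring` alone can verify identities that depend on it. -/
theorem exists_add_swap {X : Fin n → Fin n → ℝ} (h : ∀ i j, X i j = X j i) :
    ∃ x : Fin n → Fin n → ℝ, X = fun i j => x i j + x j i :=
  ⟨fun i j => X i j / 2, by funext i j; dsimp only; rw [h j i]; ring⟩

theorem exists_sub_swap {X : Fin n → Fin n → ℝ} (h : ∀ i j, X i j = -X j i) :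
    ∃ x : Fin n → Fin n → ℝ, X = fun i j => x i j - x j i :=
  ⟨fun i j => X i j / 2, by funext i j; dsimp only; rw [h j i]; ring⟩

/-- The full contraction `K^{pq} f_{pq}`. -/
def contr (K f : Fin n → Fin n → ℝ) : ℝ := ∑ p, ∑ q, K p q * f p q

theorem contr_add (K f g : Fin n → Fin n → ℝ) :
    contr K (fun p q => f p q + g p q) = contr K f + contr K g := by
  simp only [contr, mul_add, Finset.sum_add_distrib]

theorem contr_sub (K f g : Fin n → Fin n → ℝ) :
    contr K (fun p q => f p q - g p q) = contr K f - contr K g := by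
  simp only [contr, mul_sub, Finset.sum_sub_distrib]

theorem contr_neg (K f : Fin n → Fin n → ℝ) :
    contr K (fun p q => -f p q) = -contr K f := by
  simp only [contr, mul_neg, Finset.sum_neg_distrib]

theorem contr_const_mul (K f : Fin n → Fin n → ℝ) (c : ℝ) :
    contr K (fun p q => c * f p q) = c * contr K f := by
  simp only [contr, Finset.mul_sum]
  exact Finset.sum_congr rfl fun p _ => Finset.sum_congr rfl fun q _ => by ring

theorem contr_mul_const (K f : Fin n → Fin n → ℝ) (c : ℝ) :
    contr K (fun p q => f p q * c) = contr K f * c := by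
  simp only [contr, Finset.sum_mul]
  exact Finset.sum_congr rfl fun p _ => Finset.sum_congr rfl fun q _ => by ring

theorem contr_div_const (K f : Fin n → Fin n → ℝ) (c : ℝ) :
    contr K (fun p q => f p q / c) = contr K f / c := by
  simp only [div_eq_mul_inv, contr_mul_const]

theorem contr_zero (K : Fin n → Fin n → ℝ) : contr K (fun _ _ => 0) = 0 := by simp [contr]

theorem contr_sum {ι : Type*} (s : Finset ι) (K : Fin n → Fin n → ℝ)
    (f : ι → Fin n → Fin n → ℝ) :
    contr K (fun p q => ∑ a ∈ s, f a p q) = ∑ a ∈ s, contr K (f a) := by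
  simp only [contr, Finset.mul_sum]
  simp only [Finset.sum_comm (s := Finset.univ) (t := s)]

/-- `K` is the inverse of the symmetric bilinear form `H`. -/
structure IsMetricPair (H K : Fin n → Fin n → ℝ) : Prop where
  symm : ∀ i j, H i j = H j i
  symm_inv : ∀ i j, K i j = K j i
  mul_inv : ∀ i j, ∑ p, K i p * H p j = if i = j then 1 else 0

namespace IsMetricPair

variable {H K : Fin n → Fin n → ℝ} (hHK : IsMetricPair H K)
include hHK

theorem contr_swap (f : Fin n → Fin n → ℝ) : contr K (fun p q => f q p) = contr K f := by
  unfold contr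
  rw [Finset.sum_comm]
  exact Finset.sum_congr rfl fun p _ => Finset.sum_congr rfl fun q _ => by
    rw [hHK.symm_inv]

theorem contr_antisymm {f : Fin n → Fin n → ℝ} (hf : ∀ p q, f p q = -f q p) :
    contr K f = 0 := by
  have h1 := hHK.contr_swap f
  have h2 : contr K (fun p q => f q p) = -contr K f := by
    rw [← contr_neg]; congr 1; funext p q; exact hf q p
  linarith

theorem contr_left (X : Fin n → ℝ) (j : Fin n) :
    contr K (fun p q => X p * H q j) = X j := by
  have : contr K (fun p q => X p * H q j) = ∑ p, X p * ∑ q, K p q * H q j := by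
    simp only [contr, Finset.mul_sum]
    exact Finset.sum_congr rfl fun p _ => Finset.sum_congr rfl fun q _ => by ring
  simp [this, hHK.mul_inv]

theorem contr_left' (X : Fin n → ℝ) (j : Fin n) :
    contr K (fun p q => X p * H j q) = X j := by
  simp only [hHK.symm j, hHK.contr_left]

theorem contr_right (X : Fin n → ℝ) (j : Fin n) :
    contr K (fun p q => X q * H p j) = X j := by
  rw [← hHK.contr_left X j, ← hHK.contr_swap]

theorem contr_right' (X : Fin n → ℝ) (j : Fin n) :
    contr K (fun p q => X q * H j p) = X j := by
  simp only [hHK.symm j, hHK.contr_right]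

theorem contr_left_comm' (X : Fin n → ℝ) (j : Fin n) :
    contr K (fun p q => H j q * X p) = X j := by
  simp only [mul_comm (H _ _), hHK.contr_left']

theorem contr_right_comm (X : Fin n → ℝ) (j : Fin n) :
    contr K (fun p q => H p j * X q) = X j := by
  simp only [mul_comm (H _ _), hHK.contr_right]

theorem contr_right_comm' (X : Fin n → ℝ) (j : Fin n) :
    contr K (fun p q => H j p * X q) = X j := by
  simp only [mul_comm (H _ _), hHK.contr_right']

theorem contr_metric : contr K (fun p q => H p q) = n := by
  have : contr K (fun p q => H p q) = ∑ p, ∑ q, K p q * H q p := by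
    unfold contr
    exact Finset.sum_congr rfl fun p _ => Finset.sum_congr rfl fun q _ => by rw [hHK.symm]
  simp [this, hHK.mul_inv]

/-- Raising and lowering an index. -/
theorem sum_raise_lower (X : Fin n → ℝ) (j : Fin n) :
    ∑ q, (∑ p, K q p * X p) * H q j = X j := by
  rw [← hHK.contr_right X j]
  simp only [contr, Finset.sum_mul]
  exact Finset.sum_congr rfl fun p _ => Finset.sum_congr rfl fun q _ => by ring

theorem sum_lower_raise (X : Fin n → ℝ) (j : Fin n) :
    ∑ q, K j q * (∑ p, X p * H p q) = X j := by
  simp only [Finset.mul_sum]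
  rw [Finset.sum_comm]
  have : ∀ p, ∑ q, K j q * (X p * H p q) = X p * (if j = p then 1 else 0) := fun p => by
    rw [← hHK.mul_inv, Finset.mul_sum]
    exact Finset.sum_congr rfl fun q _ => by rw [hHK.symm]; ring
  simp [this]

theorem lower_injective {X Y : Fin n → ℝ} (h : ∀ q, ∑ p, X p * H p q = ∑ p, Y p * H p q) :
    X = Y := by
  funext j
  rw [← hHK.sum_lower_raise X j, ← hHK.sum_lower_raise Y j]
  exact Finset.sum_congr rfl fun q _ => by rw [h]

end IsMetricPair

/-! #### Algebraic curvature tensors -/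

/-- The Kulkarni–Nomizu type product of `H` and `Q`, antisymmetric in the last two indices. -/
def skewProd (H Q : Fin n → Fin n → ℝ) (i j k l : Fin n) : ℝ :=
  Q i k * H j l - Q j k * H i l - H j k * Q i l + H i k * Q j l

/-- The Kulkarni–Nomizu type product of `H` and `Q`, symmetric in the last two indices. -/
def symmProd (H Q : Fin n → Fin n → ℝ) (i j k l : Fin n) : ℝ :=
  H j k * Q i l - H i k * Q j l + H j l * Q i k - H i l * Q j k

/-- The curvature type tensor built from a two-form `F`. -/
def formProd (H F : Fin n → Fin n → ℝ) (i j k l : Fin n) : ℝ :=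
  F i j * H k l - (F k i * H j l - F k j * H i l) / 2 + (F l i * H j k - F l j * H i k) / 2

theorem proj2_skewProd {H Q : Fin n → Fin n → ℝ} (hH : ∀ i j, H i j = H j i)
    (hQ : ∀ i j, Q i j = Q j i) (i j k l : Fin n) :
    proj2 (skewProd H Q) i j k l = skewProd H Q i j k l := by
  obtain ⟨H, rfl⟩ := exists_add_swap hH
  obtain ⟨Q, rfl⟩ := exists_add_swap hQ
  simp only [proj2, skewProd]; ring

theorem proj2_symmProd {H Q : Fin n → Fin n → ℝ} (hH : ∀ i j, H i j = H j i)
    (hQ : ∀ i j, Q i j = Q j i) (i j k l : Fin n) :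
    proj2 (symmProd H Q) i j k l = 0 := by
  obtain ⟨H, rfl⟩ := exists_add_swap hH
  obtain ⟨Q, rfl⟩ := exists_add_swap hQ
  simp only [proj2, symmProd]; ring

theorem proj2_formProd {H F : Fin n → Fin n → ℝ} (hH : ∀ i j, H i j = H j i)
    (hF : ∀ i j, F i j = -F j i) (i j k l : Fin n) :
    proj2 (formProd H F) i j k l = 0 := by
  obtain ⟨H, rfl⟩ := exists_add_swap hH
  obtain ⟨F, rfl⟩ := exists_sub_swap hF
  simp only [proj2, formProd]; ring

theorem proj1_skewProd {H Q : Fin n → Fin n → ℝ} (hH : ∀ i j, H i j = H j i)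
    (hQ : ∀ i j, Q i j = Q j i) (i j k l : Fin n) :
    proj1 (skewProd H Q) i j k l = 0 := by
  obtain ⟨H, rfl⟩ := exists_add_swap hH
  obtain ⟨Q, rfl⟩ := exists_add_swap hQ
  simp only [proj1, sym3, skewProd]; ring

theorem proj1_symmProd {H Q : Fin n → Fin n → ℝ} (hH : ∀ i j, H i j = H j i)
    (hQ : ∀ i j, Q i j = Q j i) (i j k l : Fin n) :
    proj1 (symmProd H Q) i j k l = symmProd H Q i j k l := by
  obtain ⟨H, rfl⟩ := exists_add_swap hH
  obtain ⟨Q, rfl⟩ := exists_add_swap hQ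
  simp only [proj1, sym3, symmProd]; ring

theorem formProd_add (H F G : Fin n → Fin n → ℝ) (i j k l : Fin n) :
    formProd H (fun a b => F a b + G a b) i j k l =
      formProd H F i j k l + formProd H G i j k l := by
  simp only [formProd]; ring

theorem formProd_cyclic {H F : Fin n → Fin n → ℝ} (hH : ∀ i j, H i j = H j i)
    (hF : ∀ i j, F i j = -F j i) (i j k l : Fin n) :
    formProd H F i j k l + formProd H F j k i l + formProd H F k i j l = 0 := by
  obtain ⟨H, rfl⟩ := exists_add_swap hH
  obtain ⟨F, rfl⟩ := exists_sub_swap hF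
  simp only [formProd]; ring

theorem formProd_antisymm {H F : Fin n → Fin n → ℝ} (hH : ∀ i j, H i j = H j i)
    (hF : ∀ i j, F i j = -F j i) (i j k l : Fin n) :
    formProd H F i j k l = -formProd H F j i k l := by
  obtain ⟨H, rfl⟩ := exists_add_swap hH
  obtain ⟨F, rfl⟩ := exists_sub_swap hF
  simp only [formProd]; ring

theorem formProd_add_swap {H F : Fin n → Fin n → ℝ} (hH : ∀ i j, H i j = H j i)
    (hF : ∀ i j, F i j = -F j i) (i j k l : Fin n) :
    formProd H F i j k l + formProd H F i j l k = 2 * (F i j * H k l) := by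
  obtain ⟨H, rfl⟩ := exists_add_swap hH
  obtain ⟨F, rfl⟩ := exists_sub_swap hF
  simp only [formProd]; ring

/-- A tensor with the symmetries of a curvature tensor whose part symmetric in the last two
indices satisfies the Bianchi identity is the sum of its two projections. -/
theorem proj1_add_proj2 {B : Fin n → Fin n → Fin n → Fin n → ℝ}
    (hB : ∀ i j k l, B i j k l = -B j i k l)
    (hc : ∀ i j k l, B i j k l + B j k i l + B k i j l = 0)
    (hs : ∀ i j k l, (B i j k l + B i j l k) + (B j k i l + B j k l i)
      + (B k i j l + B k i l j) = 0) (i j k l : Fin n) :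
    proj1 B i j k l + proj2 B i j k l = B i j k l := by
  simp only [proj1, proj2, sym3]
  -- A linear problem in the 24 components obtained by permuting i, j, k, l; the relations listed
  -- suffice to solve it.
  linarith [hB i j k l, hB i j l k, hB i k j l, hB i k l j, hB i l j k, hB i l k j,
    hB j k i l, hB j k l i, hB j l i k, hB j l k i, hB k l i j, hB k l j i,
    hc i j k l, hc i j l k, hc i k l j, hc j k l i,
    hs i j k l, hs i j l k, hs i k l j, hs j k l i]

end Pointwise

end AHGeometry

/-! ### Traces of the Kulkarni–Nomizu products; dimensions two and three. -/

namespace AHGeometry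

section Pointwise

variable {n : ℕ} {H K : Fin n → Fin n → ℝ}

theorem contr_skewProd (hHK : IsMetricPair H K) (Q : Fin n → Fin n → ℝ) (j k : Fin n) :
    contr K (fun p q => skewProd H Q p j k q) = (2 - (n : ℝ)) * Q j k - contr K Q * H j k := by
  simp only [skewProd, contr_add, contr_sub, contr_const_mul, hHK.contr_left', hHK.contr_right_comm,
    hHK.contr_metric]
  ring

theorem contr_symmProd (hHK : IsMetricPair H K) (Q : Fin n → Fin n → ℝ) (j k : Fin n) :
    contr K (fun p q => symmProd H Q p j k q) = contr K Q * H j k - n * Q j k := by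
  simp only [symmProd, contr_add, contr_sub, contr_const_mul, contr_mul_const, hHK.contr_left_comm',
    hHK.contr_right_comm, hHK.contr_metric]
  ring

theorem contr_formProd_last (hHK : IsMetricPair H K) {F : Fin n → Fin n → ℝ}
    (hF : ∀ i j, F i j = -F j i) (i j : Fin n) :
    contr K (fun p q => formProd H F i j p q) = n * F i j := by
  simp only [formProd, contr_add, contr_sub, contr_const_mul, contr_div_const,
    hHK.contr_left', hHK.contr_right', hHK.contr_metric, hF j i]
  ring

/-- In dimension two a tensor skew in each pair of indices has a single independent component, so
the product depends on Q only through its trace. -/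
theorem skewProd_fin_two {H K Q : Fin 2 → Fin 2 → ℝ} (hHK : IsMetricPair H K)
    (hQ : ∀ i j, Q i j = Q j i) (i j k l : Fin 2) :
    skewProd H Q i j k l = contr K Q / 2 * skewProd H H i j k l := by
  have e00 := hHK.mul_inv 0 0
  have e01 := hHK.mul_inv 0 1
  have e10 := hHK.mul_inv 1 0
  have e11 := hHK.mul_inv 1 1
  have hh := hHK.symm 1 0
  have hk := hHK.symm_inv 1 0
  have hq := hQ 1 0
  simp only [Fin.sum_univ_two, hh, hk] at e00 e01 e10 e11
  norm_num at e00 e01 e10 e11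
  -- This is the identity tr(adj(H) Q) = det(H) tr(K Q), i.e. adj(H) = det(H) K, written with the
  -- four entries of K H = 1.
  have key : Q 0 0 * H 1 1 - 2 * Q 0 1 * H 0 1 + Q 1 1 * H 0 0 =
      (K 0 0 * Q 0 0 + 2 * K 0 1 * Q 0 1 + K 1 1 * Q 1 1) * (H 0 0 * H 1 1 - H 0 1 * H 0 1) := by
    linear_combination (-(Q 0 0 * H 1 1) + Q 0 1 * H 0 1) * e00 + (Q 0 0 * H 0 1 - Q 0 1 * H 0 0) * e01
      + (Q 1 1 * H 0 1 - Q 0 1 * H 1 1) * e10 + (Q 0 1 * H 0 1 - Q 1 1 * H 0 0) * e11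
  have hc : contr K Q = K 0 0 * Q 0 0 + 2 * K 0 1 * Q 0 1 + K 1 1 * Q 1 1 := by
    simp only [contr, Fin.sum_univ_two, hk, hq]; ring
  rw [hc]
  fin_cases i <;> fin_cases j <;> fin_cases k <;> fin_cases l <;>
    simp only [skewProd, Fin.zero_eta, Fin.mk_one, hh, hq] <;>
    first | ring1 | linear_combination key | linear_combination -key

/-- In dimension three a trace-free tensor with the symmetries of a curvature tensor vanishes. -/
theorem eq_zero_of_contr_eq_zero_fin_three {H K : Fin 3 → Fin 3 → ℝ} (hHK : IsMetricPair H K)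
    {A : Fin 3 → Fin 3 → Fin 3 → Fin 3 → ℝ} (h1 : ∀ i j k l, A i j k l = -A j i k l)
    (h2 : ∀ i j k l, A i j k l = -A i j l k) (h3 : ∀ i j k l, A i j k l = A k l i j)
    (h0 : ∀ j k, contr K (fun p q => A p j k q) = 0) (i j k l : Fin 3) : A i j k l = 0 := by
  have hd : (Matrix.of K).det ≠ 0 := by
    have : Matrix.of K * Matrix.of H = 1 := by
      ext i j
      simp only [Matrix.mul_apply, Matrix.of_apply, hHK.mul_inv, Matrix.one_apply]
    intro h
    have h' := congrArg Matrix.det this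
    rw [Matrix.det_mul, h] at h'
    simp at h'
  have hz1 : ∀ i k l, A i i k l = 0 := fun i k l => by linarith [h1 i i k l]
  have hz2 : ∀ i j k, A i j k k = 0 := fun i j k => by linarith [h2 i j k k]
  have a1 := h1 1 0
  have a2 := h1 2 0
  have a3 := h1 2 1
  have b1 := fun i j => h2 i j 1 0
  have b2 := fun i j => h2 i j 2 0
  have b3 := fun i j => h2 i j 2 1
  have c1 := h3 0 2 0 1
  have c2 := h3 1 2 0 1
  have c3 := h3 1 2 0 2
  have k1 := hHK.symm_inv 1 0
  have k2 := hHK.symm_inv 2 0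
  have k3 := hHK.symm_inv 2 1
  have r00 := h0 0 0
  have r01 := h0 0 1
  have r02 := h0 0 2
  have r11 := h0 1 1
  have r12 := h0 1 2
  have r22 := h0 2 2
  simp only [contr, Fin.sum_univ_three, a1, a2, a3, b1, b2, b3, c1, c2, c3, k1, k2, k3, hz1, hz2]
    at r00 r01 r02 r11 r12 r22
  rw [Matrix.det_fin_three] at hd
  simp only [Matrix.of_apply, k1, k2, k3] at hd
  -- Index pairs 01, 02, 12 are dual to the indices 2, 1, 0. Up to sign, det(K) times each
  -- independent component is a component of the Einstein tensor with indices raised by K; here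
  -- det(K) A_0101 = R^22 - ½ K^22 R, where R_jk is the trace that vanishes. The coefficients below
  -- are those of this formula and its five analogues.
  have z0101 : A 0 1 0 1 = 0 := by
    refine (mul_eq_zero.1 ?_).resolve_left hd
    linear_combination -((1 * K 2 2 * K 0 0 / 2 - K 0 2 * K 0 2) * r00
        + (2 * K 2 2 * K 0 1 / 2 - K 0 2 * K 1 2 - K 1 2 * K 0 2) * r01
        + (2 * K 2 2 * K 0 2 / 2 - K 0 2 * K 2 2 - K 2 2 * K 0 2) * r02
        + (1 * K 2 2 * K 1 1 / 2 - K 1 2 * K 1 2) * r11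
        + (2 * K 2 2 * K 1 2 / 2 - K 1 2 * K 2 2 - K 2 2 * K 1 2) * r12
        + (1 * K 2 2 * K 2 2 / 2 - K 2 2 * K 2 2) * r22)
  have z0102 : A 0 1 0 2 = 0 := by
    refine (mul_eq_zero.1 ?_).resolve_left hd
    linear_combination ((1 * K 1 2 * K 0 0 / 2 - K 0 1 * K 0 2) * r00
        + (2 * K 1 2 * K 0 1 / 2 - K 0 1 * K 1 2 - K 1 1 * K 0 2) * r01
        + (2 * K 1 2 * K 0 2 / 2 - K 0 1 * K 2 2 - K 1 2 * K 0 2) * r02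
        + (1 * K 1 2 * K 1 1 / 2 - K 1 1 * K 1 2) * r11
        + (2 * K 1 2 * K 1 2 / 2 - K 1 1 * K 2 2 - K 1 2 * K 1 2) * r12
        + (1 * K 1 2 * K 2 2 / 2 - K 1 2 * K 2 2) * r22)
  have z0202 : A 0 2 0 2 = 0 := by
    refine (mul_eq_zero.1 ?_).resolve_left hd
    linear_combination -((1 * K 1 1 * K 0 0 / 2 - K 0 1 * K 0 1) * r00
        + (2 * K 1 1 * K 0 1 / 2 - K 0 1 * K 1 1 - K 1 1 * K 0 1) * r01
        + (2 * K 1 1 * K 0 2 / 2 - K 0 1 * K 1 2 - K 1 2 * K 0 1) * r02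
        + (1 * K 1 1 * K 1 1 / 2 - K 1 1 * K 1 1) * r11
        + (2 * K 1 1 * K 1 2 / 2 - K 1 1 * K 1 2 - K 1 2 * K 1 1) * r12
        + (1 * K 1 1 * K 2 2 / 2 - K 1 2 * K 1 2) * r22)
  have z0112 : A 0 1 1 2 = 0 := by
    refine (mul_eq_zero.1 ?_).resolve_left hd
    linear_combination -((1 * K 0 2 * K 0 0 / 2 - K 0 0 * K 0 2) * r00
        + (2 * K 0 2 * K 0 1 / 2 - K 0 0 * K 1 2 - K 0 1 * K 0 2) * r01
        + (2 * K 0 2 * K 0 2 / 2 - K 0 0 * K 2 2 - K 0 2 * K 0 2) * r02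
        + (1 * K 0 2 * K 1 1 / 2 - K 0 1 * K 1 2) * r11
        + (2 * K 0 2 * K 1 2 / 2 - K 0 1 * K 2 2 - K 0 2 * K 1 2) * r12
        + (1 * K 0 2 * K 2 2 / 2 - K 0 2 * K 2 2) * r22)
  have z0212 : A 0 2 1 2 = 0 := by
    refine (mul_eq_zero.1 ?_).resolve_left hd
    linear_combination ((1 * K 0 1 * K 0 0 / 2 - K 0 0 * K 0 1) * r00
        + (2 * K 0 1 * K 0 1 / 2 - K 0 0 * K 1 1 - K 0 1 * K 0 1) * r01
        + (2 * K 0 1 * K 0 2 / 2 - K 0 0 * K 1 2 - K 0 2 * K 0 1) * r02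
        + (1 * K 0 1 * K 1 1 / 2 - K 0 1 * K 1 1) * r11
        + (2 * K 0 1 * K 1 2 / 2 - K 0 1 * K 1 2 - K 0 2 * K 1 1) * r12
        + (1 * K 0 1 * K 2 2 / 2 - K 0 2 * K 1 2) * r22)
  have z1212 : A 1 2 1 2 = 0 := by
    refine (mul_eq_zero.1 ?_).resolve_left hd
    linear_combination -((1 * K 0 0 * K 0 0 / 2 - K 0 0 * K 0 0) * r00
        + (2 * K 0 0 * K 0 1 / 2 - K 0 0 * K 0 1 - K 0 1 * K 0 0) * r01
        + (2 * K 0 0 * K 0 2 / 2 - K 0 0 * K 0 2 - K 0 2 * K 0 0) * r02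
        + (1 * K 0 0 * K 1 1 / 2 - K 0 1 * K 0 1) * r11
        + (2 * K 0 0 * K 1 2 / 2 - K 0 1 * K 0 2 - K 0 2 * K 0 1) * r12
        + (1 * K 0 0 * K 2 2 / 2 - K 0 2 * K 0 2) * r22)
  have y1 : ∀ k l, A 0 1 k l = 0 := by
    intro k l
    fin_cases k <;> fin_cases l <;> simp [hz2, b1, b2, b3, z0101, z0102, z0112]
  have y2 : ∀ k l, A 0 2 k l = 0 := by
    intro k l
    fin_cases k <;> fin_cases l <;> simp [hz2, b1, b2, b3, c1, z0102, z0202, z0212]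
  have y3 : ∀ k l, A 1 2 k l = 0 := by
    intro k l
    fin_cases k <;> fin_cases l <;> simp [hz2, b1, b2, b3, c2, c3, z0112, z0212, z1212]
  fin_cases i <;> fin_cases j <;> simp [hz1, a1, a2, a3, y1, y2, y3]

end Pointwise
end AHGeometry

/-! ### Symmetries, traces and decomposition of the curvature tensors. -/

namespace AHGeometry
namespace LocalData

variable {n : ℕ} {D D' : LocalData n} {y : Model n}

theorem curv_antisymm (D : LocalData n) (y : Model n) (i j k l : Fin n) :
    D.curv y i j k l = -D.curv y j i k l := by
  simp only [curv, Finset.sum_sub_distrib]; ring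

theorem curvLow_antisymm (D : LocalData n) (y : Model n) (i j k l : Fin n) :
    D.curvLow y i j k l = -D.curvLow y j i k l := by
  simp only [curvLow, ← Finset.sum_neg_distrib]
  exact Finset.sum_congr rfl fun p _ => by rw [D.curv_antisymm]; ring

theorem faradayForm_antisymm (D : LocalData n) (y : Model n) (i j : Fin n) :
    D.faradayForm y i j = -D.faradayForm y j i := by
  simp only [faradayForm, fun p => D.curv_antisymm y i j p p, Finset.sum_neg_distrib]; ring

theorem faradayCurv_eq (D : LocalData n) (y : Model n) :
    D.faradayCurv y = formProd (D.H y) (D.faradayForm y) := rfl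

theorem contr_comm (K : Fin n → Fin n → ℝ) (X : Fin n → Fin n → Fin n → Fin n → ℝ) :
    contr K (fun i j => contr K (fun p q => X i j p q)) =
      contr K (fun p q => contr K (fun i j => X i j p q)) := by
  have h : ∀ Y : Fin n → Fin n → Fin n → Fin n → ℝ,
      contr K (fun i j => contr K (fun p q => Y i j p q)) =
        ∑ i, ∑ p, ∑ j, ∑ q, K i j * (K p q * Y i j p q) := fun Y => by
    simp only [contr, Finset.mul_sum]
    exact Finset.sum_congr rfl fun i _ => Finset.sum_comm
  rw [h, h, Finset.sum_comm]
  refine Finset.sum_congr rfl fun p _ => Finset.sum_congr rfl fun i _ => ?_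
  rw [Finset.sum_comm]
  exact Finset.sum_congr rfl fun q _ => Finset.sum_congr rfl fun j _ => by ring

/-- A lowered index is contracted by the trace. -/
theorem contr_lower {H K : Fin n → Fin n → ℝ} (hHK : IsMetricPair H K)
    (X : Fin n → Fin n → ℝ) :
    contr K (fun p q => ∑ r, X p r * H r q) = ∑ p, X p p := by
  unfold contr
  exact Finset.sum_congr rfl fun p _ => hHK.sum_lower_raise (X p) p

theorem ricci_eq_contr (hm : IsMetricPair (D.H y) (D.Hinv y)) (i j : Fin n) :
    D.ricci y i j = contr (D.Hinv y) (fun p q => D.curvLow y p i j q) :=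
  (contr_lower hm fun p r => D.curv y p i j r).symm

theorem faradayForm_eq_contr (hm : IsMetricPair (D.H y) (D.Hinv y)) (i j : Fin n) :
    D.faradayForm y i j = 1 / n * contr (D.Hinv y) (fun p q => D.curvLow y i j p q) := by
  rw [faradayForm, ← contr_lower hm fun p r => D.curv y i j p r]; rfl

theorem scal_eq_contr (D : LocalData n) (y : Model n) :
    D.scal y = contr (D.Hinv y) (D.ricci y) := rfl

theorem T4_symm (D : LocalData n) (y : Model n) :
    (∀ i j k l, D.T4 y i j k l = -D.T4 y j i k l) ∧ (∀ i j k l, D.T4 y i j k l = -D.T4 y i j l k) ∧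
      ∀ i j k l, D.T4 y i j k l = D.T4 y k l i j := by
  refine ⟨fun i j k l => ?_, fun i j k l => ?_, fun i j k l => ?_⟩
  · simp only [T4, proj2, D.curvLow_antisymm y j i]; ring
  · simp only [T4, proj2, D.curvLow_antisymm y l k]; ring
  · simp only [T4, proj2]; ring

theorem U4_antisymm (D : LocalData n) (y : Model n) (i j k l : Fin n) :
    D.U4 y i j k l = -D.U4 y j i k l := by
  simp only [U4, proj1]; ring

theorem U4_symm (D : LocalData n) (y : Model n) (i j k l : Fin n) :
    D.U4 y i j k l = D.U4 y i j l k := by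
  simp only [U4, proj1, sym3]; ring

theorem T2_symm (hm : IsMetricPair (D.H y) (D.Hinv y)) (i j : Fin n) :
    D.T2 y i j = D.T2 y j i := by
  obtain ⟨h1, h2, h3⟩ := D.T4_symm y
  change contr _ _ = contr _ _
  rw [← hm.contr_swap]
  congr 1; funext p q
  rw [h3, h1, h2, neg_neg]

/-- Each of the four terms of the second projection has double trace ±R, and with its sign
contributes R/4. -/
theorem contr_T2 (hm : IsMetricPair (D.H y) (D.Hinv y)) :
    contr (D.Hinv y) (D.T2 y) = D.scal y := by
  have e1 : ∀ i j, D.T2 y i j = (D.ricci y i j + D.ricci y j i) / 4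
      - contr (D.Hinv y) (fun p q => D.curvLow y p i q j) / 4
      - contr (D.Hinv y) (fun p q => D.curvLow y q j p i) / 4 := by
    intro i j
    rw [ricci_eq_contr hm, ricci_eq_contr hm, ← hm.contr_swap (fun p q => D.curvLow y p j i q),
      ← contr_add, ← contr_div_const, ← contr_div_const, ← contr_div_const, ← contr_sub,
      ← contr_sub]
    change contr _ _ = _
    congr 1; funext p q
    simp only [T4, proj2, D.curvLow_antisymm y j q]; ring
  have e2 : contr (D.Hinv y)
      (fun i j => contr (D.Hinv y) (fun p q => D.curvLow y p i q j)) = -D.scal y := by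
    rw [scal_eq_contr, ← contr_neg, contr_comm]
    congr 1; funext p q
    rw [ricci_eq_contr hm, ← contr_neg]
    congr 1; funext i j
    exact D.curvLow_antisymm y p i q j
  have e3 : contr (D.Hinv y)
      (fun i j => contr (D.Hinv y) (fun p q => D.curvLow y q j p i)) = -D.scal y := by
    rw [← e2, ← hm.contr_swap]
    congr 1; funext i j
    rw [← hm.contr_swap]
  have e4 : contr (D.Hinv y) (fun i j => D.T2 y i j) = D.scal y := by
    simp only [e1, contr_sub, contr_div_const, contr_add, e2, e3, hm.contr_swap (D.ricci y)]
    rw [scal_eq_contr]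
    ring
  exact e4

theorem A2_symm (hm : IsMetricPair (D.H y) (D.Hinv y)) (i j : Fin n) :
    D.A2 y i j = D.A2 y j i := by
  simp only [A2, T2_symm hm i j, hm.symm i j]

theorem contr_A2 (hn : 2 < n) (hm : IsMetricPair (D.H y) (D.Hinv y)) :
    contr (D.Hinv y) (D.A2 y) = -(D.scal y / (2 * ((n : ℝ) - 1))) := by
  have h2 : (2 : ℝ) < n := by exact_mod_cast hn
  have e1 : (n : ℝ) ≠ 0 := by linarith
  have e4 : ((n : ℝ) - 1) ≠ 0 := by linarith
  have := contr_T2 hm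
  have hH := hm.contr_metric
  change contr _ (fun i j => D.A2 y i j) = _
  simp only [A2, contr_sub, contr_const_mul, hH]
  change 1 / (2 - (n : ℝ)) * (contr _ (D.T2 y) - _) - _ = _
  rw [this]
  field_simp
  ring

theorem T4_eq (hm : IsMetricPair (D.H y) (D.Hinv y)) (i j k l : Fin n) :
    D.T4 y i j k l = D.A4 y i j k l + skewProd (D.H y) (D.A2 y) i j k l := by
  simp only [A4, skewProd, hm.symm l, hm.symm k]; ring

theorem U4_eq (hm : IsMetricPair (D.H y) (D.Hinv y)) (i j k l : Fin n) :
    D.U4 y i j k l = D.E4 y i j k l + symmProd (D.H y) (D.E2 y) i j k l := by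
  simp only [E4, symmProd, hm.symm l, hm.symm k]; ring

theorem A4_symm (hm : IsMetricPair (D.H y) (D.Hinv y)) :
    (∀ i j k l, D.A4 y i j k l = -D.A4 y j i k l) ∧ (∀ i j k l, D.A4 y i j k l = -D.A4 y i j l k) ∧
      ∀ i j k l, D.A4 y i j k l = D.A4 y k l i j := by
  obtain ⟨h1, h2, h3⟩ := D.T4_symm y
  refine ⟨fun i j k l => ?_, fun i j k l => ?_, fun i j k l => ?_⟩
  · simp only [A4, h1 i j]; ring
  · simp only [A4, h2 i j k]; ring
  · simp only [A4, h3 i j k, hm.symm l, hm.symm k, A2_symm hm l, A2_symm hm k]; ring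

/-- `A_{ijkl}` is trace-free. -/
theorem contr_A4 (hn : 2 < n) (hm : IsMetricPair (D.H y) (D.Hinv y)) (j k : Fin n) :
    contr (D.Hinv y) (fun p q => D.A4 y p j k q) = 0 := by
  have h2 : (2 : ℝ) < n := by exact_mod_cast hn
  have e1 : (n : ℝ) ≠ 0 := by linarith
  have e2 : (2 - (n : ℝ)) ≠ 0 := by linarith
  have e4 : ((n : ℝ) - 1) ≠ 0 := by linarith
  have h : contr (D.Hinv y) (fun p q => D.T4 y p j k q) = D.T2 y j k := rfl
  simp only [T4_eq hm, contr_add, contr_skewProd hm, contr_A2 hn hm] at h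
  have hA : (2 - (n : ℝ)) * D.A2 y j k = D.T2 y j k - D.scal y / n * D.H y j k
      - (2 - (n : ℝ)) * (D.scal y / (2 * n * ((n : ℝ) - 1)) * D.H y j k) := by
    rw [A2]; field_simp
  -- The total coefficient of H_jk; the pure-trace term in `A2` is chosen to make it vanish.
  have hs : D.scal y / n + (2 - (n : ℝ)) * (D.scal y / (2 * n * ((n : ℝ) - 1)))
      - D.scal y / (2 * ((n : ℝ) - 1)) = 0 := by
    field_simp; ring
  linear_combination h - hA + D.H y j k * hs

theorem A4_eq_zero_of_three {D : LocalData 3} {y : Model 3}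
    (hm : IsMetricPair (D.H y) (D.Hinv y)) (i j k l : Fin 3) : D.A4 y i j k l = 0 := by
  obtain ⟨h1, h2, h3⟩ := A4_symm hm
  exact eq_zero_of_contr_eq_zero_fin_three hm h1 h2 h3 (contr_A4 (by norm_num) hm) i j k l

/-- The part of the curvature symmetric in the last two indices is `F_{ij} H_{kl}` up to a tensor
which satisfies the Bianchi identity. -/
structure CurvatureIdentities (D : LocalData n) (y : Model n) : Prop where
  metric : IsMetricPair (D.H y) (D.Hinv y)
  bianchi : ∀ i j k l, D.curvLow y i j k l + D.curvLow y j k i l + D.curvLow y k i j l = 0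
  symm_part : ∀ i j k l,
    (D.curvLow y i j k l + D.curvLow y i j l k - 2 * (D.faradayForm y i j * D.H y k l))
      + (D.curvLow y j k i l + D.curvLow y j k l i - 2 * (D.faradayForm y j k * D.H y i l))
      + (D.curvLow y k i j l + D.curvLow y k i l j - 2 * (D.faradayForm y k i * D.H y j l)) = 0

/-- Once the part built from F is subtracted, the remainder satisfies the hypotheses of
`proj1_add_proj2`. The second projection does not notice the subtraction, by `proj2_formProd`. -/
theorem CurvatureIdentities.curvLow_eq (hc : D.CurvatureIdentities y) (i j k l : Fin n) :
    D.curvLow y i j k l =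
      D.T4 y i j k l + D.U4 y i j k l + formProd (D.H y) (D.faradayForm y) i j k l := by
  have hH := hc.metric.symm
  have hF := D.faradayForm_antisymm y
  have h := proj1_add_proj2
    (B := fun a b c d => D.curvLow y a b c d - formProd (D.H y) (D.faradayForm y) a b c d)
    (fun i j k l => by rw [D.curvLow_antisymm, formProd_antisymm hH hF]; ring)
    (fun i j k l => by linarith [hc.bianchi i j k l, formProd_cyclic hH hF i j k l])
    (fun i j k l => by
      linarith [hc.symm_part i j k l, formProd_add_swap hH hF i j k l,
        formProd_add_swap hH hF j k i l, formProd_add_swap hH hF k i j l]) i j k l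
  have hT : D.T4 y i j k l = proj2 (fun a b c d =>
      D.curvLow y a b c d - formProd (D.H y) (D.faradayForm y) a b c d) i j k l := by
    have h0 := proj2_formProd hH hF i j k l
    simp only [proj2] at h0
    simp only [T4, proj2]
    linarith
  have hU : D.U4 y i j k l = proj1 (fun a b c d =>
      D.curvLow y a b c d - formProd (D.H y) (D.faradayForm y) a b c d) i j k l := rfl
  rw [hT, hU]
  linarith

theorem CurvatureIdentities.curvLow_add_swap (hc : D.CurvatureIdentities y) (i j k l : Fin n) :
    D.curvLow y i j k l + D.curvLow y i j l k =
      2 * D.U4 y i j k l + 2 * (D.faradayForm y i j * D.H y k l) := by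
  rw [hc.curvLow_eq i j k l, hc.curvLow_eq i j l k,
    ← formProd_add_swap hc.metric.symm (D.faradayForm_antisymm y), (D.T4_symm y).2.1 i j l k,
    D.U4_symm y i j l k]
  ring

theorem U4_cyclic (hc : D.CurvatureIdentities y) (i j k l : Fin n) :
    D.U4 y i j k l + D.U4 y j k i l + D.U4 y k i j l = 0 := by
  have e1 := hc.curvLow_add_swap i j k l
  have e2 := hc.curvLow_add_swap j k i l
  have e3 := hc.curvLow_add_swap k i j l
  linarith [hc.symm_part i j k l]

/-- The trace of R_ijkl over k, l is n F_ij, and F_ij H_kl already accounts for all of it. -/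
theorem contr_U4_last (hn : 2 ≤ n) (hc : D.CurvatureIdentities y) (i j : Fin n) :
    contr (D.Hinv y) (fun p q => D.U4 y i j p q) = 0 := by
  have hn0 : (n : ℝ) ≠ 0 := by positivity
  have h := faradayForm_eq_contr hc.metric i j
  have h' : contr (D.Hinv y) (fun p q => D.curvLow y i j p q + D.curvLow y i j q p) =
      2 * (n * D.faradayForm y i j) := by
    rw [contr_add, hc.metric.contr_swap (fun p q => D.curvLow y i j p q), h]
    field_simp
    norm_num
  simp only [hc.curvLow_add_swap, contr_add, contr_const_mul, hc.metric.contr_metric] at h'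
  linarith

/-- Trace the Bianchi identity for U; the term traced over the last two indices vanishes. -/
theorem U2_symm (hn : 2 ≤ n) (hc : D.CurvatureIdentities y) (j k : Fin n) :
    D.U2 y j k = D.U2 y k j := by
  have e1 : D.U2 y j k = contr (D.Hinv y) (fun p q => D.U4 y p j k q) := rfl
  have e2 : D.U2 y k j = contr (D.Hinv y) (fun p q => D.U4 y p k j q) := rfl
  have e3 := contr_U4_last hn hc j k
  have e4 : contr (D.Hinv y) (fun p q => D.U4 y p j k q - D.U4 y p k j q + D.U4 y j k p q) = 0 := by
    rw [← contr_zero (D.Hinv y)]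
    congr 1; funext p q
    rw [D.U4_antisymm y p k]
    linarith [U4_cyclic hc p j k q]
  rw [contr_add, contr_sub, e3] at e4
  rw [e1, e2]; linarith

/-- U is skew in its first pair and symmetric in its last, so exchanging the two contractions
changes the sign of the double trace. -/
theorem contr_U2 (D : LocalData n) (y : Model n) :
    contr (D.Hinv y) (D.U2 y) = 0 := by
  have e1 : contr (D.Hinv y) (D.U2 y) =
    contr (D.Hinv y) (fun j k => contr (D.Hinv y) (fun p q => D.U4 y p j k q)) := rfl
  have e2 : contr (D.Hinv y) (D.U2 y) =
      -contr (D.Hinv y) (fun j k => contr (D.Hinv y) (fun p q => D.U4 y p j k q)) := by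
    rw [e1]
    nth_rewrite 1 [contr_comm]
    rw [← contr_neg]
    congr 1; funext p q
    rw [← contr_neg]
    congr 1; funext j k
    rw [D.U4_antisymm y p j, D.U4_symm y j p k]
  linarith

theorem E2_symm (hn : 2 ≤ n) (hc : D.CurvatureIdentities y) (i j : Fin n) :
    D.E2 y i j = D.E2 y j i := by
  simp only [E2, U2_symm hn hc i j]

theorem contr_E2 (D : LocalData n) (y : Model n) :
    contr (D.Hinv y) (D.E2 y) = 0 := by
  have : contr (D.Hinv y) (fun i j => D.E2 y i j) = 0 := by
    simp only [E2, contr_const_mul]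
    rw [show contr (D.Hinv y) (fun i j => D.U2 y i j) = 0 from D.contr_U2 y, mul_zero]
  exact this

/-- `E_{ijkl}` is trace-free. -/
theorem contr_E4 (hn : 2 ≤ n) (hm : IsMetricPair (D.H y) (D.Hinv y)) (j k : Fin n) :
    contr (D.Hinv y) (fun p q => D.E4 y p j k q) = 0 := by
  have hn0 : (n : ℝ) ≠ 0 := by positivity
  have h : contr (D.Hinv y) (fun p q => D.U4 y p j k q) = D.U2 y j k := rfl
  simp only [U4_eq hm, contr_add, contr_symmProd hm, D.contr_E2 y] at h
  rw [E2] at h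
  field_simp at h
  linarith

theorem E4_antisymm (D : LocalData n) (y : Model n) (i j k l : Fin n) :
    D.E4 y i j k l = -D.E4 y j i k l := by
  simp only [E4, D.U4_antisymm y i j]; ring

theorem E4_symm (D : LocalData n) (y : Model n) (i j k l : Fin n) :
    D.E4 y i j k l = D.E4 y i j l k := by
  simp only [E4, D.U4_symm y i j k]; ring

end LocalData
end AHGeometry

/-! ### Effect on the Schouten and Weyl tensors of a change of curvature by Kulkarni–Nomizu terms.
-/

namespace AHGeometry
namespace LocalData

variable {n : ℕ} {D D' : LocalData n} {y : Model n}

/-- The change of the curvature at a point when the normalized metric is kept. -/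
structure CurvatureChange (D D' : LocalData n) (y : Model n) (f Q C : Fin n → Fin n → ℝ) :
    Prop where
  metric : IsMetricPair (D.H y) (D.Hinv y)
  H_eq : D'.H y = D.H y
  Hinv_eq : D'.Hinv y = D.Hinv y
  form : ∀ i j, D'.faradayForm y i j = D.faradayForm y i j + f i j
  symm_left : ∀ i j, Q i j = Q j i
  symm_right : ∀ i j, C i j = C j i
  trace_right : contr (D.Hinv y) C = 0
  antisymm : ∀ i j, f i j = -f j i
  curv : ∀ i j k l, D'.curvLow y i j k l = D.curvLow y i j k l + formProd (D.H y) f i j k l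
    + skewProd (D.H y) Q i j k l + symmProd (D.H y) C i j k l

namespace CurvatureChange

variable {f Q C : Fin n → Fin n → ℝ} (h : CurvatureChange D D' y f Q C)
include h

/-- The second projection fixes the skew product and annihilates the other two terms. -/
theorem T4_eq (i j k l : Fin n) :
    D'.T4 y i j k l = D.T4 y i j k l + skewProd (D.H y) Q i j k l := by
  have e1 := proj2_skewProd h.metric.symm h.symm_left i j k l
  have e2 := proj2_symmProd h.metric.symm h.symm_right i j k l
  have e3 := proj2_formProd h.metric.symm h.antisymm i j k l
  simp only [proj2] at e1 e2 e3
  simp only [T4, proj2, h.curv]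
  linarith

/-- The two-form part is removed together with F before projecting; the first projection then kills
the skew product and fixes the symmetric one. -/
theorem U4_eq (i j k l : Fin n) :
    D'.U4 y i j k l = D.U4 y i j k l + symmProd (D.H y) C i j k l := by
  have e1 := proj1_skewProd h.metric.symm h.symm_left i j k l
  have e2 := proj1_symmProd h.metric.symm h.symm_right i j k l
  have e3 : ∀ i j k l, D'.faradayCurv y i j k l =
      D.faradayCurv y i j k l + formProd (D.H y) f i j k l := fun i j k l => by
    rw [faradayCurv_eq, faradayCurv_eq, h.H_eq, ← formProd_add]
    simp only [formProd, h.form]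
  simp only [proj1, sym3] at e1 e2
  simp only [U4, proj1, sym3, h.curv, e3]
  linarith

theorem T2_eq (i j : Fin n) : D'.T2 y i j =
    D.T2 y i j + ((2 - (n : ℝ)) * Q i j - contr (D.Hinv y) Q * D.H y i j) := by
  have : D'.T2 y i j = contr (D'.Hinv y) (fun p q => D'.T4 y p i j q) := rfl
  simp only [this, h.Hinv_eq, h.T4_eq, contr_add, contr_skewProd h.metric]
  rfl

theorem U2_eq (i j : Fin n) : D'.U2 y i j = D.U2 y i j - n * C i j := by
  have : D'.U2 y i j = contr (D'.Hinv y) (fun p q => D'.U4 y p i j q) := rfl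
  simp only [this, h.Hinv_eq, h.U4_eq, contr_add, contr_symmProd h.metric, h.trace_right]
  rw [zero_mul, zero_sub, ← sub_eq_add_neg]
  rfl

theorem metric' : IsMetricPair (D'.H y) (D'.Hinv y) := by
  rw [h.H_eq, h.Hinv_eq]; exact h.metric

/-- Read off from `T2_eq`, since the scalar curvature is the trace of `T2`. -/
theorem scal_eq : D'.scal y = D.scal y + (2 - 2 * (n : ℝ)) * contr (D.Hinv y) Q := by
  have e := contr_T2 h.metric'
  have e1 : contr (D'.Hinv y) (fun i j => D'.T2 y i j) = D'.scal y := e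
  simp only [h.Hinv_eq, h.T2_eq, contr_add, contr_sub, contr_const_mul,
    h.metric.contr_metric] at e1
  have e2 : contr (D.Hinv y) (fun i j => D.T2 y i j) = D.scal y := contr_T2 h.metric
  have e3 : contr (D.Hinv y) (fun i j => Q i j) = contr (D.Hinv y) Q := rfl
  rw [← e1, e2, e3]; ring

theorem E2_eq (hn : 2 ≤ n) (i j : Fin n) : D'.E2 y i j = D.E2 y i j + C i j := by
  have hn0 : (n : ℝ) ≠ 0 := by positivity
  rw [E2, E2, h.U2_eq]; field_simp; ring

theorem E4_eq (hn : 2 ≤ n) (i j k l : Fin n) : D'.E4 y i j k l = D.E4 y i j k l := by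
  have e1 := LocalData.U4_eq h.metric i j k l
  have e2 := LocalData.U4_eq h.metric' i j k l
  rw [h.U4_eq, h.H_eq] at e2
  simp only [symmProd, h.E2_eq hn] at e1 e2
  linarith

theorem A2_eq (hn : 2 < n) (i j : Fin n) : D'.A2 y i j = D.A2 y i j + Q i j := by
  have h2 : (2 : ℝ) < n := by exact_mod_cast hn
  have e1 : (n : ℝ) ≠ 0 := by linarith
  have e2 : (2 - (n : ℝ)) ≠ 0 := by linarith
  have e4 : ((n : ℝ) - 1) ≠ 0 := by linarith
  rw [A2, A2, h.T2_eq, h.scal_eq, h.H_eq]; field_simp; ring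

/-- For n > 2 the change of T is the Kulkarni–Nomizu product of H with the change of `A2`. For n = 2
only the trace of Q survives in that product, and the scalar curvature records it. -/
theorem A4_eq (hn : 2 ≤ n) (i j k l : Fin n) : D'.A4 y i j k l = D.A4 y i j k l := by
  have e1 := LocalData.T4_eq h.metric i j k l
  have e2 := LocalData.T4_eq h.metric' i j k l
  rw [h.T4_eq, h.H_eq] at e2
  rcases hn.lt_or_eq with hn | hn
  · simp only [skewProd, h.A2_eq hn] at e1 e2
    linarith
  · subst hn
    -- At n = 2 the factor 1 / (2 - n) is 0, so `A2` is -(R/4) H, and R changes by -2 tr Q.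
    have e3 : ∀ i j, D'.A2 y i j = D.A2 y i j + contr (D.Hinv y) Q / 2 * D.H y i j := by
      intro i j
      rw [A2, A2, h.scal_eq, h.H_eq]; norm_num; ring
    rw [skewProd_fin_two h.metric h.symm_left] at e2
    simp only [skewProd, e3] at e1 e2
    linarith

theorem W2_eq (hn : 2 < n) (i j : Fin n) :
    D'.W2 y i j = D.W2 y i j + (Q i j + C i j + 1 / 2 * f i j) := by
  rw [W2, W2, h.A2_eq hn, h.E2_eq hn.le, h.form]; ring

end CurvatureChange

end LocalData
end AHGeometry

namespace AHGeometry

/-! ### Calculus in coordinates -/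

section Calculus

variable {n : ℕ} {f g : Model n → ℝ} {y : Model n}

theorem pd_congr (i : Fin n) (h : f =ᶠ[nhds y] g) : pd i f y = pd i g y := by
  rw [pd, pd, h.fderiv_eq]

theorem pd_add (i : Fin n) (hf : ContDiffAt ℝ ∞ f y) (hg : ContDiffAt ℝ ∞ g y) :
    pd i (fun z => f z + g z) y = pd i f y + pd i g y := by
  rw [pd, fderiv_fun_add (hf.differentiableAt (by simp)) (hg.differentiableAt (by simp))]; rfl

theorem pd_sub (i : Fin n) (hf : ContDiffAt ℝ ∞ f y) (hg : ContDiffAt ℝ ∞ g y) :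
    pd i (fun z => f z - g z) y = pd i f y - pd i g y := by
  rw [pd, fderiv_fun_sub (hf.differentiableAt (by simp)) (hg.differentiableAt (by simp))]; rfl

theorem pd_mul (i : Fin n) (hf : ContDiffAt ℝ ∞ f y) (hg : ContDiffAt ℝ ∞ g y) :
    pd i (fun z => f z * g z) y = pd i f y * g y + f y * pd i g y := by
  rw [pd, fderiv_fun_mul (hf.differentiableAt (by simp)) (hg.differentiableAt (by simp))]
  simp only [add_apply, smul_apply, smul_eq_mul, pd]
  ring

theorem pd_const (i : Fin n) (c : ℝ) : pd i (fun _ => c) y = 0 := by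
  simp [pd]

theorem pd_const_mul (i : Fin n) (c : ℝ) (hf : ContDiffAt ℝ ∞ f y) :
    pd i (fun z => c * f z) y = c * pd i f y := by
  rw [pd_mul i contDiffAt_const hf, pd_const]; ring

theorem pd_sum {ι : Type*} (s : Finset ι) (i : Fin n) {F : ι → Model n → ℝ}
    (hF : ∀ a ∈ s, ContDiffAt ℝ ∞ (F a) y) :
    pd i (fun z => ∑ a ∈ s, F a z) y = ∑ a ∈ s, pd i (F a) y := by
  rw [pd, fderiv_fun_sum fun a ha => (hF a ha).differentiableAt (by simp)]
  simp only [sum_apply, pd]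

theorem contDiffAt_pd (i : Fin n) (hf : ContDiffAt ℝ ∞ f y) :
    ContDiffAt ℝ ∞ (fun z => pd i f z) y := by
  unfold pd
  exact (hf.fderiv_right (m := ∞) (by simp)).clm_apply contDiffAt_const

theorem pd_comm (i j : Fin n) (hf : ContDiffAt ℝ ∞ f y) :
    pd i (fun z => pd j f z) y = pd j (fun z => pd i f z) y := by
  have hs : IsSymmSndFDerivAt ℝ f y := hf.isSymmSndFDerivAt (by
    rw [minSmoothness_of_isRCLikeNormedField]
    exact WithTop.coe_le_coe.2 (le_top : (2 : ℕ∞) ≤ ⊤))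
  have hd : DifferentiableAt ℝ (fderiv ℝ f) y :=
    (hf.fderiv_right (m := ∞) (by simp)).differentiableAt (by simp)
  have h : ∀ a b : Fin n, pd a (fun z => pd b f z) y =
      fderiv ℝ (fderiv ℝ f) y (EuclideanSpace.single a 1) (EuclideanSpace.single b 1) := by
    intro a b
    unfold pd
    rw [fderiv_clm_apply hd (differentiableAt_const _)]
    simp
  rw [h, h, hs]

end Calculus

/-! ### Covariant derivatives and the curvature of a modified connection. -/

namespace LocalData

variable {n : ℕ} {D D' : LocalData n} {y : Model n}

/-- The covariant derivative of a one-form. -/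
def nablaForm (D : LocalData n) (α : Model n → Fin n → ℝ) (y : Model n) (i j : Fin n) : ℝ :=
  pd i (fun z => α z j) y - ∑ p, D.Γ y i j p * α y p

/-- The covariant derivative of a tensor of type `(1, 2)`. -/
def nablaMixed (D : LocalData n) (P : Model n → Fin n → Fin n → Fin n → ℝ) (y : Model n)
    (i j k l : Fin n) : ℝ :=
  pd i (fun z => P z j k l) y - ∑ p, D.Γ y i j p * P y p k l - ∑ p, D.Γ y i k p * P y j p l
    + ∑ p, D.Γ y i p l * P y j k p

/-- The covariant derivative of a covariant 3-tensor. -/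
def nablaThree (D : LocalData n) (P : Model n → Fin n → Fin n → Fin n → ℝ) (y : Model n)
    (i j k l : Fin n) : ℝ :=
  pd i (fun z => P z j k l) y - ∑ p, D.Γ y i j p * P y p k l - ∑ p, D.Γ y i k p * P y j p l
    - ∑ p, D.Γ y i l p * P y j k p

/-- The curvature of two connections which differ by a tensor `P`. -/
theorem curv_of_Γ_eq_add {P : Model n → Fin n → Fin n → Fin n → ℝ}
    (hΓ : ∀ i j k, ContDiffAt ℝ ∞ (fun z => D.Γ z i j k) y)
    (hP : ∀ i j k, ContDiffAt ℝ ∞ (fun z => P z i j k) y)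
    (hsymm : ∀ i j k, D.Γ y i j k = D.Γ y j i k)
    (h : ∀ᶠ z in nhds y, ∀ i j k, D'.Γ z i j k = D.Γ z i j k + P z i j k) (i j k l : Fin n) :
    D'.curv y i j k l = D.curv y i j k l + D.nablaMixed P y i j k l - D.nablaMixed P y j i k l
      + ∑ p, (P y i p l * P y j k p - P y j p l * P y i k p) := by
  have e1 : ∀ i j k l, pd i (fun z => D'.Γ z j k l) y =
      pd i (fun z => D.Γ z j k l) y + pd i (fun z => P z j k l) y := fun i j k l => by
    rw [← pd_add i (hΓ j k l) (hP j k l)]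
    exact pd_congr i (h.mono fun z hz => hz j k l)
  have e2 := h.self_of_nhds
  -- By symmetry of Γ, the terms of ∇P in which Γ acts on the slot i or j cancel on skewing.
  simp only [curv, e1, nablaMixed, e2, hsymm j i, add_mul, mul_add, Finset.sum_add_distrib,
    Finset.sum_sub_distrib]
  simp only [fun p => mul_comm (P y i p l), fun p => mul_comm (P y j p l)]
  ring

/-- The covariant derivative commutes with lowering an index, up to the derivative of the
metric. -/
theorem sum_nablaMixed_mul {P : Model n → Fin n → Fin n → Fin n → ℝ}
    {H : Model n → Fin n → Fin n → ℝ}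
    (hP : ∀ i j k, ContDiffAt ℝ ∞ (fun z => P z i j k) y)
    (hH : ∀ i j, ContDiffAt ℝ ∞ (fun z => H z i j) y) (i j k l : Fin n) :
    ∑ m, D.nablaMixed P y i j k m * H y m l =
      D.nablaThree (fun z a b c => ∑ m, P z a b m * H z m c) y i j k l
        - ∑ m, P y j k m * D.nabla H y i m l := by
  have e1 : pd i (fun z => ∑ m, P z j k m * H z m l) y =
      ∑ m, pd i (fun z => P z j k m) y * H y m l
        + ∑ m, P y j k m * pd i (fun z => H z m l) y := by
    rw [pd_sum _ _ fun m _ => (hP j k m).mul (hH m l), ← Finset.sum_add_distrib]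
    exact Finset.sum_congr rfl fun m _ => pd_mul i (hP j k m) (hH m l)
  have e2 : ∑ m, (∑ p, D.Γ y i p m * P y j k p) * H y m l =
      ∑ m, P y j k m * ∑ p, D.Γ y i m p * H y p l := by
    simp only [Finset.sum_mul, Finset.mul_sum]
    rw [Finset.sum_comm]
    exact Finset.sum_congr rfl fun p _ => Finset.sum_congr rfl fun q _ => by ring
  have e3 : ∑ p, D.Γ y i l p * ∑ m, P y j k m * H y m p =
      ∑ m, P y j k m * ∑ p, D.Γ y i l p * H y m p := by
    simp only [Finset.mul_sum]
    rw [Finset.sum_comm]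
    exact Finset.sum_congr rfl fun p _ => Finset.sum_congr rfl fun q _ => by ring
  have e4 : ∀ (c : Fin n → ℝ) (X : Fin n → Fin n → ℝ),
      ∑ m, (∑ p, c p * X p m) * H y m l = ∑ p, c p * ∑ m, X p m * H y m l := by
    intro c X
    simp only [Finset.sum_mul, Finset.mul_sum]
    rw [Finset.sum_comm]
    exact Finset.sum_congr rfl fun p _ => Finset.sum_congr rfl fun q _ => by ring
  simp only [nablaMixed, nablaThree, nabla, e1, e3, add_mul, sub_mul, mul_sub,
    Finset.sum_add_distrib, Finset.sum_sub_distrib, e2, e4]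
  ring

end LocalData
end AHGeometry

/-! ### AH structures in coordinates and the curvature of a Weyl-type change. -/

namespace AHGeometry
namespace LocalData

variable {n : ℕ} {D D' : LocalData n} {y : Model n} {U : Set (Model n)}
  {θ α : Model n → Fin n → ℝ}

/-- The cubic torsion with its last index lowered. -/
def cubicLow (D : LocalData n) (y : Model n) (i j k : Fin n) : ℝ :=
  ∑ p, D.cubicTorsion y i j p * D.H y p k

/-- The contraction `𝓛_{ij}^p α_p`. -/
def cubicForm (D : LocalData n) (α : Model n → Fin n → ℝ) (y : Model n) (i j : Fin n) : ℝ :=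
  ∑ p, D.cubicTorsion y i j p * α y p

/-- The square norm of a one-form. -/
def normSq (D : LocalData n) (α : Model n → Fin n → ℝ) (y : Model n) : ℝ :=
  ∑ p, D.raise y (α y) p * α y p

/-- The tensor `∇_i α_j - α_i α_j + (1/2) |α|² H_{ij}`. -/
def schoutenChange (D : LocalData n) (α : Model n → Fin n → ℝ) (y : Model n) (i j : Fin n) : ℝ :=
  D.nablaForm α y i j - α y i * α y j + 1 / 2 * D.normSq α y * D.H y i j

/-- The tensor `α_i δ_j^k + α_j δ_i^k - H_{ij} α^k`. -/
def weylChange (D : LocalData n) (α : Model n → Fin n → ℝ) (y : Model n) (i j k : Fin n) : ℝ :=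
  α y i * (if j = k then 1 else 0) + α y j * (if i = k then 1 else 0)
    - D.H y i j * D.raise y (α y) k

/-- The coordinate expression of an AH structure with its aligned representative: the covariant
derivative of the normalized metric is `θ ⊗ H` plus the cubic torsion. -/
structure IsAHOn (D : LocalData n) (U : Set (Model n)) (θ : Model n → Fin n → ℝ) : Prop where
  isOpen : IsOpen U
  smooth_Γ : ∀ y ∈ U, ∀ i j k, ContDiffAt ℝ ∞ (fun z => D.Γ z i j k) y
  smooth_H : ∀ y ∈ U, ∀ i j, ContDiffAt ℝ ∞ (fun z => D.H z i j) y
  smooth_Hinv : ∀ y ∈ U, ∀ i j, ContDiffAt ℝ ∞ (fun z => D.Hinv z i j) y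
  smooth_cubic : ∀ y ∈ U, ∀ i j k, ContDiffAt ℝ ∞ (fun z => D.cubicTorsion z i j k) y
  smooth_θ : ∀ y ∈ U, ∀ i, ContDiffAt ℝ ∞ (fun z => θ z i) y
  symm_Γ : ∀ y ∈ U, ∀ i j k, D.Γ y i j k = D.Γ y j i k
  metric : ∀ y ∈ U, IsMetricPair (D.H y) (D.Hinv y)
  nabla_H : ∀ y ∈ U, ∀ i j k, D.nabla D.H y i j k = θ y i * D.H y j k + D.cubicLow y i j k
  cubic_symm : ∀ y ∈ U, ∀ i j k, D.cubicTorsion y i j k = D.cubicTorsion y j i k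
  cubicLow_symm : ∀ y ∈ U, ∀ i j k, D.cubicLow y i j k = D.cubicLow y i k j
  cubic_trace : ∀ y ∈ U, ∀ i, ∑ p, D.cubicTorsion y i p p = 0

theorem sum_mul_H_eq (hm : IsMetricPair (D.H y) (D.Hinv y)) (i : Fin n) :
    ∑ p, D.raise y (α y) p * D.H y p i = α y i :=
  hm.sum_raise_lower (α y) i

theorem sum_weylChange_mul_H (hm : IsMetricPair (D.H y) (D.Hinv y)) (i j k : Fin n) :
    ∑ m, D.weylChange α y i j m * D.H y m k =
      α y i * D.H y j k + α y j * D.H y i k - D.H y i j * α y k := by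
  simp only [weylChange, sub_mul, add_mul, Finset.sum_sub_distrib, Finset.sum_add_distrib,
    mul_assoc, ← Finset.mul_sum, sum_mul_H_eq hm]
  simp

theorem sum_weylChange_mul (X : Fin n → ℝ) (i j : Fin n) :
    ∑ m, D.weylChange α y i j m * X m =
      α y i * X j + α y j * X i - D.H y i j * ∑ m, D.raise y (α y) m * X m := by
  simp only [weylChange, sub_mul, add_mul, Finset.sum_sub_distrib, Finset.sum_add_distrib,
    mul_assoc, ← Finset.mul_sum]
  simp

/-- Leibniz rule for the product of a one-form and a covariant 2-tensor. -/
theorem nablaThree_mul {H : Model n → Fin n → Fin n → ℝ}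
    (hα : ∀ i, ContDiffAt ℝ ∞ (fun z => α z i) y)
    (hH : ∀ i j, ContDiffAt ℝ ∞ (fun z => H z i j) y) (i j k l : Fin n) :
    D.nablaThree (fun z a b c => α z a * H z b c) y i j k l =
      D.nablaForm α y i j * H y k l + α y j * D.nabla H y i k l := by
  simp only [nablaThree, nablaForm, nabla, pd_mul i (hα j) (hH k l), sub_mul, mul_sub,
    Finset.sum_mul, Finset.mul_sum, mul_assoc, mul_left_comm (α y j)]
  ring

theorem nablaThree_weyl {H : Model n → Fin n → Fin n → ℝ}
    (hα : ∀ i, ContDiffAt ℝ ∞ (fun z => α z i) y)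
    (hH : ∀ i j, ContDiffAt ℝ ∞ (fun z => H z i j) y) (i j k l : Fin n) :
    D.nablaThree (fun z a b c => α z a * H z b c + α z b * H z a c - H z a b * α z c) y i j k l =
      D.nablaForm α y i j * H y k l + α y j * D.nabla H y i k l
      + (D.nablaForm α y i k * H y j l + α y k * D.nabla H y i j l)
      - (D.nablaForm α y i l * H y j k + α y l * D.nabla H y i j k) := by
  have e1 : pd i (fun z => α z j * H z k l + α z k * H z j l - H z j k * α z l) y =
      pd i (fun z => α z j) y * H y k l + α y j * pd i (fun z => H z k l) y
      + (pd i (fun z => α z k) y * H y j l + α y k * pd i (fun z => H z j l) y)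
      - (pd i (fun z => H z j k) y * α y l + H y j k * pd i (fun z => α z l) y) := by
    rw [pd_sub i (((hα j).mul (hH k l)).add ((hα k).mul (hH j l))) ((hH j k).mul (hα l)),
      pd_add i ((hα j).mul (hH k l)) ((hα k).mul (hH j l)), pd_mul i (hα j) (hH k l),
      pd_mul i (hα k) (hH j l), pd_mul i (hH j k) (hα l)]
  simp only [nablaThree, nablaForm, nabla, e1, sub_mul, mul_sub, mul_add,
    Finset.sum_mul, Finset.mul_sum, Finset.sum_add_distrib, Finset.sum_sub_distrib, mul_assoc,
    mul_left_comm (α y _), mul_comm (H y _ _) (α y _)]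
  ring

theorem nablaThree_congr {P Q : Model n → Fin n → Fin n → Fin n → ℝ}
    (h : ∀ᶠ z in nhds y, P z = Q z) (i j k l : Fin n) :
    D.nablaThree P y i j k l = D.nablaThree Q y i j k l := by
  have e : pd i (fun z => P z j k l) y = pd i (fun z => Q z j k l) y :=
    pd_congr i (h.mono fun z hz => by simp only [hz])
  simp only [nablaThree, e, h.self_of_nhds]

namespace IsAHOn

variable (h : D.IsAHOn U θ)
include h

theorem cubicLow_swap (hy : y ∈ U) (i j k : Fin n) : D.cubicLow y i j k = D.cubicLow y j i k := by
  simp only [cubicLow, h.cubic_symm y hy i j]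

theorem sum_raise_mul_cubicLow (hy : y ∈ U) (i l : Fin n) :
    ∑ m, D.raise y (α y) m * D.cubicLow y i m l = D.cubicForm α y i l := by
  have hs : ∀ m, D.cubicLow y i m l = D.cubicLow y i l m := fun m => h.cubicLow_symm y hy i m l
  simp only [hs]
  simp only [cubicLow, cubicForm, Finset.mul_sum]
  rw [Finset.sum_comm]
  refine Finset.sum_congr rfl fun p _ => ?_
  rw [← sum_mul_H_eq (D := D) (α := α) (h.metric y hy) p, Finset.mul_sum]
  exact Finset.sum_congr rfl fun q _ => by rw [(h.metric y hy).symm q p]; ring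

theorem contDiffAt_raise (hy : y ∈ U) (hα : ∀ i, ContDiffAt ℝ ∞ (fun z => α z i) y) (k : Fin n) :
    ContDiffAt ℝ ∞ (fun z => D.raise z (α z) k) y :=
  ContDiffAt.sum fun p _ => (h.smooth_Hinv y hy k p).mul (hα p)

theorem contDiffAt_weylChange (hy : y ∈ U) (hα : ∀ i, ContDiffAt ℝ ∞ (fun z => α z i) y)
    (i j k : Fin n) : ContDiffAt ℝ ∞ (fun z => D.weylChange α z i j k) y :=
  (((hα i).mul contDiffAt_const).add ((hα j).mul contDiffAt_const)).sub
    ((h.smooth_H y hy i j).mul (h.contDiffAt_raise hy hα k))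

/-- With its index lowered the Weyl change is polynomial in α and H, so the derivative of the
inverse metric never enters. The contributions of θ cancel, since H_ij α^k has H once below and once
above; those of 𝓛 remain. -/
theorem sum_nablaMixed_weylChange (hy : y ∈ U) (hα : ∀ i, ContDiffAt ℝ ∞ (fun z => α z i) y)
    (i j k l : Fin n) :
    ∑ m, D.nablaMixed (D.weylChange α) y i j k m * D.H y m l =
      D.nablaForm α y i j * D.H y k l + D.nablaForm α y i k * D.H y j l
        - D.nablaForm α y i l * D.H y j k - D.cubicLow y i j k * α y l
        + D.H y j k * D.cubicForm α y i l := by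
  rw [sum_nablaMixed_mul (h.contDiffAt_weylChange hy hα) (h.smooth_H y hy), sum_weylChange_mul]
  have e : D.nablaThree (fun z a b c => ∑ m, D.weylChange α z a b m * D.H z m c) y i j k l =
      D.nablaThree (fun z a b c => α z a * D.H z b c + α z b * D.H z a c - D.H z a b * α z c)
        y i j k l := by
    refine nablaThree_congr ?_ i j k l
    filter_upwards [h.isOpen.mem_nhds hy] with z hz
    funext a b c
    exact sum_weylChange_mul_H (h.metric z hz) a b c
  rw [e, nablaThree_weyl hα (h.smooth_H y hy)]
  simp only [h.nabla_H y hy, mul_add, Finset.sum_add_distrib, h.sum_raise_mul_cubicLow hy,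
    mul_left_comm _ (θ y i), ← Finset.mul_sum, sum_mul_H_eq (h.metric y hy)]
  ring

/-- The quadratic part of the change completes ∇α to `schoutenChange`. The failure of ∇ to preserve
the conformal metric enters only through `cubicForm`, and only in the terms with H_jk and H_ik; this
is what makes part of the change symmetric in k, l. -/
theorem curvLow_change (hy : y ∈ U) (hα : ∀ i, ContDiffAt ℝ ∞ (fun z => α z i) y)
    (hH : D'.H y = D.H y)
    (hΓ : ∀ᶠ z in nhds y, ∀ i j k, D'.Γ z i j k = D.Γ z i j k + D.weylChange α z i j k)
    (i j k l : Fin n) :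
    D'.curvLow y i j k l = D.curvLow y i j k l
      + (D.nablaForm α y i j - D.nablaForm α y j i) * D.H y k l
      + D.schoutenChange α y i k * D.H y j l - D.schoutenChange α y j k * D.H y i l
      - D.H y j k * (D.schoutenChange α y i l - D.cubicForm α y i l)
      + D.H y i k * (D.schoutenChange α y j l - D.cubicForm α y j l) := by
  have hm := h.metric y hy
  have q1 : ∀ i j k l, ∑ m, (∑ p, D.weylChange α y i p m * D.weylChange α y j k p) * D.H y m l =
      ∑ p, D.weylChange α y j k p * (∑ m, D.weylChange α y i p m * D.H y m l) := by
    intro i j k l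
    simp only [Finset.sum_mul, Finset.mul_sum]
    rw [Finset.sum_comm]
    exact Finset.sum_congr rfl fun p _ => Finset.sum_congr rfl fun q _ => by ring
  -- Expand the inner lowered factor, then contract the outer one with H_kl, with α and with H_ki;
  -- contraction with α produces |α|².
  have q2 : ∀ i j k l, ∑ p, D.weylChange α y j k p * (∑ m, D.weylChange α y i p m * D.H y m l) =
      α y i * (α y j * D.H y k l + α y k * D.H y j l - D.H y j k * α y l)
      + D.H y i l * (2 * (α y j * α y k) - D.H y j k * D.normSq α y)
      - α y l * (α y j * D.H y k i + α y k * D.H y j i - D.H y j k * α y i) := by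
    intro i j k l
    simp only [sum_weylChange_mul_H hm]
    rw [← sum_weylChange_mul_H hm j k l, ← sum_weylChange_mul_H hm j k i]
    have e := sum_weylChange_mul (D := D) (α := α) (y := y) (α y) j k
    have e' : ∑ m, D.weylChange α y j k m * α y m =
        2 * (α y j * α y k) - D.H y j k * D.normSq α y := by
      rw [e, normSq]; ring
    rw [← e']
    simp only [Finset.mul_sum, ← Finset.sum_add_distrib, ← Finset.sum_sub_distrib]
    exact Finset.sum_congr rfl fun p _ => by rw [hm.symm i p]; ring
  simp only [curvLow, curv_of_Γ_eq_add (h.smooth_Γ y hy) (h.contDiffAt_weylChange hy hα)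
    (h.symm_Γ y hy) hΓ, hH, add_mul, sub_mul, Finset.sum_add_distrib, Finset.sum_sub_distrib,
    h.sum_nablaMixed_weylChange hy hα, q1, q2, schoutenChange]
  rw [h.cubicLow_swap hy j i, hm.symm k i, hm.symm k j, hm.symm j i]
  ring

end IsAHOn

end LocalData
end AHGeometry

/-! ### Ricci and Bianchi identities, and the curvature symmetries of an AH structure. -/

namespace AHGeometry
namespace LocalData

variable {n : ℕ} {D D' : LocalData n} {y : Model n} {U : Set (Model n)}
  {θ α : Model n → Fin n → ℝ}

/-- The contraction of the curvature with a covector. -/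
theorem sum_curv_mul (X : Fin n → ℝ) (i j k : Fin n) :
    ∑ p, D.curv y i j k p * X p =
      ∑ p, pd i (fun z => D.Γ z j k p) y * X p - ∑ p, pd j (fun z => D.Γ z i k p) y * X p
      + ∑ p, D.Γ y j k p * (∑ q, D.Γ y i p q * X q)
      - ∑ p, D.Γ y i k p * (∑ q, D.Γ y j p q * X q) := by
  have e : ∀ i j k, ∑ p, (∑ q, D.Γ y i q p * D.Γ y j k q) * X p =
      ∑ p, D.Γ y j k p * (∑ q, D.Γ y i p q * X q) := by
    intro i j k
    simp only [Finset.sum_mul, Finset.mul_sum]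
    rw [Finset.sum_comm]
    exact Finset.sum_congr rfl fun p _ => Finset.sum_congr rfl fun q _ => by ring
  rw [← e, ← e]
  simp only [curv, add_mul, sub_mul, Finset.sum_add_distrib, Finset.sum_sub_distrib]
  ring

theorem pd_nablaForm (hΓ : ∀ i j k, ContDiffAt ℝ ∞ (fun z => D.Γ z i j k) y)
    (hα : ∀ i, ContDiffAt ℝ ∞ (fun z => α z i) y) (i j k : Fin n) :
    pd i (fun z => D.nablaForm α z j k) y = pd i (fun z => pd j (fun w => α w k) z) y
      - (∑ p, pd i (fun z => D.Γ z j k p) y * α y p + ∑ p, D.Γ y j k p * pd i (fun z => α z p) y) := by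
  unfold nablaForm
  rw [pd_sub i (contDiffAt_pd j (hα k)) (ContDiffAt.sum fun p _ => (hΓ j k p).mul (hα p)),
    pd_sum _ _ fun p _ => (hΓ j k p).mul (hα p), ← Finset.sum_add_distrib]
  congr 1
  exact Finset.sum_congr rfl fun p _ => pd_mul i (hΓ j k p) (hα p)

/-- The Ricci identity for one-forms. -/
theorem skewNabla_nablaForm (hΓ : ∀ i j k, ContDiffAt ℝ ∞ (fun z => D.Γ z i j k) y)
    (hsymm : ∀ i j k, D.Γ y i j k = D.Γ y j i k)
    (hα : ∀ i, ContDiffAt ℝ ∞ (fun z => α z i) y) (i j k : Fin n) :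
    D.skewNabla (D.nablaForm α) y i j k = -∑ p, D.curv y i j k p * α y p := by
  rw [sum_curv_mul, skewNabla, nabla, nabla, pd_nablaForm hΓ hα, pd_nablaForm hΓ hα,
    pd_comm i j (hα k)]
  have e : ∀ i j k, ∑ p, D.Γ y i k p * D.nablaForm α y j p =
      ∑ p, D.Γ y i k p * pd j (fun z => α z p) y
        - ∑ p, D.Γ y i k p * (∑ q, D.Γ y j p q * α y q) := by
    intro i j k
    simp only [nablaForm, mul_sub, Finset.sum_sub_distrib]
  simp only [e, hsymm j i]
  ring

theorem pd_nabla {X : Model n → Fin n → Fin n → ℝ}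
    (hΓ : ∀ i j k, ContDiffAt ℝ ∞ (fun z => D.Γ z i j k) y)
    (hX : ∀ i j, ContDiffAt ℝ ∞ (fun z => X z i j) y) (i j k l : Fin n) :
    pd i (fun z => D.nabla X z j k l) y = pd i (fun z => pd j (fun w => X w k l) z) y
      - (∑ p, pd i (fun z => D.Γ z j k p) y * X y p l
        + ∑ p, D.Γ y j k p * pd i (fun z => X z p l) y)
      - (∑ p, pd i (fun z => D.Γ z j l p) y * X y k p
        + ∑ p, D.Γ y j l p * pd i (fun z => X z k p) y) := by
  unfold nabla
  have h1 : ContDiffAt ℝ ∞ (fun z => ∑ p, D.Γ z j k p * X z p l) y :=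
    ContDiffAt.sum fun p _ => (hΓ j k p).mul (hX p l)
  have h2 : ContDiffAt ℝ ∞ (fun z => ∑ p, D.Γ z j l p * X z k p) y :=
    ContDiffAt.sum fun p _ => (hΓ j l p).mul (hX k p)
  rw [pd_sub i ((contDiffAt_pd j (hX k l)).sub h1) h2, pd_sub i (contDiffAt_pd j (hX k l)) h1,
    pd_sum _ _ fun p _ => (hΓ j k p).mul (hX p l), pd_sum _ _ fun p _ => (hΓ j l p).mul (hX k p),
    ← Finset.sum_add_distrib, ← Finset.sum_add_distrib]
  congr 1
  · congr 1
    exact Finset.sum_congr rfl fun p _ => pd_mul i (hΓ j k p) (hX p l)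
  · exact Finset.sum_congr rfl fun p _ => pd_mul i (hΓ j l p) (hX k p)

/-- The Ricci identity for covariant 2-tensors. -/
theorem nablaThree_nabla_sub {X : Model n → Fin n → Fin n → ℝ}
    (hΓ : ∀ i j k, ContDiffAt ℝ ∞ (fun z => D.Γ z i j k) y)
    (hsymm : ∀ i j k, D.Γ y i j k = D.Γ y j i k)
    (hX : ∀ i j, ContDiffAt ℝ ∞ (fun z => X z i j) y) (i j k l : Fin n) :
    D.nablaThree (D.nabla X) y i j k l - D.nablaThree (D.nabla X) y j i k l =
      -∑ p, D.curv y i j k p * X y p l - ∑ p, D.curv y i j l p * X y k p := by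
  rw [sum_curv_mul, sum_curv_mul, nablaThree, nablaThree, pd_nabla hΓ hX, pd_nabla hΓ hX,
    pd_comm i j (hX k l)]
  have e1 : ∀ i j k l, ∑ p, D.Γ y i k p * D.nabla X y j p l =
      ∑ p, D.Γ y i k p * pd j (fun z => X z p l) y
        - ∑ p, D.Γ y i k p * (∑ q, D.Γ y j p q * X y q l)
        - ∑ p, ∑ q, D.Γ y i k p * (D.Γ y j l q * X y p q) := by
    intro i j k l
    simp only [nabla, mul_sub, Finset.sum_sub_distrib, Finset.mul_sum]
  have e2 : ∀ i j k l, ∑ p, D.Γ y i l p * D.nabla X y j k p =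
      ∑ p, D.Γ y i l p * pd j (fun z => X z k p) y
        - ∑ p, ∑ q, D.Γ y j k p * (D.Γ y i l q * X y p q)
        - ∑ p, D.Γ y i l p * (∑ q, D.Γ y j p q * X y k q) := by
    intro i j k l
    have : ∑ p, ∑ q, D.Γ y j k p * (D.Γ y i l q * X y p q) =
        ∑ p, D.Γ y i l p * ∑ q, D.Γ y j k q * X y q p := by
      simp only [Finset.mul_sum]
      rw [Finset.sum_comm]
      exact Finset.sum_congr rfl fun p _ => Finset.sum_congr rfl fun q _ => by ring
    rw [this]
    simp only [nabla, mul_sub, Finset.sum_sub_distrib]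
  simp only [e1, e2, hsymm j i]
  ring

/-- The first Bianchi identity. -/
theorem curv_cyclic (hsymm : ∀ᶠ z in nhds y, ∀ i j k, D.Γ z i j k = D.Γ z j i k)
    (i j k l : Fin n) : D.curv y i j k l + D.curv y j k i l + D.curv y k i j l = 0 := by
  have e : ∀ a i j k, pd a (fun z => D.Γ z i j k) y = pd a (fun z => D.Γ z j i k) y :=
    fun a i j k => pd_congr a (hsymm.mono fun z hz => hz i j k)
  have h := hsymm.self_of_nhds
  simp only [curv, Finset.sum_sub_distrib]
  rw [e i k j l, e j k i l, e k j i l, funext fun p => h k i p, funext fun p => h k j p,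
    funext fun p => h j i p]
  ring

namespace IsAHOn

variable (h : D.IsAHOn U θ)
include h

/-- The skew part of the covariant derivative of the cubic torsion, corrected by a quadratic
term. -/
theorem curvLow_add_swap (hy : y ∈ U) (i j k l : Fin n) :
    D.curvLow y i j k l + D.curvLow y i j l k =
      -((D.nablaForm θ y i j - D.nablaForm θ y j i) * D.H y k l
      + ∑ m, (D.nablaMixed D.cubicTorsion y i j k m - D.nablaMixed D.cubicTorsion y j i k m)
          * D.H y m l
      + ∑ m, (D.cubicTorsion y j k m * D.cubicLow y i m l
          - D.cubicTorsion y i k m * D.cubicLow y j m l)) := by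
  have hm := h.metric y hy
  -- The Ricci identity for H gives minus the part of the curvature symmetric in k, l; the left side
  -- is then computed from ∇H = θ ⊗ H + 𝓛.
  have e1 := nablaThree_nabla_sub (h.smooth_Γ y hy) (h.symm_Γ y hy) (h.smooth_H y hy) i j k l
  have e2 : ∑ p, D.curv y i j l p * D.H y k p = D.curvLow y i j l k :=
    Finset.sum_congr rfl fun p _ => by rw [hm.symm]
  have e3 : ∀ i j k l, D.nablaThree (D.nabla D.H) y i j k l =
      D.nablaThree (fun z a b c => θ z a * D.H z b c) y i j k l
        + D.nablaThree D.cubicLow y i j k l := by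
    intro i j k l
    have : D.nablaThree (D.nabla D.H) y i j k l =
        D.nablaThree (fun z a b c => θ z a * D.H z b c + D.cubicLow z a b c) y i j k l := by
      refine nablaThree_congr ?_ i j k l
      filter_upwards [h.isOpen.mem_nhds hy] with z hz
      funext a b c
      exact h.nabla_H z hz a b c
    rw [this]
    have h2 : ContDiffAt ℝ ∞ (fun z => D.cubicLow z j k l) y :=
      ContDiffAt.sum fun p _ => (h.smooth_cubic y hy j k p).mul (h.smooth_H y hy p l)
    simp only [nablaThree, pd_add i ((h.smooth_θ y hy j).mul (h.smooth_H y hy k l)) h2, mul_add,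
      Finset.sum_add_distrib]
    ring
  have e4 : ∀ i j k l, D.nablaThree D.cubicLow y i j k l =
      ∑ m, D.nablaMixed D.cubicTorsion y i j k m * D.H y m l
        + (θ y i * D.cubicLow y j k l + ∑ m, D.cubicTorsion y j k m * D.cubicLow y i m l) := by
    intro i j k l
    have := sum_nablaMixed_mul (D := D) (h.smooth_cubic y hy) (h.smooth_H y hy) i j k l
    have h2 : ∑ m, D.cubicTorsion y j k m * D.nabla D.H y i m l =
        θ y i * D.cubicLow y j k l + ∑ m, D.cubicTorsion y j k m * D.cubicLow y i m l := by
      simp only [h.nabla_H y hy, mul_add, Finset.sum_add_distrib, mul_left_comm _ (θ y i),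
        ← Finset.mul_sum]
      rfl
    rw [this, h2]
    change D.nablaThree D.cubicLow y i j k l = D.nablaThree D.cubicLow y i j k l - _ + _
    ring
  rw [e2] at e1
  -- The products of θ with 𝓛 from the two summands of ∇H cancel each other, and θ_i θ_j disappears
  -- on skewing.
  simp only [e3, e4, nablaThree_mul (h.smooth_θ y hy) (h.smooth_H y hy), h.nabla_H y hy] at e1
  simp only [sub_mul, Finset.sum_sub_distrib]
  have e5 : ∑ p, D.curv y i j k p * D.H y p l = D.curvLow y i j k l := rfl
  linarith

/-- Covariant differentiation commutes with the trace of an upper and a lower index, and 𝓛 is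
trace-free. -/
theorem sum_nablaMixed_cubic (hy : y ∈ U) (i j : Fin n) :
    ∑ m, D.nablaMixed D.cubicTorsion y i j m m = 0 := by
  have e1 : ∑ m, pd i (fun z => D.cubicTorsion z j m m) y = 0 := by
    rw [← pd_sum _ _ fun m _ => h.smooth_cubic y hy j m m, ← pd_const (y := y) i 0]
    apply pd_congr
    filter_upwards [h.isOpen.mem_nhds hy] with z hz using h.cubic_trace z hz j
  have e2 : ∑ m, ∑ p, D.Γ y i j p * D.cubicTorsion y p m m = 0 := by
    rw [Finset.sum_comm]
    simp only [← Finset.mul_sum, h.cubic_trace y hy, mul_zero, Finset.sum_const_zero]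
  have e3 : ∑ m, ∑ p, D.Γ y i m p * D.cubicTorsion y j p m =
      ∑ m, ∑ p, D.Γ y i p m * D.cubicTorsion y j m p := Finset.sum_comm
  simp only [nablaMixed, Finset.sum_add_distrib, Finset.sum_sub_distrib, e1, e2, e3]
  ring

theorem contr_cubic_mul_cubicLow (hy : y ∈ U) (i j : Fin n) :
    contr (D.Hinv y) (fun k l => ∑ m, D.cubicTorsion y j k m * D.cubicLow y i m l) =
      ∑ k, ∑ m, D.cubicTorsion y j k m * D.cubicTorsion y i m k := by
  rw [← contr_lower (h.metric y hy) fun k r => ∑ m, D.cubicTorsion y j k m * D.cubicTorsion y i m r]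
  congr 1; funext k l
  simp only [cubicLow, Finset.sum_mul, Finset.mul_sum]
  rw [Finset.sum_comm]
  exact Finset.sum_congr rfl fun p _ => Finset.sum_congr rfl fun q _ => by ring

/-- Trace `curvLow_add_swap` over k, l. The derivative of 𝓛 has no trace and the traced quadratic
term is symmetric in i, j, which leaves -n dθ = 2 n F. -/
theorem nablaForm_sub (hn : 2 ≤ n) (hy : y ∈ U) (i j : Fin n) :
    D.nablaForm θ y i j - D.nablaForm θ y j i = -2 * D.faradayForm y i j := by
  have hn0 : (n : ℝ) ≠ 0 := by positivity
  have hm := h.metric y hy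
  have e1 := faradayForm_eq_contr hm i j
  have e2 : contr (D.Hinv y) (fun k l => D.curvLow y i j k l + D.curvLow y i j l k) =
      2 * (n * D.faradayForm y i j) := by
    rw [contr_add, hm.contr_swap (fun k l => D.curvLow y i j k l), e1]
    field_simp
    norm_num
  have e3 : ∑ k, ∑ m, D.cubicTorsion y j k m * D.cubicTorsion y i m k =
      ∑ k, ∑ m, D.cubicTorsion y i k m * D.cubicTorsion y j m k := by
    rw [Finset.sum_comm]
    exact Finset.sum_congr rfl fun p _ => Finset.sum_congr rfl fun q _ => by ring
  have e4 := contr_lower hm (fun k m => D.nablaMixed D.cubicTorsion y i j k m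
    - D.nablaMixed D.cubicTorsion y j i k m)
  rw [Finset.sum_sub_distrib, h.sum_nablaMixed_cubic hy, h.sum_nablaMixed_cubic hy] at e4
  simp only [h.curvLow_add_swap hy] at e2
  rw [contr_neg, contr_add, contr_add, contr_const_mul, hm.contr_metric, e4] at e2
  simp only [Finset.sum_sub_distrib, contr_sub, h.contr_cubic_mul_cubicLow hy, e3] at e2
  have : (n : ℝ) * (D.nablaForm θ y i j - D.nablaForm θ y j i + 2 * D.faradayForm y i j) = 0 := by
    linarith
  have := (mul_eq_zero.1 this).resolve_left hn0
  linarith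

/-- Since dθ = -2F, removing F_ij H_kl from the symmetric part leaves only derivatives of 𝓛 and
terms quadratic in 𝓛. Their cyclic sum cancels in pairs because 𝓛 is symmetric in its lower indices.
-/
theorem curvatureIdentities (hn : 2 ≤ n) (hy : y ∈ U) : D.CurvatureIdentities y := by
  have hm := h.metric y hy
  have hU : ∀ᶠ z in nhds y, z ∈ U := h.isOpen.mem_nhds hy
  refine ⟨hm, fun i j k l => ?_, fun i j k l => ?_⟩
  · simp only [curvLow, ← Finset.sum_add_distrib]
    refine Finset.sum_eq_zero fun p _ => ?_
    rw [← add_mul, ← add_mul, curv_cyclic (hU.mono h.symm_Γ), zero_mul]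
  · simp only [h.curvLow_add_swap hy, h.nablaForm_sub hn hy]
    have e1 : ∀ a i j k, pd a (fun z => D.cubicTorsion z i j k) y =
        pd a (fun z => D.cubicTorsion z j i k) y :=
      fun a i j k => pd_congr a (hU.mono fun z hz => h.cubic_symm z hz i j k)
    have s := h.cubic_symm y hy
    have e2 : ∀ i j k m, D.nablaMixed D.cubicTorsion y i j k m =
        D.nablaMixed D.cubicTorsion y i k j m := fun i j k m => by
      simp only [nablaMixed, e1 i j k m, s j k, s _ k, s j _]
      ring
    have e3 : ∑ m, (D.nablaMixed D.cubicTorsion y i j k m - D.nablaMixed D.cubicTorsion y j i k m)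
          * D.H y m l
        + ∑ m, (D.cubicTorsion y j k m * D.cubicLow y i m l
          - D.cubicTorsion y i k m * D.cubicLow y j m l)
        + (∑ m, (D.nablaMixed D.cubicTorsion y j k i m - D.nablaMixed D.cubicTorsion y k j i m)
          * D.H y m l
        + ∑ m, (D.cubicTorsion y k i m * D.cubicLow y j m l
          - D.cubicTorsion y j i m * D.cubicLow y k m l))
        + (∑ m, (D.nablaMixed D.cubicTorsion y k i j m - D.nablaMixed D.cubicTorsion y i k j m)
          * D.H y m l
        + ∑ m, (D.cubicTorsion y i j m * D.cubicLow y k m l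
          - D.cubicTorsion y k j m * D.cubicLow y i m l)) = 0 := by
      simp only [← Finset.sum_add_distrib]
      refine Finset.sum_eq_zero fun m _ => ?_
      rw [e2 i k j, e2 j k i, e2 k j i, s j k, s i k, s j i]
      ring
    linarith

end IsAHOn

end LocalData
end AHGeometry

/-! ### Pairs of AH structures: invariance of the cubic torsion and the change of curvature. -/

namespace AHGeometry
namespace LocalData

variable {n : ℕ} {D D' : LocalData n} {y : Model n} {U : Set (Model n)}
  {θ θ' α : Model n → Fin n → ℝ}

/-- Two AH structures with the same normalized metric whose aligned representatives differ by the
tensor `α_i δ_j^k + α_j δ_i^k - H_{ij} α^k`. -/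
structure IsAHPairOn (D D' : LocalData n) (U : Set (Model n)) (θ θ' α : Model n → Fin n → ℝ) :
    Prop where
  left : D.IsAHOn U θ
  right : D'.IsAHOn U θ'
  H_eq : ∀ y ∈ U, D'.H y = D.H y
  Hinv_eq : ∀ y ∈ U, D'.Hinv y = D.Hinv y
  smooth : ∀ y ∈ U, ∀ i, ContDiffAt ℝ ∞ (fun z => α z i) y
  Γ_eq : ∀ y ∈ U, ∀ i j k, D'.Γ y i j k = D.Γ y i j k + D.weylChange α y i j k

theorem IsAHOn.contr_cubicLow (h : D.IsAHOn U θ) (hy : y ∈ U) (i : Fin n) :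
    contr (D.Hinv y) (fun p q => D.cubicLow y i p q) = 0 := by
  rw [← h.cubic_trace y hy i, ← contr_lower (h.metric y hy) fun p r => D.cubicTorsion y i p r]
  rfl

theorem IsAHOn.cubicForm_symm (h : D.IsAHOn U θ) (hy : y ∈ U) (i j : Fin n) :
    D.cubicForm α y i j = D.cubicForm α y j i := by
  simp only [cubicForm, h.cubic_symm y hy i j]

theorem IsAHOn.contr_cubicForm (h : D.IsAHOn U θ) (hy : y ∈ U) :
    contr (D.Hinv y) (D.cubicForm α y) = 0 := by
  have : contr (D.Hinv y) (fun i j => D.cubicForm α y i j) = 0 := by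
    simp only [← h.sum_raise_mul_cubicLow hy, contr_sum, contr_const_mul, h.cubicLow_swap hy _ _,
      h.contr_cubicLow hy, mul_zero, Finset.sum_const_zero]
  exact this

namespace IsAHPairOn

variable (h : IsAHPairOn D D' U θ θ' α)
include h

/-- The part of the lowered Weyl change symmetric in its last two indices is α_i H_jk: such a change
affects only the conformal scale. -/
theorem nabla_H (hy : y ∈ U) (i j k : Fin n) :
    D'.nabla D'.H y i j k = D.nabla D.H y i j k - 2 * α y i * D.H y j k := by
  have hm := h.left.metric y hy
  have e : pd i (fun z => D'.H z j k) y = pd i (fun z => D.H z j k) y :=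
    pd_congr i (Filter.eventually_of_mem (h.left.isOpen.mem_nhds hy) fun z hz => by simp only [h.H_eq z hz])
  have e1 := sum_weylChange_mul_H (α := α) hm i j k
  have e2 : ∑ m, D.weylChange α y i k m * D.H y j m =
      α y i * D.H y k j + α y k * D.H y i j - D.H y i k * α y j := by
    rw [← sum_weylChange_mul_H hm]
    exact Finset.sum_congr rfl fun m _ => by rw [hm.symm m]
  simp only [nabla, e, h.H_eq y hy, h.Γ_eq y hy, add_mul, Finset.sum_add_distrib, e1, e2]
  rw [hm.symm k j]
  ring

theorem θ_cubicLow (hy : y ∈ U) (i j k : Fin n) :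
    θ' y i * D.H y j k + D'.cubicLow y i j k =
      θ y i * D.H y j k + D.cubicLow y i j k - 2 * α y i * D.H y j k := by
  have e := h.nabla_H hy i j k
  rwa [h.left.nabla_H y hy, h.right.nabla_H y hy, h.H_eq y hy] at e

/-- In `θ_cubicLow` the trace over j, k gives θ' = θ - 2α; what is left is the equality of the cubic
torsions. -/
theorem cubicTorsion_eq (hn : 2 ≤ n) (hy : y ∈ U) : D'.cubicTorsion y = D.cubicTorsion y := by
  have hn0 : (n : ℝ) ≠ 0 := by positivity
  have hm := h.left.metric y hy
  have e : ∀ i, θ' y i = θ y i - 2 * α y i := by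
    intro i
    have e1 : contr (D.Hinv y) (fun j k => θ' y i * D.H y j k + D'.cubicLow y i j k) =
        contr (D.Hinv y)
          (fun j k => θ y i * D.H y j k + D.cubicLow y i j k - 2 * α y i * D.H y j k) := by
      congr 1; funext j k; exact h.θ_cubicLow hy i j k
    have e2 := h.right.contr_cubicLow hy i
    rw [h.Hinv_eq y hy] at e2
    simp only [contr_add, contr_sub, contr_const_mul, h.left.contr_cubicLow hy, e2,
      hm.contr_metric] at e1
    have : (n : ℝ) * (θ' y i - (θ y i - 2 * α y i)) = 0 := by linarith
    linarith [(mul_eq_zero.1 this).resolve_left hn0]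
  funext i j
  apply hm.lower_injective
  intro k
  have e1 := h.θ_cubicLow hy i j k
  rw [e] at e1
  simp only [cubicLow, h.H_eq y hy] at e1
  linarith

/-- The self-conjugate part of the change of the curvature. -/
theorem curvatureChange (hn : 2 ≤ n) (hy : y ∈ U) : CurvatureChange D D' y
    (fun i j => D.nablaForm α y i j - D.nablaForm α y j i)
    (fun i j => (D.schoutenChange α y i j + D.schoutenChange α y j i) / 2
      - 1 / 2 * D.cubicForm α y i j)
    (fun i j => 1 / 2 * D.cubicForm α y i j) := by
  have hn0 : (n : ℝ) ≠ 0 := by positivity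
  have hm := h.left.metric y hy
  have hm' := h.right.metric y hy
  have hB := fun i j => h.left.cubicForm_symm (α := α) hy i j
  -- The skew part ½ dα of `schoutenChange` goes into `formProd`. The term `cubicForm`, present in
  -- one pair of products only, is split evenly between the skew and the symmetric product.
  have hcurv : ∀ i j k l, D'.curvLow y i j k l = D.curvLow y i j k l
      + formProd (D.H y) (fun i j => D.nablaForm α y i j - D.nablaForm α y j i) i j k l
      + skewProd (D.H y) (fun i j => (D.schoutenChange α y i j + D.schoutenChange α y j i) / 2
      - 1 / 2 * D.cubicForm α y i j) i j k l
      + symmProd (D.H y) (fun i j => 1 / 2 * D.cubicForm α y i j) i j k l := by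
    intro i j k l
    rw [h.left.curvLow_change hy (h.smooth y hy) (h.H_eq y hy)
      (Filter.eventually_of_mem (h.left.isOpen.mem_nhds hy) h.Γ_eq)]
    simp only [formProd, skewProd, symmProd, schoutenChange, hm.symm k i, hm.symm k j, hm.symm l i,
      hm.symm l j]
    ring
  refine ⟨hm, h.H_eq y hy, h.Hinv_eq y hy, fun i j => ?_, fun i j => ?_, fun i j => ?_, ?_,
    fun i j => ?_, hcurv⟩
  -- Trace over the last two indices: the skew product has no such trace, that of the symmetric
  -- product cancels by symmetry of `cubicForm`, and `formProd` gives n times the two-form.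
  · rw [faradayForm_eq_contr hm, faradayForm_eq_contr hm', h.Hinv_eq y hy]
    simp only [hcurv]
    rw [contr_add, contr_add, contr_add, contr_formProd_last hm fun i j => by ring]
    have e1 : contr (D.Hinv y) (fun p q => skewProd (D.H y)
        (fun i j => (D.schoutenChange α y i j + D.schoutenChange α y j i) / 2
      - 1 / 2 * D.cubicForm α y i j) i j p q) = 0 :=
      hm.contr_antisymm fun p q => by simp only [skewProd]; ring
    have e2 : contr (D.Hinv y) (fun p q => symmProd (D.H y)
        (fun i j => 1 / 2 * D.cubicForm α y i j) i j p q) = 0 := by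
      simp only [symmProd, contr_add, contr_sub, hm.contr_right_comm', hm.contr_left_comm']
      rw [hB j i]; ring
    rw [e1, e2]
    field_simp
    ring
  · rw [hB j i]; ring
  · rw [hB j i]
  · rw [contr_const_mul]
    rw [show contr (D.Hinv y) (fun i j => D.cubicForm α y i j) = 0 from h.left.contr_cubicForm hy,
      mul_zero]
  · ring

end IsAHPairOn

/-! ### Smoothness of the curvature tensors -/

namespace IsAHOn

variable (h : D.IsAHOn U θ)
include h

theorem contDiffAt_curv (hy : y ∈ U) (i j k l : Fin n) :
    ContDiffAt ℝ ∞ (fun z => D.curv z i j k l) y :=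
  ((contDiffAt_pd i (h.smooth_Γ y hy j k l)).sub (contDiffAt_pd j (h.smooth_Γ y hy i k l))).add
    (ContDiffAt.sum fun p _ => ((h.smooth_Γ y hy i p l).mul (h.smooth_Γ y hy j k p)).sub
      ((h.smooth_Γ y hy j p l).mul (h.smooth_Γ y hy i k p)))

theorem contDiffAt_curvLow (hy : y ∈ U) (i j k l : Fin n) :
    ContDiffAt ℝ ∞ (fun z => D.curvLow z i j k l) y :=
  ContDiffAt.sum fun p _ => (h.contDiffAt_curv hy i j k p).mul (h.smooth_H y hy p l)

theorem contDiffAt_contr (hy : y ∈ U) {f : Model n → Fin n → Fin n → ℝ}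
    (hf : ∀ p q, ContDiffAt ℝ ∞ (fun z => f z p q) y) :
    ContDiffAt ℝ ∞ (fun z => contr (D.Hinv z) (f z)) y :=
  ContDiffAt.sum fun p _ => ContDiffAt.sum fun q _ => (h.smooth_Hinv y hy p q).mul (hf p q)

theorem contDiffAt_faradayForm (hy : y ∈ U) (i j : Fin n) :
    ContDiffAt ℝ ∞ (fun z => D.faradayForm z i j) y :=
  contDiffAt_const.mul (ContDiffAt.sum fun p _ => h.contDiffAt_curv hy i j p p)

theorem contDiffAt_faradayCurv (hy : y ∈ U) (i j k l : Fin n) :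
    ContDiffAt ℝ ∞ (fun z => D.faradayCurv z i j k l) y := by
  have hF := h.contDiffAt_faradayForm hy
  have hH := h.smooth_H y hy
  unfold faradayCurv
  exact (((hF i j).mul (hH k l)).sub
    ((((hF k i).mul (hH j l)).sub ((hF k j).mul (hH i l))).div_const 2)).add
    ((((hF l i).mul (hH j k)).sub ((hF l j).mul (hH i k))).div_const 2)

theorem contDiffAt_T4 (hy : y ∈ U) (i j k l : Fin n) :
    ContDiffAt ℝ ∞ (fun z => D.T4 z i j k l) y := by
  have hR := h.contDiffAt_curvLow hy
  unfold T4 proj2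
  exact contDiffAt_const.mul ((((hR i j k l).sub (hR i j l k)).div_const 2).add
    (((hR k l i j).sub (hR k l j i)).div_const 2))

theorem contDiffAt_U4 (hy : y ∈ U) (i j k l : Fin n) :
    ContDiffAt ℝ ∞ (fun z => D.U4 z i j k l) y := by
  have hB := fun i j k l => (h.contDiffAt_curvLow hy i j k l).sub (h.contDiffAt_faradayCurv hy i j k l)
  unfold U4 proj1 sym3
  exact contDiffAt_const.mul
    ((((((((hB i j k l).add (hB i j l k)).add (hB i k j l)).add (hB i k l j)).add
      (hB i l j k)).add (hB i l k j)).div_const 6).sub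
    (((((((hB j i k l).add (hB j i l k)).add (hB j k i l)).add (hB j k l i)).add
      (hB j l i k)).add (hB j l k i)).div_const 6))

theorem contDiffAt_E2 (hy : y ∈ U) (i j : Fin n) : ContDiffAt ℝ ∞ (fun z => D.E2 z i j) y :=
  contDiffAt_const.mul (h.contDiffAt_contr hy fun p q => h.contDiffAt_U4 hy p i j q)

theorem contDiffAt_scal (hy : y ∈ U) : ContDiffAt ℝ ∞ (fun z => D.scal z) y :=
  h.contDiffAt_contr hy fun i j => ContDiffAt.sum fun p _ => h.contDiffAt_curv hy p i j p

theorem contDiffAt_A2 (hy : y ∈ U) (i j : Fin n) : ContDiffAt ℝ ∞ (fun z => D.A2 z i j) y := by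
  have hT : ContDiffAt ℝ ∞ (fun z => D.T2 z i j) y :=
    h.contDiffAt_contr hy fun p q => h.contDiffAt_T4 hy p i j q
  have hs := h.contDiffAt_scal hy
  have hH := h.smooth_H y hy i j
  unfold A2
  exact (contDiffAt_const.mul (hT.sub ((hs.div_const _).mul hH))).sub ((hs.div_const _).mul hH)

theorem contDiffAt_W2 (hy : y ∈ U) (i j : Fin n) : ContDiffAt ℝ ∞ (fun z => D.W2 z i j) y :=
  ((h.contDiffAt_A2 hy i j).add (h.contDiffAt_E2 hy i j)).add
    (contDiffAt_const.mul (h.contDiffAt_faradayForm hy i j))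

theorem contDiffAt_nablaForm (hy : y ∈ U) (hα : ∀ i, ContDiffAt ℝ ∞ (fun z => α z i) y)
    (i j : Fin n) : ContDiffAt ℝ ∞ (fun z => D.nablaForm α z i j) y :=
  (contDiffAt_pd i (hα j)).sub (ContDiffAt.sum fun p _ => (h.smooth_Γ y hy i j p).mul (hα p))

theorem contDiffAt_normSq (hy : y ∈ U) (hα : ∀ i, ContDiffAt ℝ ∞ (fun z => α z i) y) :
    ContDiffAt ℝ ∞ (fun z => D.normSq α z) y :=
  ContDiffAt.sum fun p _ => (h.contDiffAt_raise hy hα p).mul (hα p)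

theorem contDiffAt_cubicForm (hy : y ∈ U) (hα : ∀ i, ContDiffAt ℝ ∞ (fun z => α z i) y)
    (i j : Fin n) : ContDiffAt ℝ ∞ (fun z => D.cubicForm α z i j) y :=
  ContDiffAt.sum fun p _ => (h.smooth_cubic y hy i j p).mul (hα p)

theorem contDiffAt_schoutenChange (hy : y ∈ U) (hα : ∀ i, ContDiffAt ℝ ∞ (fun z => α z i) y)
    (i j : Fin n) : ContDiffAt ℝ ∞ (fun z => D.schoutenChange α z i j) y :=
  ((h.contDiffAt_nablaForm hy hα i j).sub ((hα i).mul (hα j))).add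
    ((contDiffAt_const.mul (h.contDiffAt_normSq hy hα)).mul (h.smooth_H y hy i j))

end IsAHOn

end LocalData
end AHGeometry

/-! ### Derivatives of the change of the Schouten tensor. -/

namespace AHGeometry
namespace LocalData

variable {n : ℕ} {D D' : LocalData n} {y : Model n} {U : Set (Model n)}
  {θ θ' α : Model n → Fin n → ℝ}

theorem nabla_congr {X Y : Model n → Fin n → Fin n → ℝ} (h : ∀ᶠ z in nhds y, X z = Y z)
    (i j k : Fin n) : D.nabla X y i j k = D.nabla Y y i j k := by
  have e : pd i (fun z => X z j k) y = pd i (fun z => Y z j k) y :=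
    pd_congr i (h.mono fun z hz => by simp only [hz])
  simp only [nabla, e, h.self_of_nhds]

theorem nabla_add {X Y : Model n → Fin n → Fin n → ℝ}
    (hX : ∀ i j, ContDiffAt ℝ ∞ (fun z => X z i j) y)
    (hY : ∀ i j, ContDiffAt ℝ ∞ (fun z => Y z i j) y) (i j k : Fin n) :
    D.nabla (fun z a b => X z a b + Y z a b) y i j k = D.nabla X y i j k + D.nabla Y y i j k := by
  simp only [nabla, pd_add i (hX j k) (hY j k), mul_add, Finset.sum_add_distrib]
  ring

theorem nabla_smul {s : Model n → ℝ} {X : Model n → Fin n → Fin n → ℝ}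
    (hs : ContDiffAt ℝ ∞ s y) (hX : ∀ i j, ContDiffAt ℝ ∞ (fun z => X z i j) y) (i j k : Fin n) :
    D.nabla (fun z a b => s z * X z a b) y i j k =
      pd i s y * X y j k + s y * D.nabla X y i j k := by
  simp only [nabla, pd_mul i hs (hX j k), mul_left_comm _ (s y), ← Finset.mul_sum]
  ring

theorem nabla_const_mul (c : ℝ) {X : Model n → Fin n → Fin n → ℝ}
    (hX : ∀ i j, ContDiffAt ℝ ∞ (fun z => X z i j) y) (i j k : Fin n) :
    D.nabla (fun z a b => c * X z a b) y i j k = c * D.nabla X y i j k := by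
  rw [nabla_smul contDiffAt_const hX, pd_const]; ring

theorem nabla_mul {β : Model n → Fin n → ℝ} (hα : ∀ i, ContDiffAt ℝ ∞ (fun z => α z i) y)
    (hβ : ∀ i, ContDiffAt ℝ ∞ (fun z => β z i) y) (i j k : Fin n) :
    D.nabla (fun z a b => α z a * β z b) y i j k =
      D.nablaForm α y i j * β y k + α y j * D.nablaForm β y i k := by
  simp only [nabla, nablaForm, pd_mul i (hα j) (hβ k), sub_mul, mul_sub, Finset.sum_mul,
    Finset.mul_sum, mul_assoc, mul_left_comm (α y j)]
  ring

theorem nabla_cubicForm (hL : ∀ i j k, ContDiffAt ℝ ∞ (fun z => D.cubicTorsion z i j k) y)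
    (hα : ∀ i, ContDiffAt ℝ ∞ (fun z => α z i) y) (i j k : Fin n) :
    D.nabla (D.cubicForm α) y i j k =
      ∑ p, D.nablaMixed D.cubicTorsion y i j k p * α y p
        + ∑ p, D.cubicTorsion y j k p * D.nablaForm α y i p := by
  have e1 : pd i (fun z => D.cubicForm α z j k) y =
      ∑ p, pd i (fun z => D.cubicTorsion z j k p) y * α y p
        + ∑ p, D.cubicTorsion y j k p * pd i (fun z => α z p) y := by
    unfold cubicForm
    rw [pd_sum _ _ fun p _ => (hL j k p).mul (hα p), ← Finset.sum_add_distrib]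
    exact Finset.sum_congr rfl fun p _ => pd_mul i (hL j k p) (hα p)
  have e4 : ∀ (c : Fin n → ℝ) (X : Fin n → Fin n → ℝ),
      ∑ m, (∑ p, c p * X p m) * α y m = ∑ p, c p * ∑ m, X p m * α y m := by
    intro c X
    simp only [Finset.sum_mul, Finset.mul_sum]
    rw [Finset.sum_comm]
    exact Finset.sum_congr rfl fun p _ => Finset.sum_congr rfl fun q _ => by ring
  have e2 : ∑ m, (∑ p, D.Γ y i p m * D.cubicTorsion y j k p) * α y m =
      ∑ m, D.cubicTorsion y j k m * ∑ p, D.Γ y i m p * α y p := by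
    simp only [Finset.sum_mul, Finset.mul_sum]
    rw [Finset.sum_comm]
    exact Finset.sum_congr rfl fun p _ => Finset.sum_congr rfl fun q _ => by ring
  simp only [nabla, nablaMixed, nablaForm, e1, add_mul, sub_mul, mul_sub, Finset.sum_add_distrib,
    Finset.sum_sub_distrib, e2, e4]
  simp only [cubicForm]
  ring

theorem IsAHOn.pd_normSq (h : D.IsAHOn U θ) (hy : y ∈ U)
    (hα : ∀ i, ContDiffAt ℝ ∞ (fun z => α z i) y) (i : Fin n) :
    pd i (D.normSq α) y = 2 * ∑ p, D.raise y (α y) p * D.nablaForm α y i p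
      - θ y i * D.normSq α y - ∑ p, D.raise y (α y) p * D.cubicForm α y i p := by
  have hm := h.metric y hy
  have hA := h.contDiffAt_raise hy hα
  have hH := h.smooth_H y hy
  have e1 : pd i (D.normSq α) y = ∑ p, pd i (fun z => D.raise z (α z) p) y * α y p
      + ∑ p, D.raise y (α y) p * pd i (fun z => α z p) y := by
    unfold normSq
    rw [pd_sum _ _ fun p _ => (hA p).mul (hα p), ← Finset.sum_add_distrib]
    exact Finset.sum_congr rfl fun p _ => pd_mul i (hA p) (hα p)
  -- Differentiating α_p = α^q H_qp instead of α^p = H^pq α_q avoids derivatives of the inverse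
  -- metric.
  have e2 : ∀ p, pd i (fun z => α z p) y =
      ∑ q, pd i (fun z => D.raise z (α z) q) y * D.H y q p
        + ∑ q, D.raise y (α y) q * pd i (fun z => D.H z q p) y := by
    intro p
    rw [← Finset.sum_add_distrib, ← Finset.sum_congr rfl fun q _ => pd_mul i (hA q) (hH q p),
      ← pd_sum _ _ fun q _ => (hA q).mul (hH q p)]
    apply pd_congr
    filter_upwards [h.isOpen.mem_nhds hy] with z hz
    exact (sum_mul_H_eq (h.metric z hz) p).symm
  have e3 : ∑ p, D.raise y (α y) p * pd i (fun z => α z p) y =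
      ∑ p, pd i (fun z => D.raise z (α z) p) y * α y p
        + ∑ p, D.raise y (α y) p * ∑ q, D.raise y (α y) q * pd i (fun z => D.H z q p) y := by
    simp only [e2, mul_add, Finset.sum_add_distrib]
    congr 1
    simp only [← fun p => sum_mul_H_eq (α := α) hm p, Finset.mul_sum]
    rw [Finset.sum_comm]
    exact Finset.sum_congr rfl fun p _ => Finset.sum_congr rfl fun q _ => by rw [hm.symm]; ring
  have e4 : ∀ p q, pd i (fun z => D.H z q p) y = θ y i * D.H y q p + D.cubicLow y i q p
      + ∑ r, D.Γ y i q r * D.H y r p + ∑ r, D.Γ y i p r * D.H y q r := by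
    intro p q
    have := h.nabla_H y hy i q p
    rw [nabla] at this
    linarith
  have e5 : ∀ p, ∑ q, D.raise y (α y) q * pd i (fun z => D.H z q p) y =
      θ y i * α y p + D.cubicForm α y i p
      + ∑ q, D.raise y (α y) q * ∑ r, D.Γ y i q r * D.H y r p + ∑ r, D.Γ y i p r * α y r := by
    intro p
    simp only [e4, mul_add, Finset.sum_add_distrib, mul_left_comm _ (θ y i), ← Finset.mul_sum,
      sum_mul_H_eq hm, h.sum_raise_mul_cubicLow hy]
    congr 1
    simp only [← fun p => sum_mul_H_eq (α := α) hm p, Finset.mul_sum]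
    rw [Finset.sum_comm]
    exact Finset.sum_congr rfl fun p _ => Finset.sum_congr rfl fun q _ => by ring
  have e6 : ∑ p, D.raise y (α y) p * ∑ q, D.raise y (α y) q * ∑ r, D.Γ y i q r * D.H y r p =
      ∑ p, D.raise y (α y) p * ∑ r, D.Γ y i p r * α y r := by
    simp only [← fun p => sum_mul_H_eq (α := α) hm p, Finset.mul_sum]
    rw [Finset.sum_comm]
    refine Finset.sum_congr rfl fun p _ => ?_
    rw [Finset.sum_comm]
    exact Finset.sum_congr rfl fun q _ => Finset.sum_congr rfl fun r _ => by rw [hm.symm q r]; ring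
  have e7 : ∑ p, D.raise y (α y) p * ∑ q, D.raise y (α y) q * pd i (fun z => D.H z q p) y =
      θ y i * D.normSq α y + ∑ p, D.raise y (α y) p * D.cubicForm α y i p
        + 2 * ∑ p, D.raise y (α y) p * ∑ r, D.Γ y i p r * α y r := by
    simp only [e5, mul_add, Finset.sum_add_distrib, e6, mul_left_comm _ (θ y i), ← Finset.mul_sum]
    rw [normSq]; ring
  rw [e7] at e3
  rw [e1]
  simp only [nablaForm, mul_sub, Finset.sum_sub_distrib]
  linarith

/-- The Weyl change is symmetric in its lower indices, so its action on the slot skewed with the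
derivative cancels; only its action on the last slot remains. -/
theorem skewNabla_change (hsymm : ∀ i j k, D.Γ y i j k = D.Γ y j i k)
    (hH : ∀ i j, D.H y i j = D.H y j i)
    (hΓ : ∀ i j k, D'.Γ y i j k = D.Γ y i j k + D.weylChange α y i j k)
    (X : Model n → Fin n → Fin n → ℝ) (i j k : Fin n) :
    D'.skewNabla X y i j k = D.skewNabla X y i j k
      - (α y i * X y j k + α y k * X y j i - D.H y i k * ∑ p, D.raise y (α y) p * X y j p)
      + (α y j * X y i k + α y k * X y i j - D.H y j k * ∑ p, D.raise y (α y) p * X y i p) := by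
  have hs : ∀ m, D.weylChange α y j i m = D.weylChange α y i j m := fun m => by
    simp only [weylChange, hH j i]; ring
  simp only [skewNabla, nabla, hΓ, add_mul, Finset.sum_add_distrib, hsymm j i, hs,
    sum_weylChange_mul (D := D) (α := α) (y := y) (fun p => X y j p),
    sum_weylChange_mul (D := D) (α := α) (y := y) (fun p => X y i p)]
  ring

theorem sum_curv_mul_form (hm : IsMetricPair (D.H y) (D.Hinv y)) (i j k : Fin n) :
    ∑ p, D.curv y i j k p * α y p = ∑ p, D.raise y (α y) p * D.curvLow y i j k p := by
  simp only [curvLow, ← fun p => sum_mul_H_eq (α := α) hm p, Finset.mul_sum]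
  rw [Finset.sum_comm]
  exact Finset.sum_congr rfl fun p _ => Finset.sum_congr rfl fun q _ => by rw [hm.symm]; ring

/-- The Ricci identity handles ∇∇α and the Leibniz rule the rest. The derivatives of |α|² and of H
carry θ with opposite signs, and 𝓛_ijk drops out on skewing. -/
theorem IsAHOn.skewNabla_schoutenChange (h : D.IsAHOn U θ) (hy : y ∈ U)
    (hα : ∀ z ∈ U, ∀ i, ContDiffAt ℝ ∞ (fun z => α z i) z) (i j k : Fin n) :
    D.skewNabla (D.schoutenChange α) y i j k =
      -∑ p, D.raise y (α y) p * D.curvLow y i j k p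
      - (D.nablaForm α y i j - D.nablaForm α y j i) * α y k
      - α y j * D.nablaForm α y i k + α y i * D.nablaForm α y j k
      + (∑ p, D.raise y (α y) p * D.nablaForm α y i p
        - 1 / 2 * ∑ p, D.raise y (α y) p * D.cubicForm α y i p) * D.H y j k
      - (∑ p, D.raise y (α y) p * D.nablaForm α y j p
        - 1 / 2 * ∑ p, D.raise y (α y) p * D.cubicForm α y j p) * D.H y i k := by
  have hα' := hα y hy
  have hN := h.contDiffAt_normSq hy hα'
  have e1 : ∀ i j k, D.nabla (D.schoutenChange α) y i j k = D.nabla (D.nablaForm α) y i j k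
      - (D.nablaForm α y i j * α y k + α y j * D.nablaForm α y i k)
      + (1 / 2 * pd i (D.normSq α) y * D.H y j k
        + 1 / 2 * D.normSq α y * D.nabla D.H y i j k) := by
    intro i j k
    have e : D.schoutenChange α = fun z a b => (D.nablaForm α z a b + -1 * (α z a * α z b))
        + 1 / 2 * D.normSq α z * D.H z a b := by
      funext z a b; rw [schoutenChange]; ring
    have s1 := h.contDiffAt_nablaForm hy hα'
    have s2 : ∀ a b, ContDiffAt ℝ ∞ (fun z => α z a * α z b) y := fun a b => (hα' a).mul (hα' b)
    have s3 : ∀ a b, ContDiffAt ℝ ∞ (fun z => -1 * (α z a * α z b)) y :=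
      fun a b => contDiffAt_const.mul (s2 a b)
    have s4 : ContDiffAt ℝ ∞ (fun z => 1 / 2 * D.normSq α z) y := contDiffAt_const.mul hN
    rw [e, nabla_add (fun a b => (s1 a b).add (s3 a b)) (fun a b => s4.mul (h.smooth_H y hy a b)),
      nabla_add s1 s3, nabla_const_mul (-1) s2, nabla_mul hα' hα', nabla_smul s4 (h.smooth_H y hy),
      pd_const_mul i _ hN]
    change _ + _ + (1 / 2 * pd i (D.normSq α) y * _ + _) = _
    ring
  have e2 := skewNabla_nablaForm (h.smooth_Γ y hy) (h.symm_Γ y hy) hα' i j k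
  rw [sum_curv_mul_form (h.metric y hy)] at e2
  rw [skewNabla] at e2 ⊢
  simp only [e1, h.nabla_H y hy, h.pd_normSq hy hα']
  rw [h.cubicLow_swap hy j i]
  linear_combination e2

end LocalData
end AHGeometry

/-! ### Contractions with α and the transformation of w_ijk. -/

namespace AHGeometry
namespace LocalData

variable {n : ℕ} {D D' : LocalData n} {y : Model n} {U : Set (Model n)}
  {θ θ' α : Model n → Fin n → ℝ}

/-- The contraction `α^p X_p`. -/
def pair (D : LocalData n) (α : Model n → Fin n → ℝ) (y : Model n) (X : Fin n → ℝ) : ℝ :=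
  ∑ p, D.raise y (α y) p * X p

theorem pair_add (X Y : Fin n → ℝ) :
    D.pair α y (fun p => X p + Y p) = D.pair α y X + D.pair α y Y := by
  simp only [pair, mul_add, Finset.sum_add_distrib]

theorem pair_sub (X Y : Fin n → ℝ) :
    D.pair α y (fun p => X p - Y p) = D.pair α y X - D.pair α y Y := by
  simp only [pair, mul_sub, Finset.sum_sub_distrib]

theorem pair_neg (X : Fin n → ℝ) : D.pair α y (fun p => -X p) = -D.pair α y X := by
  simp only [pair, mul_neg, Finset.sum_neg_distrib]

theorem pair_const_mul (c : ℝ) (X : Fin n → ℝ) :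
    D.pair α y (fun p => c * X p) = c * D.pair α y X := by
  simp only [pair, mul_left_comm _ c, Finset.mul_sum]

theorem pair_mul_const (c : ℝ) (X : Fin n → ℝ) :
    D.pair α y (fun p => X p * c) = D.pair α y X * c := by
  simp only [mul_comm _ c, pair_const_mul]

theorem pair_div_const (c : ℝ) (X : Fin n → ℝ) :
    D.pair α y (fun p => X p / c) = D.pair α y X / c := by
  simp only [div_eq_mul_inv, pair_mul_const]

theorem pair_H (hm : IsMetricPair (D.H y) (D.Hinv y)) (i : Fin n) :
    D.pair α y (fun p => D.H y i p) = α y i := by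
  rw [← sum_mul_H_eq (α := α) hm i, pair]
  exact Finset.sum_congr rfl fun p _ => by rw [hm.symm]

theorem pair_skewProd (hm : IsMetricPair (D.H y) (D.Hinv y)) {Q : Fin n → Fin n → ℝ}
    (i j k : Fin n) :
    D.pair α y (fun p => skewProd (D.H y) Q i j k p) = Q i k * α y j - Q j k * α y i
      - D.H y j k * D.pair α y (Q i) + D.H y i k * D.pair α y (Q j) := by
  simp only [skewProd, pair_add, pair_sub, pair_const_mul, pair_H hm]

theorem pair_symmProd (hm : IsMetricPair (D.H y) (D.Hinv y)) {Q : Fin n → Fin n → ℝ}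
    (i j k : Fin n) :
    D.pair α y (fun p => symmProd (D.H y) Q i j k p) = D.H y j k * D.pair α y (Q i)
      - D.H y i k * D.pair α y (Q j) + α y j * Q i k - α y i * Q j k := by
  simp only [symmProd, pair_add, pair_sub, pair_const_mul, pair_mul_const, pair_H hm]

theorem pair_formProd (hm : IsMetricPair (D.H y) (D.Hinv y)) {F : Fin n → Fin n → ℝ}
    (hF : ∀ i j, F i j = -F j i) (i j k : Fin n) :
    D.pair α y (fun p => formProd (D.H y) F i j k p) = F i j * α y k
      - (F k i * α y j - F k j * α y i) / 2
      - (D.pair α y (F i) * D.H y j k - D.pair α y (F j) * D.H y i k) / 2 := by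
  have e : ∀ i, D.pair α y (fun p => F p i) = -D.pair α y (F i) := fun i => by
    rw [← pair_neg]; congr 1; funext p; exact hF p i
  simp only [formProd, pair_add, pair_sub, pair_const_mul, pair_mul_const, pair_div_const,
    pair_H hm, e]
  ring

theorem CurvatureIdentities.pair_curvLow (hc : D.CurvatureIdentities y) (i j k : Fin n) :
    D.pair α y (fun p => D.curvLow y i j k p) = D.pair α y (fun p => D.W4 y i j k p)
      + (D.A2 y i k * α y j - D.A2 y j k * α y i
        - D.H y j k * D.pair α y (D.A2 y i) + D.H y i k * D.pair α y (D.A2 y j))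
      + (D.H y j k * D.pair α y (D.E2 y i)
        - D.H y i k * D.pair α y (D.E2 y j) + α y j * D.E2 y i k - α y i * D.E2 y j k)
      + (D.faradayForm y i j * α y k
        - (D.faradayForm y k i * α y j - D.faradayForm y k j * α y i) / 2
        - (D.pair α y (D.faradayForm y i) * D.H y j k
          - D.pair α y (D.faradayForm y j) * D.H y i k) / 2) := by
  rw [← pair_skewProd hc.metric, ← pair_symmProd hc.metric,
    ← pair_formProd hc.metric (D.faradayForm_antisymm y), ← pair_add, ← pair_add, ← pair_add]
  congr 1; funext p
  rw [hc.curvLow_eq, T4_eq hc.metric, U4_eq hc.metric, W4]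
  ring

/-- A tensor `X_{ijk}` modified by a tensor without trace and by a pure trace. -/
theorem traceFree3_change (hn : 2 ≤ n) (hm : IsMetricPair (D.H y) (D.Hinv y))
    (hH : D'.H y = D.H y) (hK : D'.Hinv y = D.Hinv y)
    {X X' : Model n → Fin n → Fin n → Fin n → ℝ} {V : Fin n → Fin n → Fin n → ℝ} {x : Fin n → ℝ}
    (hV : ∀ i, contr (D.Hinv y) (V i) = 0)
    (h : ∀ i j k, X' y i j k = X y i j k - V i j k - x i * D.H y j k + x j * D.H y i k)
    (i j k : Fin n) : D'.traceFree3 X' y i j k = D.traceFree3 X y i j k - V i j k := by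
  have h2 : (2 : ℝ) ≤ n := by exact_mod_cast hn
  have hn1 : (n : ℝ) - 1 ≠ 0 := by linarith
  have e : ∀ i, D'.trace3 X' y i = D.trace3 X y i - ((n : ℝ) - 1) * x i := by
    intro i
    have e1 : D'.trace3 X' y i = contr (D'.Hinv y) (fun p q => X' y i p q) := rfl
    have e2 : D.trace3 X y i = contr (D.Hinv y) (fun p q => X y i p q) := rfl
    have e3 : contr (D.Hinv y) (fun p q => V i p q) = 0 := hV i
    rw [e1, e2, hK]
    simp only [h, contr_add, contr_sub, contr_const_mul, e3, hm.contr_metric, hm.contr_left']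
    ring
  simp only [traceFree3, e, h, hH]
  field_simp
  ring

theorem contr_pair (X : Fin n → Fin n → Fin n → ℝ)
    (hX : ∀ p, contr (D.Hinv y) (fun i j => X i j p) = 0) :
    contr (D.Hinv y) (fun i j => D.pair α y (X i j)) = 0 := by
  simp only [pair, contr_sum, contr_const_mul, hX, mul_zero, Finset.sum_const_zero]

theorem contr_A4_middle (hn : 2 < n) (hm : IsMetricPair (D.H y) (D.Hinv y)) (i l : Fin n) :
    contr (D.Hinv y) (fun p q => D.A4 y i p q l) = 0 := by
  obtain ⟨h1, h2, -⟩ := A4_symm hm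
  rw [← contr_A4 hn hm i l]
  congr 1; funext p q
  rw [h1, h2, neg_neg]

theorem contr_E4_middle (hn : 2 ≤ n) (hm : IsMetricPair (D.H y) (D.Hinv y)) (i l : Fin n) :
    contr (D.Hinv y) (fun p q => D.E4 y i p q l) = 0 := by
  rw [← neg_eq_zero, ← contr_neg, ← contr_E4 hn hm i l]
  congr 1; funext p q
  rw [D.E4_antisymm, D.E4_symm, neg_neg]

theorem IsAHOn.w3_eq (h : D.IsAHOn U θ) (hy : y ∈ U) (i j k : Fin n) :
    D.w3 y i j k = D.a3 y i j k + D.e3 y i j k := by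
  have e : ∀ i j k, D.nabla D.W2 y i j k = D.nabla D.A2 y i j k + D.nabla D.E2 y i j k
      + 1 / 2 * D.nabla D.faradayForm y i j k := by
    intro i j k
    have sF := h.contDiffAt_faradayForm hy
    have sA := h.contDiffAt_A2 hy
    have sE := h.contDiffAt_E2 hy
    rw [← nabla_const_mul _ sF, ← nabla_add sA sE,
      ← nabla_add (fun a b => (sA a b).add (sE a b)) fun a b => contDiffAt_const.mul (sF a b)]
    rfl
  simp only [w3, a3, e3, skewNabla, e]
  ring

namespace IsAHPairOn

variable (h : IsAHPairOn D D' U θ θ' α)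
include h

/-- The symmetric part of `schoutenChange` minus C comes from A, C from E, and the skew part from
½F, so the sum is the whole tensor. -/
theorem W2_eq (hn : 2 < n) (hy : y ∈ U) (i j : Fin n) :
    D'.W2 y i j = D.W2 y i j + D.schoutenChange α y i j := by
  rw [(h.curvatureChange hn.le hy).W2_eq hn, schoutenChange, schoutenChange,
    (h.left.metric y hy).symm j i]
  ring

/-- The terms -α^p R_ijkp from the Ricci identity meet those from the change of connection acting on
`W2`. In the coefficient of H_jk the contributions of A and F cancel, but E enters the curvature
with the opposite sign to A, so its contributions add up; hence the factor 2 in the trace part. -/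
theorem w3_change (hn : 2 < n) (hy : y ∈ U) (i j k : Fin n) :
    D'.w3 y i j k = D.w3 y i j k - D.pair α y (fun p => D.W4 y i j k p)
      - (1 / 2 * D.pair α y (D.cubicForm α y i) + 2 * D.pair α y (D.E2 y i)) * D.H y j k
      + (1 / 2 * D.pair α y (D.cubicForm α y j) + 2 * D.pair α y (D.E2 y j)) * D.H y i k := by
  have hm := h.left.metric y hy
  have hc := h.left.curvatureIdentities hn.le hy
  have e0 : D'.skewNabla D'.W2 y i j k =
      D'.skewNabla (fun z a b => D.W2 z a b + D.schoutenChange α z a b) y i j k := by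
    have : ∀ᶠ z in nhds y, D'.W2 z = fun a b => D.W2 z a b + D.schoutenChange α z a b := by
      filter_upwards [h.left.isOpen.mem_nhds hy] with z hz
      funext a b; exact h.W2_eq hn hz a b
    simp only [skewNabla, nabla_congr this]
  have e1 := h.left.skewNabla_schoutenChange hy h.smooth i j k
  rw [show ∑ p, D.raise y (α y) p * D.curvLow y i j k p =
    D.pair α y (fun p => D.curvLow y i j k p) from rfl, hc.pair_curvLow] at e1
  have e2 : D.skewNabla (fun z a b => D.W2 z a b + D.schoutenChange α z a b) y i j k =
      D.skewNabla D.W2 y i j k + D.skewNabla (D.schoutenChange α) y i j k := by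
    have s1 := h.left.contDiffAt_W2 hy
    have s2 := h.left.contDiffAt_schoutenChange hy (h.smooth y hy)
    have : ∀ i j k, D.nabla (fun z a b => D.W2 z a b + D.schoutenChange α z a b) y i j k =
      D.nabla D.W2 y i j k + D.nabla (D.schoutenChange α) y i j k := nabla_add s1 s2
    simp only [skewNabla, this]; ring
  have e3 : ∀ i, ∑ p, D.raise y (α y) p * (D.W2 y i p + D.schoutenChange α y i p) =
      D.pair α y (D.A2 y i) + D.pair α y (D.E2 y i) + 1 / 2 * D.pair α y (D.faradayForm y i)
      + D.pair α y (D.nablaForm α y i) - 1 / 2 * D.normSq α y * α y i := by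
    intro i
    have e4 : D.pair α y (fun p => α y p) = D.normSq α y := rfl
    change D.pair α y (fun p => D.W2 y i p + D.schoutenChange α y i p) = _
    simp only [W2, schoutenChange, pair_add, pair_sub, pair_const_mul, pair_H hm, e4]
    ring
  rw [w3, w3, e0, skewNabla_change (h.left.symm_Γ y hy) hm.symm (h.Γ_eq y hy), e2, e1, e3, e3]
  have e6 : ∀ i, ∑ p, D.raise y (α y) p * D.nablaForm α y i p = D.pair α y (D.nablaForm α y i) :=
    fun _ => rfl
  have e7 : ∀ i, ∑ p, D.raise y (α y) p * D.cubicForm α y i p = D.pair α y (D.cubicForm α y i) :=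
    fun _ => rfl
  simp only [e6, e7, W2, schoutenChange]
  rw [A2_symm hm j i, E2_symm hn.le hc j i, D.faradayForm_antisymm y j i,
    D.faradayForm_antisymm y k i, D.faradayForm_antisymm y k j, hm.symm j i]
  ring

end IsAHPairOn

end LocalData
end AHGeometry

/-! ### Transformation of e_ijk and a_ijk, and of their trace-free parts. -/

namespace AHGeometry
namespace LocalData

variable {n : ℕ} {D D' : LocalData n} {y : Model n} {U : Set (Model n)}
  {θ θ' α : Model n → Fin n → ℝ}

/-- The symmetric part of the curvature has two expressions, through derivatives of 𝓛 and through U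
and F. They are compared after contraction with α; the F terms cancel because dθ = -2F. -/
theorem IsAHOn.sum_skew_nablaMixed (h : D.IsAHOn U θ) (hn : 2 ≤ n) (hy : y ∈ U) (i j k : Fin n) :
    ∑ m, (D.nablaMixed D.cubicTorsion y i j k m - D.nablaMixed D.cubicTorsion y j i k m) * α y m =
      -2 * D.pair α y (fun p => D.U4 y i j k p)
      - ∑ m, (D.cubicTorsion y j k m * D.cubicForm α y i m
          - D.cubicTorsion y i k m * D.cubicForm α y j m) := by
  have hm := h.metric y hy
  have hc := h.curvatureIdentities hn hy
  have e1 : D.pair α y (fun l => D.curvLow y i j k l + D.curvLow y i j l k) =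
      2 * D.pair α y (fun p => D.U4 y i j k p) + 2 * (D.faradayForm y i j * α y k) := by
    simp only [hc.curvLow_add_swap, pair_add, pair_const_mul, pair_H hm]
  simp only [h.curvLow_add_swap hy] at e1
  rw [pair_neg, pair_add, pair_add, pair_const_mul, pair_H hm, h.nablaForm_sub hn hy] at e1
  have e2 : ∀ X : Fin n → ℝ, D.pair α y (fun l => ∑ m, X m * D.H y m l) = ∑ m, X m * α y m := by
    intro X
    simp only [pair, ← fun p => sum_mul_H_eq (α := α) hm p, Finset.mul_sum]
    rw [Finset.sum_comm]
    exact Finset.sum_congr rfl fun p _ => Finset.sum_congr rfl fun q _ => by rw [hm.symm]; ring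
  have e3 : D.pair α y (fun l => ∑ m, (D.cubicTorsion y j k m * D.cubicLow y i m l
      - D.cubicTorsion y i k m * D.cubicLow y j m l)) =
      ∑ m, (D.cubicTorsion y j k m * D.cubicForm α y i m
          - D.cubicTorsion y i k m * D.cubicForm α y j m) := by
    simp only [← h.sum_raise_mul_cubicLow hy, pair, Finset.mul_sum, ← Finset.sum_sub_distrib]
    rw [Finset.sum_comm]
    refine Finset.sum_congr rfl fun p _ => Finset.sum_congr rfl fun q _ => ?_
    rw [h.cubicLow_symm y hy i q p, h.cubicLow_symm y hy j q p]; ring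
  rw [e2, e3] at e1
  linarith

theorem IsAHOn.skewNabla_cubicForm (h : D.IsAHOn U θ) (hn : 2 ≤ n) (hy : y ∈ U)
    (hα : ∀ i, ContDiffAt ℝ ∞ (fun z => α z i) y) (i j k : Fin n) :
    D.skewNabla (D.cubicForm α) y i j k = -2 * D.pair α y (fun p => D.U4 y i j k p)
      + 2 * D.cubicSkew (D.cubicForm α) y i j k - 2 * D.cubicSkew (D.nablaForm α) y i j k := by
  have e := h.sum_skew_nablaMixed (α := α) hn hy i j k
  simp only [sub_mul, Finset.sum_sub_distrib] at e
  have s := h.cubic_symm y hy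
  rw [skewNabla, nabla_cubicForm (h.smooth_cubic y hy) hα, nabla_cubicForm (h.smooth_cubic y hy) hα]
  simp only [cubicSkew, s k, Finset.sum_sub_distrib]
  linarith

/-- The |α|² term contributes 𝓛_kij - 𝓛_kji, which is zero. -/
theorem IsAHOn.cubicSkew_schoutenChange (h : D.IsAHOn U θ) (hy : y ∈ U) (i j k : Fin n) :
    D.cubicSkew (D.schoutenChange α) y i j k = D.cubicSkew (D.nablaForm α) y i j k
      - (D.cubicForm α y k i * α y j - D.cubicForm α y k j * α y i) / 2 := by
  have hm := h.metric y hy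
  have e1 : ∀ a b, ∑ p, D.cubicTorsion y k a p * D.schoutenChange α y b p =
      ∑ p, D.cubicTorsion y k a p * D.nablaForm α y b p - α y b * D.cubicForm α y k a
        + 1 / 2 * D.normSq α y * D.cubicLow y k a b := by
    intro a b
    simp only [schoutenChange, mul_add, mul_sub, Finset.sum_add_distrib, Finset.sum_sub_distrib,
      mul_left_comm _ (α y b), mul_left_comm _ (1 / 2 * D.normSq α y), ← Finset.mul_sum,
      hm.symm b]
    rfl
  simp only [cubicSkew, Finset.sum_sub_distrib, e1]
  rw [h.cubicLow_symm y hy k j i]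
  ring

namespace IsAHPairOn

variable (h : IsAHPairOn D D' U θ θ' α)
include h

/-- Half the skew derivative of `cubicForm` supplies -α^p U_ijkp, whose Weyl part is -α^p E_ijkp.
Its terms in 𝓛 ∇α and 𝓛𝓛α are cancelled by the 𝓛-terms in the definition of e, which serve this
purpose. What is left combines with the change of connection to a pure trace. -/
theorem e3_change (hn : 2 < n) (hy : y ∈ U) (i j k : Fin n) :
    D'.e3 y i j k = D.e3 y i j k - D.pair α y (fun p => D.E4 y i j k p)
      - (1 / 2 * D.pair α y (D.cubicForm α y i) + 2 * D.pair α y (D.E2 y i)) * D.H y j k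
      + (1 / 2 * D.pair α y (D.cubicForm α y j) + 2 * D.pair α y (D.E2 y j)) * D.H y i k := by
  have hm := h.left.metric y hy
  have hc := h.left.curvatureIdentities hn.le hy
  have hα := h.smooth y hy
  have hE : ∀ z ∈ U, D'.E2 z = fun a b => D.E2 z a b + 1 / 2 * D.cubicForm α z a b := by
    intro z hz
    funext a b
    exact (h.curvatureChange hn.le hz).E2_eq hn.le a b
  have e0 : D'.skewNabla D'.E2 y i j k =
      D'.skewNabla (fun z a b => D.E2 z a b + 1 / 2 * D.cubicForm α z a b) y i j k := by
    have : ∀ᶠ z in nhds y, D'.E2 z = fun a b => D.E2 z a b + 1 / 2 * D.cubicForm α z a b :=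
      Filter.eventually_of_mem (h.left.isOpen.mem_nhds hy) hE
    simp only [skewNabla, nabla_congr this]
  have e1 : D.skewNabla (fun z a b => D.E2 z a b + 1 / 2 * D.cubicForm α z a b) y i j k =
      D.skewNabla D.E2 y i j k + 1 / 2 * D.skewNabla (D.cubicForm α) y i j k := by
    have s1 := h.left.contDiffAt_E2 hy
    have s2 := h.left.contDiffAt_cubicForm hy hα
    have : ∀ i j k, D.nabla (fun z a b => D.E2 z a b + 1 / 2 * D.cubicForm α z a b) y i j k =
        D.nabla D.E2 y i j k + 1 / 2 * D.nabla (D.cubicForm α) y i j k := fun i j k => by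
      rw [nabla_add s1 fun a b => contDiffAt_const.mul (s2 a b), nabla_const_mul _ s2]
    simp only [skewNabla, this]; ring
  have e2 : ∀ i, ∑ p, D.raise y (α y) p * (D.E2 y i p + 1 / 2 * D.cubicForm α y i p) =
      D.pair α y (D.E2 y i) + 1 / 2 * D.pair α y (D.cubicForm α y i) := by
    intro i
    rw [← pair_const_mul, ← pair_add]
    rfl
  have e3 : D.pair α y (fun p => D.U4 y i j k p) = D.pair α y (fun p => D.E4 y i j k p)
      + (D.H y j k * D.pair α y (D.E2 y i)
        - D.H y i k * D.pair α y (D.E2 y j) + α y j * D.E2 y i k - α y i * D.E2 y j k) := by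
    simp only [U4_eq hm, pair_add, pair_symmProd hm]
  -- The combination A + ½F - E changes by Q + ½ dα - C, that is, by `schoutenChange` minus
  -- `cubicForm`.
  have c1 : D'.cubicSkew D'.A2 y i j k + 1 / 2 * D'.cubicSkew D'.faradayForm y i j k
      - D'.cubicSkew D'.E2 y i j k = D.cubicSkew D.A2 y i j k
      + 1 / 2 * D.cubicSkew D.faradayForm y i j k - D.cubicSkew D.E2 y i j k
      + D.cubicSkew (D.schoutenChange α) y i j k - D.cubicSkew (D.cubicForm α) y i j k := by
    have hc' := h.curvatureChange hn.le hy
    have hA := hc'.A2_eq hn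
    have hF := hc'.form
    have hE := hc'.E2_eq hn.le
    simp only [cubicSkew, h.cubicTorsion_eq hn.le hy, mul_div_assoc', Finset.mul_sum,
      ← Finset.sum_add_distrib, ← Finset.sum_sub_distrib, ← add_div, ← sub_div]
    congr 1
    refine Finset.sum_congr rfl fun p _ => ?_
    rw [hA, hA, hF, hF, hE, hE]
    simp only [schoutenChange, hm.symm p]
    ring
  have e4 : D'.e3 y i j k = D'.skewNabla D'.E2 y i j k + (D'.cubicSkew D'.A2 y i j k
      + 1 / 2 * D'.cubicSkew D'.faradayForm y i j k - D'.cubicSkew D'.E2 y i j k) := by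
    rw [LocalData.e3]; ring
  rw [e4, c1, e0, skewNabla_change (h.left.symm_Γ y hy) hm.symm (h.Γ_eq y hy), e1,
    h.left.skewNabla_cubicForm hn.le hy hα, e3, h.left.cubicSkew_schoutenChange hy, e2, e2,
    LocalData.e3, E2_symm hn.le hc j i, h.left.cubicForm_symm hy j i, h.left.cubicForm_symm hy k i,
    h.left.cubicForm_symm hy k j]
  ring

/-- Since w = a + e and the trace parts in `w3_change` and `e3_change` agree, they cancel. -/
theorem a3_change (hn : 2 < n) (hy : y ∈ U) (i j k : Fin n) :
    D'.a3 y i j k = D.a3 y i j k - D.pair α y (fun p => D.A4 y i j k p) := by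
  have e1 := h.w3_change hn hy i j k
  have e2 := h.e3_change hn hy i j k
  rw [h.left.w3_eq hy, h.right.w3_eq hy] at e1
  simp only [W4, pair_add] at e1
  linarith

theorem W3_change (hn : 2 < n) (hy : y ∈ U) (i j k : Fin n) :
    D'.W3 y i j k = D.W3 y i j k - D.pair α y (fun p => D.W4 y i j k p) := by
  have hm := h.left.metric y hy
  refine traceFree3_change (V := fun i j k => D.pair α y (fun p => D.W4 y i j k p)) hn.le hm
    (h.H_eq y hy) (h.Hinv_eq y hy) (fun i => ?_) (h.w3_change hn hy) i j k
  refine contr_pair (fun j k p => D.W4 y i j k p) fun p => ?_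
  simp only [W4, contr_add, contr_A4_middle hn hm, contr_E4_middle hn.le hm, add_zero]

theorem E3_change (hn : 2 < n) (hy : y ∈ U) (i j k : Fin n) :
    D'.E3 y i j k = D.E3 y i j k - D.pair α y (fun p => D.E4 y i j k p) := by
  have hm := h.left.metric y hy
  refine traceFree3_change (V := fun i j k => D.pair α y (fun p => D.E4 y i j k p)) hn.le hm
    (h.H_eq y hy) (h.Hinv_eq y hy) (fun i => ?_) (h.e3_change hn hy) i j k
  exact contr_pair (fun j k p => D.E4 y i j k p) fun p => contr_E4_middle hn.le hm i p

theorem contr_pair_A4 (hn : 2 < n) (hy : y ∈ U) (i : Fin n) :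
    contr (D.Hinv y) (fun j k => D.pair α y (fun p => D.A4 y i j k p)) = 0 :=
  contr_pair (fun j k p => D.A4 y i j k p) fun p => contr_A4_middle hn (h.left.metric y hy) i p

theorem A3_change (hn : 2 < n) (hy : y ∈ U) (i j k : Fin n) :
    D'.A3 y i j k = D.A3 y i j k - D.pair α y (fun p => D.A4 y i j k p) := by
  refine traceFree3_change (V := fun i j k => D.pair α y (fun p => D.A4 y i j k p)) (x := 0) hn.le
    (h.left.metric y hy) (h.H_eq y hy) (h.Hinv_eq y hy) (h.contr_pair_A4 hn hy) (fun i j k => ?_)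
    i j k
  rw [h.a3_change hn hy]; simp

theorem A1_eq (hn : 2 < n) (hy : y ∈ U) (i : Fin n) : D'.A1 y i = D.A1 y i := by
  have e1 : D'.A1 y i = contr (D'.Hinv y) (fun p q => D'.a3 y i p q) := rfl
  have e2 : D.A1 y i = contr (D.Hinv y) (fun p q => D.a3 y i p q) := rfl
  rw [e1, e2, h.Hinv_eq y hy]
  simp only [h.a3_change hn hy, contr_sub, h.contr_pair_A4 hn hy, sub_zero]

end IsAHPairOn

end LocalData
end AHGeometry

/-! ### From an aligned connection and a metric to the normalized equations. -/

namespace AHGeometry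

section

variable {n : ℕ} {y : Model n}

theorem contDiffAt_det {m : ℕ} {A : Model n → Matrix (Fin m) (Fin m) ℝ}
    (hA : ∀ i j, ContDiffAt ℝ ∞ (fun z => A z i j) y) :
    ContDiffAt ℝ ∞ (fun z => (A z).det) y := by
  simp only [Matrix.det_apply, Units.smul_def, zsmul_eq_mul]
  exact ContDiffAt.sum fun σ _ => contDiffAt_const.mul (contDiffAt_prod fun i _ => hA _ _)

theorem contDiffAt_inv {m : ℕ} {A : Model n → Matrix (Fin m) (Fin m) ℝ}
    (hA : ∀ i j, ContDiffAt ℝ ∞ (fun z => A z i j) y) (h0 : (A y).det ≠ 0) (i j : Fin m) :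
    ContDiffAt ℝ ∞ (fun z => (A z)⁻¹ i j) y := by
  -- Cramer's rule, which reduces smoothness of the inverse to that of determinants.
  have h1 : ∀ z, (A z)⁻¹ i j = ((A z).det)⁻¹ * ((A z).updateRow j (Pi.single i 1)).det := by
    intro z
    rw [Matrix.inv_def, Matrix.smul_apply, smul_eq_mul, Ring.inverse_eq_inv', Matrix.adjugate_apply]
  simp only [h1]
  refine ((contDiffAt_det hA).inv h0).mul (contDiffAt_det fun a b => ?_)
  by_cases hab : a = j
  · subst hab
    simp only [Matrix.updateRow_self]
    exact contDiffAt_const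
  · simp only [Matrix.updateRow_ne hab]
    exact hA a b

theorem contDiffAt_abs_rpow {f : Model n → ℝ} (hf : ContDiffAt ℝ ∞ f y) (h0 : f y ≠ 0) (p : ℝ) :
    ContDiffAt ℝ ∞ (fun z => |f z| ^ p) y :=
  (hf.abs h0).rpow_const_of_ne (abs_ne_zero.2 h0)

theorem isMetricPair_inv {g : Matrix (Fin n) (Fin n) ℝ} (hs : ∀ i j, g i j = g j i)
    (h0 : g.det ≠ 0) : IsMetricPair (fun i j => g i j) (fun i j => g⁻¹ i j) := by
  refine ⟨hs, fun i j => ?_, fun i j => ?_⟩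
  · have h1 : g.transpose = g := by ext i j; exact hs j i
    have h2 : g⁻¹.transpose = g⁻¹ := by rw [Matrix.transpose_nonsing_inv, h1]
    exact congrFun (congrFun h2 j) i
  · have h1 := Matrix.nonsing_inv_mul g (isUnit_iff_ne_zero.2 h0)
    have h2 := congrFun (congrFun h1 i) j
    rwa [Matrix.mul_apply, Matrix.one_apply] at h2

theorem IsMetricPair.contr_const_mul_metric {H K : Fin n → Fin n → ℝ} (hm : IsMetricPair H K)
    (c : ℝ) : contr K (fun p q => c * H p q) = c * n := by
  rw [← hm.contr_metric]
  exact contr_const_mul _ _ c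

/-- An aligned metric derivative without conformal torsion is the sum of a multiple of the metric
and its completely symmetric trace-free part. -/
theorem eq_add_tfSym (hn : 2 ≤ n) {g : Matrix (Fin n) (Fin n) ℝ}
    (hm : IsMetricPair (fun i j => g i j) (fun i j => g⁻¹ i j))
    {N : Fin n → Fin n → Fin n → ℝ} (hN : ∀ i j k, N i j k = N i k j)
    (ha : ∀ i, tr23 g N i = n * tr12 g N i) (h0 : ∀ i j k, tfHook g N i j k = 0) (i j k : Fin n) :
    N i j k - N j i k = tr12 g N i * g j k - tr12 g N j * g i k ∧
      tfSym g N i j k = N i j k - tr12 g N i * g j k := by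
  have h2 : (2 : ℝ) ≤ n := by exact_mod_cast hn
  have hn1 : (n : ℝ) - 1 ≠ 0 := by linarith
  have hn2 : (n : ℝ) + 2 ≠ 0 := by linarith
  have h13 : ∀ i, tr13 g N i = tr12 g N i := fun i => by
    simp only [tr13, tr12, hN _ i]
  have hs : ∀ i j, g i j = g j i := hm.symm
  -- Under alignment all three traces of N are multiples of `tr12`, so vanishing of `tfHook` says
  -- that the part of N skew in i, j is a pure trace.
  have e1 : ∀ i j k, N i j k - N j i k = tr12 g N i * g j k - tr12 g N j * g i k := by
    intro i j k
    have e := h0 i j k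
    simp only [tfHook, ha, h13, hN i k j, hN j k i, hs k] at e
    field_simp at e
    have e' : ((n : ℝ) - 1) * (N i j k - N j i k - (tr12 g N i * g j k - tr12 g N j * g i k)) = 0 := by
      linarith
    linarith [(mul_eq_zero.1 e').resolve_left hn1]
  refine ⟨e1 i j k, ?_⟩
  have e2 : ∀ i j k, sym3 N i j k = N i j k - 2 / 3 * (tr12 g N i * g j k)
      + 1 / 3 * (tr12 g N j * g i k) + 1 / 3 * (tr12 g N k * g i j) := by
    intro i j k
    rw [sym3]
    linarith [e1 i j k, e1 i k j, hN i j k, hN j i k, hN k i j, hs j k, hs i j, hs i k, e1 j i k,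
      congrArg (fun x => tr12 g N i * x) (hs j k)]
  have e3 : ∀ k, tr12 g (sym3 N) k = (n + 2) / 3 * tr12 g N k := by
    intro k
    have c : tr12 g (sym3 N) k = contr (fun i j => g⁻¹ i j) (fun p q => sym3 N p q k) := rfl
    have c' : tr12 g N k = contr (fun i j => g⁻¹ i j) (fun p q => N p q k) := rfl
    rw [c]
    simp only [e2, contr_add, contr_sub, contr_const_mul]
    rw [hm.contr_left, hm.contr_right, hm.contr_const_mul_metric, ← c']
    ring
  rw [tfSym, e3, e3, e3, e2, hs k i]
  field_simp
  ring

end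

namespace LocalData

variable {n : ℕ} {D D' : LocalData n} {y : Model n} {U : Set (Model n)}

theorem isMetricPair_H (hs : ∀ i j, D.g y i j = D.g y j i) (h0 : (D.g y).det ≠ 0) :
    IsMetricPair (D.H y) (D.Hinv y) := by
  have hm := isMetricPair_inv hs h0
  have hp := abs_pos.2 h0
  have h1 : |(D.g y).det| ^ (1 / (n : ℝ)) * |(D.g y).det| ^ (-(1 / (n : ℝ))) = 1 := by
    rw [← Real.rpow_add hp]; simp
  refine ⟨fun i j => by rw [H, H, hs], fun i j => ?_, fun i j => ?_⟩
  · rw [Hinv, Hinv, hm.symm_inv i j]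
  · rw [← hm.mul_inv i j]
    refine Finset.sum_congr rfl fun p _ => ?_
    rw [Hinv, H]
    linear_combination ((D.g y)⁻¹ i p * D.g y p j) * h1

/-- A torsion-free connection and a metric, in coordinates, such that the connection is aligned
and the conformal torsion vanishes. -/
structure IsAlignedOn (D : LocalData n) (U : Set (Model n)) : Prop where
  isOpen : IsOpen U
  smooth_Γ : ∀ y ∈ U, ∀ i j k, ContDiffAt ℝ ∞ (fun z => D.Γ z i j k) y
  smooth_g : ∀ y ∈ U, ∀ i j, ContDiffAt ℝ ∞ (fun z => D.g z i j) y
  symm_Γ : ∀ y ∈ U, ∀ i j k, D.Γ y i j k = D.Γ y j i k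
  symm_g : ∀ y ∈ U, ∀ i j, D.g y i j = D.g y j i
  det_ne_zero : ∀ y ∈ U, (D.g y).det ≠ 0
  aligned : ∀ y ∈ U, D.AlignedAt y
  codazzi : ∀ y ∈ U, ∀ i j k, D.conformalTorsion y i j k = 0

namespace IsAlignedOn

variable (h : D.IsAlignedOn U)
include h

theorem isMetricPair (hy : y ∈ U) :
    IsMetricPair (fun i j => D.g y i j) (fun i j => (D.g y)⁻¹ i j) :=
  isMetricPair_inv (h.symm_g y hy) (h.det_ne_zero y hy)

theorem nablaMetric_symm (hy : y ∈ U) (i j k : Fin n) :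
    D.nablaMetric y i j k = D.nablaMetric y i k j := by
  have e : pd i (fun z => D.g z j k) y = pd i (fun z => D.g z k j) y :=
    pd_congr i (Filter.eventually_of_mem (h.isOpen.mem_nhds hy) fun z hz => h.symm_g z hz j k)
  have e1 : ∀ j k, ∑ p, D.Γ y i j p * D.g y p k = ∑ p, D.Γ y i j p * D.g y k p := fun j k =>
    Finset.sum_congr rfl fun p _ => by rw [h.symm_g y hy p k]
  simp only [nablaMetric, nabla]
  rw [e, e1, ← e1 k j]
  ring

theorem tfHook_eq_zero (hy : y ∈ U) (i j k : Fin n) :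
    tfHook (D.g y) (D.nablaMetric y) i j k = 0 := by
  have hm := h.isMetricPair hy
  have e := hm.sum_raise_lower (tfHook (D.g y) (D.nablaMetric y) i j) k
  rw [← e]
  refine Finset.sum_eq_zero fun q _ => ?_
  have := h.codazzi y hy i j q
  rw [conformalTorsion] at this
  rw [this, zero_mul]

theorem nablaMetric_eq (hn : 2 ≤ n) (hy : y ∈ U) (i j k : Fin n) :
    D.nablaMetric y i j k - D.nablaMetric y j i k =
        tr12 (D.g y) (D.nablaMetric y) i * D.g y j k
          - tr12 (D.g y) (D.nablaMetric y) j * D.g y i k ∧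
      tfSym (D.g y) (D.nablaMetric y) i j k = D.nablaMetric y i j k
        - tr12 (D.g y) (D.nablaMetric y) i * D.g y j k :=
  eq_add_tfSym hn (h.isMetricPair hy) (h.nablaMetric_symm hy) (h.aligned y hy)
    (h.tfHook_eq_zero hy) i j k

theorem faraday_eq (hn : 2 ≤ n) (hy : y ∈ U) (i : Fin n) :
    D.faraday y i = 1 / 2 * tr12 (D.g y) (D.nablaMetric y) i := by
  have hn0 : (n : ℝ) ≠ 0 := by positivity
  rw [faraday, h.aligned y hy]
  field_simp

theorem contDiffAt_nablaMetric (hy : y ∈ U) (i j k : Fin n) :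
    ContDiffAt ℝ ∞ (fun z => D.nablaMetric z i j k) y :=
  ((contDiffAt_pd i (h.smooth_g y hy j k)).sub
    (ContDiffAt.sum fun p _ => (h.smooth_Γ y hy i j p).mul (h.smooth_g y hy p k))).sub
    (ContDiffAt.sum fun p _ => (h.smooth_Γ y hy i k p).mul (h.smooth_g y hy j p))

theorem contDiffAt_inv_g (hy : y ∈ U) (i j : Fin n) :
    ContDiffAt ℝ ∞ (fun z => (D.g z)⁻¹ i j) y :=
  contDiffAt_inv (h.smooth_g y hy) (h.det_ne_zero y hy) i j

theorem contDiffAt_tr12 (hy : y ∈ U) (i : Fin n) :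
    ContDiffAt ℝ ∞ (fun z => tr12 (D.g z) (D.nablaMetric z) i) y :=
  ContDiffAt.sum fun p _ => ContDiffAt.sum fun q _ =>
    (h.contDiffAt_inv_g hy p q).mul (h.contDiffAt_nablaMetric hy p q i)

theorem contDiffAt_faraday (hn : 2 ≤ n) (hy : y ∈ U) (i : Fin n) :
    ContDiffAt ℝ ∞ (fun z => D.faraday z i) y := by
  refine (contDiffAt_const.mul (h.contDiffAt_tr12 hy i)).congr_of_eventuallyEq
    (f := fun z => 1 / 2 * tr12 (D.g z) (D.nablaMetric z) i) ?_
  filter_upwards [h.isOpen.mem_nhds hy] with z hz using h.faraday_eq hn hz i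

theorem cubicTorsion_eq (hn : 2 ≤ n) (hy : y ∈ U) (i j k : Fin n) : D.cubicTorsion y i j k =
    ∑ p, (D.g y)⁻¹ k p * (D.nablaMetric y i j p
      - tr12 (D.g y) (D.nablaMetric y) i * D.g y j p) := by
  simp only [cubicTorsion, (h.nablaMetric_eq hn hy i j _).2]

theorem contDiffAt_scale (hy : y ∈ U) (p : ℝ) :
    ContDiffAt ℝ ∞ (fun z => |(D.g z).det| ^ p) y :=
  contDiffAt_abs_rpow (contDiffAt_det (h.smooth_g y hy)) (h.det_ne_zero y hy) p

theorem cubicLow_eq (hn : 2 ≤ n) (hy : y ∈ U) (i j k : Fin n) : D.cubicLow y i j k =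
    |(D.g y).det| ^ (-(1 / (n : ℝ))) * (D.nablaMetric y i j k
      - tr12 (D.g y) (D.nablaMetric y) i * D.g y j k) := by
  have hm := h.isMetricPair hy
  have e := hm.sum_raise_lower (fun k => D.nablaMetric y i j k
      - tr12 (D.g y) (D.nablaMetric y) i * D.g y j k) k
  rw [← e, cubicLow, Finset.mul_sum]
  refine Finset.sum_congr rfl fun p _ => ?_
  rw [h.cubicTorsion_eq hn hy, H]
  ring

/-- θ is the logarithmic derivative of the scale |det g|^(-1/n) plus twice the Faraday primitive.
Symmetry of 𝓛 in its first two indices comes from zero conformal torsion, in the last two from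
symmetry of g; its trace vanishes by alignment. -/
theorem isAHOn (hn : 2 ≤ n) : D.IsAHOn U (fun z i =>
    pd i (fun w => |(D.g w).det| ^ (-(1 / (n : ℝ)))) z / |(D.g z).det| ^ (-(1 / (n : ℝ)))
      + tr12 (D.g z) (D.nablaMetric z) i) where
  isOpen := h.isOpen
  smooth_Γ := h.smooth_Γ
  smooth_H := fun y hy i j => (h.contDiffAt_scale hy _).mul (h.smooth_g y hy i j)
  smooth_Hinv := fun y hy i j => (h.contDiffAt_scale hy _).mul (h.contDiffAt_inv_g hy i j)
  smooth_cubic := fun y hy i j k => by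
    refine ContDiffAt.congr_of_eventuallyEq (f := fun z => ∑ p, (D.g z)⁻¹ k p *
      (D.nablaMetric z i j p - tr12 (D.g z) (D.nablaMetric z) i * D.g z j p))
      (ContDiffAt.sum fun p _ => (h.contDiffAt_inv_g hy k p).mul
        ((h.contDiffAt_nablaMetric hy i j p).sub
          ((h.contDiffAt_tr12 hy i).mul (h.smooth_g y hy j p)))) ?_
    filter_upwards [h.isOpen.mem_nhds hy] with z hz using h.cubicTorsion_eq hn hz i j k
  smooth_θ := fun y hy i => by
    have hp : |(D.g y).det| ^ (-(1 / (n : ℝ))) ≠ 0 :=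
      (Real.rpow_pos_of_pos (abs_pos.2 (h.det_ne_zero y hy)) _).ne'
    exact ((contDiffAt_pd i (h.contDiffAt_scale hy _)).div (h.contDiffAt_scale hy _) hp).add
      (h.contDiffAt_tr12 hy i)
  symm_Γ := h.symm_Γ
  metric := fun y hy => isMetricPair_H (h.symm_g y hy) (h.det_ne_zero y hy)
  nabla_H := fun y hy i j k => by
    have hp : |(D.g y).det| ^ (-(1 / (n : ℝ))) ≠ 0 :=
      (Real.rpow_pos_of_pos (abs_pos.2 (h.det_ne_zero y hy)) _).ne'
    have e : D.nabla D.H y i j k = _ := nabla_smul (h.contDiffAt_scale hy _) (h.smooth_g y hy) i j k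
    rw [e, h.cubicLow_eq hn hy, H, nablaMetric]
    field_simp
    ring
  cubic_symm := fun y hy i j k => by
    simp only [h.cubicTorsion_eq hn hy]
    refine Finset.sum_congr rfl fun p _ => ?_
    have := (h.nablaMetric_eq hn hy i j p).1
    rw [show D.nablaMetric y i j p - tr12 (D.g y) (D.nablaMetric y) i * D.g y j p =
      D.nablaMetric y j i p - tr12 (D.g y) (D.nablaMetric y) j * D.g y i p by linarith]
  cubicLow_symm := fun y hy i j k => by
    rw [h.cubicLow_eq hn hy, h.cubicLow_eq hn hy, h.nablaMetric_symm hy, h.symm_g y hy j k]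
  cubic_trace := fun y hy i => by
    have hm := h.isMetricPair hy
    have e : ∑ p, D.cubicTorsion y i p p = contr (fun i j => (D.g y)⁻¹ i j)
        (fun p q => D.nablaMetric y i p q - tr12 (D.g y) (D.nablaMetric y) i * D.g y p q) := by
      simp only [h.cubicTorsion_eq hn hy]
      rfl
    have e' : tr23 (D.g y) (D.nablaMetric y) i = contr (fun i j => (D.g y)⁻¹ i j)
        (fun p q => D.nablaMetric y i p q) := rfl
    rw [e, contr_sub, hm.contr_const_mul_metric, ← e', h.aligned y hy]
    ring

end IsAlignedOn

/-- det g acquires the factor f^n, and the exponent -1/n turns it into f⁻¹. -/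
theorem H_eq_of_conformal {f : ℝ} (hn : 2 ≤ n) (hf : 0 < f)
    (hg : D'.g y = f • D.g y) (h0 : (D.g y).det ≠ 0) :
    D'.H y = D.H y ∧ D'.Hinv y = D.Hinv y := by
  have hn0 : (n : ℝ) ≠ 0 := by positivity
  have hp := abs_pos.2 h0
  have hfn : 0 < f ^ n := pow_pos hf n
  have e1 : ∀ p : ℝ, |(D'.g y).det| ^ p = (f ^ n) ^ p * |(D.g y).det| ^ p := fun p => by
    rw [hg, Matrix.det_smul, Fintype.card_fin, abs_mul, abs_of_pos hfn,
      Real.mul_rpow hfn.le (abs_nonneg _)]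
  have e2 : (f ^ n) ^ (1 / (n : ℝ)) = f := by
    rw [← Real.rpow_natCast, ← Real.rpow_mul hf.le, mul_one_div_cancel hn0, Real.rpow_one]
  have e3 : (f ^ n) ^ (-(1 / (n : ℝ))) = f⁻¹ := by
    rw [Real.rpow_neg hfn.le, e2]
  constructor
  · funext i j
    rw [H, H, e1, e3, hg, Matrix.smul_apply, smul_eq_mul]
    field_simp
  · funext i j
    have : (D'.g y)⁻¹ = f⁻¹ • (D.g y)⁻¹ := by
      have e := Matrix.inv_smul' (D.g y) (Units.mk0 f hf.ne') (isUnit_iff_ne_zero.2 h0)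
      rw [hg]
      exact e
    rw [Hinv, Hinv, e1, e2, this, Matrix.smul_apply, smul_eq_mul]
    field_simp

/-- Two aligned connections which differ by `a_i δ_j^k + a_j δ_i^k + h_{ij} b^k` differ by a Weyl
type change given by the difference of their Faraday primitives. -/
theorem Γ_eq_of_aligned (hn : 2 ≤ n) (h : D.IsAlignedOn U) (h' : D'.IsAlignedOn U)
    (hg : D'.g = D.g) (hy : y ∈ U)
    (hab : ∃ a b : Fin n → ℝ, ∀ i j k, D'.Γ y i j k - D.Γ y i j k =
      a i * (if j = k then 1 else 0) + a j * (if i = k then 1 else 0) + D.g y i j * b k)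
    (i j k : Fin n) :
    D'.Γ y i j k = D.Γ y i j k
      + D.weylChange (fun z i => D.faraday z i - D'.faraday z i) y i j k := by
  obtain ⟨a, b, hab⟩ := hab
  have h2 : (2 : ℝ) ≤ n := by exact_mod_cast hn
  have hm := h.isMetricPair hy
  have hs := h.symm_g y hy
  have hΓ : ∀ i j k, D'.Γ y i j k = D.Γ y i j k + (a i * (if j = k then 1 else 0)
      + a j * (if i = k then 1 else 0) + D.g y i j * b k) := fun i j k => by
    linarith [hab i j k]
  let bl : Fin n → ℝ := fun k => ∑ p, b p * D.g y p k
  have e1 : ∀ i j k, ∑ p, (a i * (if j = p then 1 else 0)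
      + a j * (if i = p then 1 else 0) + D.g y i j * b p) * D.g y p k =
      a i * D.g y j k + a j * D.g y i k + D.g y i j * bl k := by
    intro i j k
    simp only [add_mul, Finset.sum_add_distrib, mul_assoc, ← Finset.mul_sum, bl]
    simp
  have e2 : ∀ i j k, D'.nablaMetric y i j k = D.nablaMetric y i j k - 2 * (a i * D.g y j k)
      - a j * D.g y i k - a k * D.g y i j - bl k * D.g y i j - bl j * D.g y i k := by
    intro i j k
    have e3 : ∑ p, D'.Γ y i k p * D.g y j p = ∑ p, D.Γ y i k p * D.g y j p
        + (a i * D.g y k j + a k * D.g y i j + D.g y i k * bl j) := by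
      rw [← e1, ← Finset.sum_add_distrib]
      exact Finset.sum_congr rfl fun p _ => by rw [hΓ, hs j p]; ring
    have e4 : ∑ p, D'.Γ y i j p * D.g y p k = ∑ p, D.Γ y i j p * D.g y p k
        + (a i * D.g y j k + a j * D.g y i k + D.g y i j * bl k) := by
      rw [← e1, ← Finset.sum_add_distrib]
      exact Finset.sum_congr rfl fun p _ => by rw [hΓ]; ring
    simp only [nablaMetric, nabla, hg]
    rw [e3, e4, hs k j]
    ring
  -- Here and in `c23`, the two traces of ∇'g occurring in the alignment condition, in terms of a
  -- and the lowered b.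
  have c12 : ∀ i, tr12 (D'.g y) (D'.nablaMetric y) i = tr12 (D.g y) (D.nablaMetric y) i
      - (n + 3) * a i - (n + 1) * bl i := by
    intro i
    have c : tr12 (D'.g y) (D'.nablaMetric y) i =
      contr (fun i j => (D.g y)⁻¹ i j) (fun p q => D'.nablaMetric y p q i) := by rw [hg]; rfl
    have c' : tr12 (D.g y) (D.nablaMetric y) i =
      contr (fun i j => (D.g y)⁻¹ i j) (fun p q => D.nablaMetric y p q i) := rfl
    rw [c, c']
    simp only [e2, contr_sub, contr_const_mul]
    rw [hm.contr_left, hm.contr_right, hm.contr_const_mul_metric, hm.contr_const_mul_metric,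
      hm.contr_right]
    ring
  have c23 : ∀ i, tr23 (D'.g y) (D'.nablaMetric y) i = tr23 (D.g y) (D.nablaMetric y) i
      - (2 * n + 2) * a i - 2 * bl i := by
    intro i
    have c : tr23 (D'.g y) (D'.nablaMetric y) i =
      contr (fun i j => (D.g y)⁻¹ i j) (fun p q => D'.nablaMetric y i p q) := by rw [hg]; rfl
    have c' : tr23 (D.g y) (D.nablaMetric y) i =
      contr (fun i j => (D.g y)⁻¹ i j) (fun p q => D.nablaMetric y i p q) := rfl
    rw [c, c']
    simp only [e2, contr_sub, contr_const_mul]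
    rw [hm.contr_const_mul_metric, hm.contr_left', hm.contr_right', hm.contr_right', hm.contr_left']
    ring
  have hbl : ∀ i, bl i = -a i := by
    intro i
    have e3 := h.aligned y hy i
    have e4 := h'.aligned y hy i
    rw [c12, c23, e3] at e4
    -- Subtracting the two alignment conditions leaves (n² + n - 2)(a + b) = 0, with b lowered.
    have e5 : ((n : ℝ) - 1) * (n + 2) * (bl i + a i) = 0 := by linear_combination e4
    have e6 : ((n : ℝ) - 1) * (n + 2) ≠ 0 := by
      apply mul_ne_zero <;> linarith
    linarith [(mul_eq_zero.1 e5).resolve_left e6]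
  have ha : ∀ i, D.faraday y i - D'.faraday y i = a i := by
    intro i
    rw [h.faraday_eq hn hy, h'.faraday_eq hn hy, c12, hbl]
    ring
  have hb : b k = -∑ p, (D.g y)⁻¹ k p * a p := by
    have := hm.sum_lower_raise b k
    rw [← this, ← Finset.sum_neg_distrib]
    refine Finset.sum_congr rfl fun q _ => ?_
    change _ * bl q = _
    rw [hbl]; ring
  have hp := abs_pos.2 (h.det_ne_zero y hy)
  have h1 : |(D.g y).det| ^ (1 / (n : ℝ)) * |(D.g y).det| ^ (-(1 / (n : ℝ))) = 1 := by
    rw [← Real.rpow_add hp]; simp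
  -- The scales of H and of its inverse cancel, so g may replace H in the last term of the Weyl
  -- change.
  have hr : D.H y i j * D.raise y a k = D.g y i j * ∑ p, (D.g y)⁻¹ k p * a p := by
    simp only [raise, Hinv, H, mul_assoc, ← Finset.mul_sum]
    linear_combination (D.g y i j * ∑ p, (D.g y)⁻¹ k p * a p) * h1
  rw [hΓ, weylChange]
  simp only [ha]
  change _ = _ + (_ - D.H y i j * D.raise y a k)
  rw [hr, hb]
  ring

end LocalData
end AHGeometry

/-! ### From structures on the manifold to pairs in a chart. -/

namespace AHGeometry

variable {n : ℕ} {M : Type*} [TopologicalSpace M] [ChartedSpace (Model n) M]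
  [IsManifold (𝓡 n) ∞ M]

theorem CPPair.IsAlignedRepresentative.isAlignedOn {S : CPPair n M} {nab : AffineConnection n M}
    (hnab : S.IsAlignedRepresentative nab) {h : PseudoMetric n M} (hh : h ∈ S.conf.carrier)
    (hc : ConformalTorsionVanishes nab h) {e : OpenPartialHomeomorph M (Model n)}
    (he : e ∈ IsManifold.maximalAtlas (𝓡 n) ∞ M) : (nab.inChart h e).IsAlignedOn e.target where
  isOpen := e.open_target
  smooth_Γ := fun _ hy i j k =>
    (nab.contDiffOn_christoffel he i j k).contDiffAt (e.open_target.mem_nhds hy)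
  smooth_g := fun _ hy i j => (h.contDiffOn_components he i j).contDiffAt (e.open_target.mem_nhds hy)
  symm_Γ := fun _ hy i j k => AffineConnection.christoffel_symm hnab.2.1 he hy i j k
  symm_g := fun _ _ _ _ => h.symm _ _ _
  det_ne_zero := fun _ hy => h.det_components_ne_zero he (e.map_target hy)
  aligned := fun y hy => hnab.2.2 h hh e he y hy
  codazzi := fun y hy => hc e he y hy

/-- Two members of a conformal projective structure differ, in a chart, by
`a_i δ_j^k + a_j δ_i^k + h_{ij} b^k`. -/
theorem ConformalProjectiveStructure.exists_christoffel_sub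
    (P : ConformalProjectiveStructure n M) {nab nab' : AffineConnection n M}
    (hnab : nab ∈ P.carrier) (hnab' : nab' ∈ P.carrier) {h : PseudoMetric n M}
    (hh : h ∈ P.conf.carrier) {e : OpenPartialHomeomorph M (Model n)}
    (he : e ∈ IsManifold.maximalAtlas (𝓡 n) ∞ M) {y : Model n} (hy : y ∈ e.target) :
    ∃ a b : Fin n → ℝ, ∀ i j k, nab'.christoffel e y i j k - nab.christoffel e y i j k =
      a i * (if j = k then 1 else 0) + a j * (if i = k then 1 else 0)
        + (nab.inChart h e).g y i j * b k := by
  obtain ⟨nab₀, -, hP⟩ := P.isClass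
  rw [hP] at hnab hnab'
  obtain ⟨a, b, hab⟩ := hnab.2.exists_christoffel_sub hh he hy
  obtain ⟨a', b', hab'⟩ := hnab'.2.exists_christoffel_sub hh he hy
  -- Both connections are compared with the one generating the class.
  refine ⟨a' - a, b' - b, fun i j k => ?_⟩
  have hg : (nab.inChart h e).g y i j = (nab₀.inChart h e).g y i j := rfl
  rw [hg, Pi.sub_apply, Pi.sub_apply, Pi.sub_apply]
  linear_combination hab' i j k - hab i j k

/-- The second structure may be written with another metric h', as only H matters. The two Faraday
primitives, however, depend on the metric and must both be taken for h. -/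
theorem CPPair.Generates.isAHPairOn (hn : 2 ≤ n) {P : CodazziProjectiveStructure n M}
    {S S' : CPPair n M} (hS : S.Generates P.toConformalProjectiveStructure)
    (hS' : S'.Generates P.toConformalProjectiveStructure) {nab nab' : AffineConnection n M}
    (hnab : S.IsAlignedRepresentative nab) (hnab' : S'.IsAlignedRepresentative nab')
    {h h' : PseudoMetric n M} (hh : h ∈ P.conf.carrier) (hh' : h' ∈ P.conf.carrier)
    {e : OpenPartialHomeomorph M (Model n)} (he : e ∈ IsManifold.maximalAtlas (𝓡 n) ∞ M) :
    ∃ θ θ', (nab.inChart h e).IsAHPairOn (nab'.inChart h' e) e.target θ θ'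
      (fun z i => (nab.inChart h e).faraday z i - (nab'.inChart h e).faraday z i) := by
  have hP := hS.2 nab hnab.1 hnab.2.1
  have hP' := hS'.2 nab' hnab'.1 hnab'.2.1
  have a1 : (nab.inChart h e).IsAlignedOn e.target :=
    hnab.isAlignedOn (hS.1 ▸ hh) (P.codazzi nab hP h hh) he
  have a2 : (nab'.inChart h e).IsAlignedOn e.target :=
    hnab'.isAlignedOn (hS'.1 ▸ hh) (P.codazzi nab' hP' h hh) he
  have a3 : (nab'.inChart h' e).IsAlignedOn e.target :=
    hnab'.isAlignedOn (hS'.1 ▸ hh') (P.codazzi nab' hP' h' hh') he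
  obtain ⟨f, hf, hff⟩ := ConformalStructure.exists_factor hh hh'
  have hH : ∀ y ∈ e.target, (nab'.inChart h' e).H y = (nab.inChart h e).H y ∧
      (nab'.inChart h' e).Hinv y = (nab.inChart h e).Hinv y := fun y hy =>
    LocalData.H_eq_of_conformal hn (hf (e.symm y)) (by ext i j; exact hff _ _ _)
      (a1.det_ne_zero y hy)
  exact ⟨_, _, {
    left := a1.isAHOn hn
    right := a3.isAHOn hn
    H_eq := fun y hy => (hH y hy).1
    Hinv_eq := fun y hy => (hH y hy).2
    smooth := fun y hy i => (a1.contDiffAt_faraday hn hy i).sub (a2.contDiffAt_faraday hn hy i)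
    Γ_eq := fun y hy => LocalData.Γ_eq_of_aligned hn a1 a2 rfl hy
      (P.exists_christoffel_sub hP hP' hh he hy) }⟩

end AHGeometry

end

theorem mainTheorem13 {n : ℕ} (hn : 2 ≤ n) {M : Type*} [TopologicalSpace M]
    [ChartedSpace (AHGeometry.Model n) M] [IsManifold (𝓡 n) ∞ M]
    (P : AHGeometry.CodazziProjectiveStructure n M) (S S' : AHGeometry.AHStructure n M)
    (hS : S.Generates P.toConformalProjectiveStructure)
    (hS' : S'.Generates P.toConformalProjectiveStructure)
    (nab nab' : AHGeometry.AffineConnection n M)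
    (hnab : S.IsAlignedRepresentative nab) (hnab' : S'.IsAlignedRepresentative nab')
    (h h' : AHGeometry.PseudoMetric n M)
    (hh : h ∈ P.conf.carrier) (hh' : h' ∈ P.conf.carrier)
    (e : OpenPartialHomeomorph M (AHGeometry.Model n))
    (he : e ∈ IsManifold.maximalAtlas (𝓡 n) ∞ M)
    (y : AHGeometry.Model n) (hy : y ∈ e.target)
    (D D' : AHGeometry.LocalData n) (hD : D = nab.inChart h e) (hD' : D' = nab'.inChart h' e)
    (α : Fin n → ℝ)
    (hα : ∀ i, α i = (nab.inChart h e).faraday y i - (nab'.inChart h e).faraday y i) :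
    -- the one-form `α` is the one which describes the difference tensor
    (∀ i j k, D'.Γ y i j k - D.Γ y i j k =
      α i * (if j = k then 1 else 0) + α j * (if i = k then 1 else 0)
        - D.H y i j * D.raise y α k) ∧
    -- invariance of the Weyl tensors
    (∀ i j k l, D'.A4 y i j k l = D.A4 y i j k l) ∧
    (∀ i j k l, D'.E4 y i j k l = D.E4 y i j k l) ∧
    (2 < n →
      -- transformation of the Cotton tensors
      (∀ i j k, D'.W3 y i j k = D.W3 y i j k - ∑ p, D.raise y α p * D.W4 y i j k p) ∧
      (∀ i j k, D'.A3 y i j k = D.A3 y i j k - ∑ p, D.raise y α p * D.A4 y i j k p) ∧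
      (∀ i j k, D'.E3 y i j k = D.E3 y i j k - ∑ p, D.raise y α p * D.E4 y i j k p) ∧
      -- invariance of the trace
      (∀ i, D'.A1 y i = D.A1 y i)) ∧
    (n = 3 →
      (∀ i j k l, D.A4 y i j k l = 0) ∧ (∀ i j k, D'.A3 y i j k = D.A3 y i j k)) := by
  obtain ⟨θ, θ', hp⟩ := hS.isAHPairOn hn hS' hnab hnab' hh hh' he
  rw [← hD, ← hD'] at hp
  -- α is prescribed only at y; it is replaced by the value there of a one-form defined on the whole
  -- chart, so that it can be differentiated.
  obtain rfl : α = fun i => D.faraday y i - (nab'.inChart h e).faraday y i := by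
    funext i
    rw [hα i, hD]
  refine ⟨fun i j k => ?_, (hp.curvatureChange hn hy).A4_eq hn, (hp.curvatureChange hn hy).E4_eq hn,
    fun hn' => ⟨hp.W3_change hn' hy, hp.A3_change hn' hy, hp.E3_change hn' hy, hp.A1_eq hn' hy⟩,
    ?_⟩
  · rw [hp.Γ_eq y hy, add_sub_cancel_left]
    rfl
  · rintro rfl
    have h0 := AHGeometry.LocalData.A4_eq_zero_of_three (hp.left.metric y hy)
    refine ⟨h0, fun i j k => ?_⟩
    rw [hp.A3_change (by norm_num) hy]
    simp [AHGeometry.LocalData.pair, h0]
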